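/- **Setting.** Let $r_0,\Omega,H,l>0$ and let $\mathcal I_0=(a,b)$ be a bounded interval with $0<a$. Put $\mathcal W=[0,\tfrac1{2r_0^2})\times[0,H]$, with points ${\bf p}=(s,z)$, and $\mathbb R^2_+=[0,\infty)^2$, with points ${\bf q}=(\Upsilon,Z)$. Let $B_l$ be the open Euclidean disc of radius $l$ about $0$, $B_l^+=B_l\cap(0,\infty)^2$, $f_0(s)=\frac{r_0^2\Omega^2}{2(1-2r_0^2s)}$ and $c({\bf p},m,{\bf q})=s\Upsilon+zZ/m$. Let $\theta_0:[0,H]\to\mathcal I_0$ be smooth on $(0,H)$ with * (A1) $\theta_0(z)-z\theta_0'(z)>0$ on $(0,H)$; * (A2) $\theta_0$ is Lipschitz on $[0,H]$. Condition (A1') is $\inf_{0<z<H}(\theta_0(z)-z\theta_0'(z))>0$. Put $\phi(z)=z/\theta_0(z)$ (injective on $[0,H]$ by (A1)) and ${\bf f}(s,z)=(s,\phi(z))$. Let $\mathcal R$ be the set of Borel functions $\varrho:[0,H]\to[0,\frac1{2r_0^2})$. For $\varrho\in\mathcal R$ let $\mu_\varrho$ be the measure on $\mathbb R^2$ with Lebesgue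 density $(2f_0(s)/\Omega^2)^2\,\chi_{\{0\le s\le\varrho(z),\,0\le z\le H\}}$, and let $\mathcal R_0=\{\varrho\in\mathcal R:\mu_\varrho\text{ is a probability measure}\}$. Let $\sigma$ be a Borel probability measure on $\mathbb R^2$ with $\sigma(\mathbb R^2\setminus B_l^+)=0$ (for instance $\mathrm{spt}\,\sigma\subset B_l^+$). With ${\bf m}_2[\sigma]=\int\frac12|{\bf q}|^2d\sigma$ and $W_2$ the quadratic Wasserstein distance, define for $\varrho\in\mathcal R_0$ $$\mathcal K[\sigma](\varrho)=\tfrac12W_2^2(\sigma,{\bf f}\#\mu_\varrho)+\int\Big(f_0(s)-\tfrac12\Big(s^2+\frac{z^2}{\theta_0^2(z)}\Big)\Big)d\mu_\varrho\in(-\infty,\infty]$$ and $\mathcal K[\sigma]=+\infty$ on $\mathcal R\setminus\mathcal R_0$. Let $\mathcal U$ be the set of pairs $(P,\Psi)\in C(\overline{\mathcal W\times\mathcal I_0})\times C(\mathbb R^2_+)$ with $P({\bf p},m)+\Psi({\bf q})\ge c({\bf p},m,{\bf q})$ on $\mathcal W\times\mathcal I_0\times\mathbb R^2_+$, and on $\mathcal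 U$ put $$\mathcal J[\sigma](P,\Psi)=-\int\Psi\,d\sigma+\inf_{\varrho\in\mathcal R}\int_0^H\!\!\int_0^{\varrho(z)}\big(f_0(s)-P(s,z,\theta_0(z))\big)\Big(\frac{2f_0(s)}{\Omega^2}\Big)^2ds\,dz .$$ Let $\mathcal U_0$ be the set of $(P,\Psi)\in\mathcal U$ with $P({\bf p},m)=\sup_{{\bf q}\in\overline{B_l^+}}\{c({\bf p},m,{\bf q})-\Psi({\bf q})\}$ on $\mathcal W\times\mathcal I_0$ and $\Psi({\bf q})=\sup_{({\bf p},m)\in\mathcal W\times\mathcal I_0}\{c({\bf p},m,{\bf q})-P({\bf p},m)\}$ on $B_l\cap\mathbb R^2_+$. A *dual maximizer* is a pair in $\mathcal U_0$ that maximizes $\mathcal J[\sigma]$ over $\mathcal U$. Put $$\mathcal T[P]({\bf p})=\big(\partial_sP({\bf p},\theta_0(z)),\ \theta_0(z)\,\partial_zP({\bf p},\theta_0(z))\big),\qquad \mathcal S[\Psi]({\bf q})=\big(\partial_\Upsilon\Psi({\bf q}),\ \phi^{-1}(\partial_Z\Psi({\bf q}))\big),$$ where the derivatives of $P$ are taken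 with its third argument $m$ held fixed. **Proposition.** $\mathcal K[\sigma]$ has a minimizer over $\mathcal R_0$, unique up to equality a.e. on $[0,H]$. It has a representative $\varrho_0$, monotone nondecreasing on $[0,H]$, such that the following hold. (i) Let $(P_0,\Psi_0)$ be any dual maximizer. Then for $\mu_{\varrho_0}$-a.e. ${\bf p}=(s,z)$ the function $P_0(\cdot,\theta_0(z))$ is differentiable at ${\bf p}$, and $$\mathcal T[P_0]\#\mu_{\varrho_0}=\sigma,\qquad \mathcal K[\sigma](\varrho_0)=\mathcal J[\sigma](P_0,\Psi_0)+{\bf m}_2[\sigma].$$ Moreover, for every $z\in[0,H]$ with $\varrho_0(z)>0$, $$2\,(1-2r_0^2\varrho_0(z))\,P_0(\varrho_0(z),z,\theta_0(z))=r_0^2\Omega^2 .$$ If in addition $\sigma$ is absolutely continuous with respect to Lebesgue measure, then for $\sigma$-a.e. ${\bf q}$ the function $\Psi_0$ is differentiable at ${\bf q}$ with $\partial_Z\Psi_0({\bf q})\in\phi([0,H])$; further $\mathcal S[\Psi_0]\#\sigma=\mu_{\varrho_0}$, $\mathcal S[\Psi_0]\circ\mathcal T[P_0]={\bf id}$ $\mu_{\varrho_0}$-a.e.,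 and $\mathcal T[P_0]\circ\mathcal S[\Psi_0]={\bf id}$ $\sigma$-a.e. (ii) Let $\sigma$ be absolutely continuous with $\mathrm{spt}\,\sigma=\overline{B_l^+}$ and $\frac{d\sigma}{d\mathcal L^2}>c_0$ a.e. on $B_l^+$ for some constant $c_0>0$. If $(P_0,\Psi_0)$ is a dual maximizer and $(P_1,\Psi_1)\in\mathcal U_0$ satisfies $\mathcal J[\sigma](P_1,\Psi_1)=\mathcal J[\sigma](P_0,\Psi_0)$, then $P_1=P_0$ on $\mathcal W\times\mathcal I_0$ and $\Psi_1=\Psi_0$ on $B_l^+$. (iii) Assume (A1'), and let $(P_0,\Psi_0)$ be a dual maximizer with $\partial_zP_0\ge b_0$ $\mathcal L^3$-a.e. on $\mathcal W\times\mathcal I_0$ for some constant $b_0>0$. Then there is $C>0$ such that $|z_2-z_1|\le C\,|\varrho_0(z_2)-\varrho_0(z_1)|$ for all $z_1,z_2\in[0,H]$ with $\varrho_0(z_1),\varrho_0(z_2)>0$. -/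

import Mathlib

open MeasureTheory Set
open scoped ContDiff

noncomputable section

namespace Vortex

/-- The physical domain `𝒲 = [0, 1/(2r₀²)) × [0, H]`, with points `p = (s, z)`. -/
def W (r₀ H : ℝ) : Set (ℝ × ℝ) := Ico 0 (1 / (2 * r₀ ^ 2)) ×ˢ Icc 0 H

/-- The closed quadrant `ℝ²₊ = [0,∞)²`, with points `q = (Υ, Z)`. -/
def quadrant : Set (ℝ × ℝ) := Ici 0 ×ˢ Ici 0

/-- The open Euclidean disc of radius `l` centred at the origin of `ℝ²`
(the product type `ℝ × ℝ` carries the sup norm, so the disc is written out). -/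
def disc (l : ℝ) : Set (ℝ × ℝ) := {q | q.1 ^ 2 + q.2 ^ 2 < l ^ 2}

/-- `B_l⁺ = B_l ∩ (0,∞)²`. -/
def discPlus (l : ℝ) : Set (ℝ × ℝ) := disc l ∩ (Ioi 0 ×ˢ Ioi 0)

/-- `f₀(s) = r₀²Ω² / (2(1 - 2r₀²s))`. -/
def f₀ (r₀ Ω s : ℝ) : ℝ := r₀ ^ 2 * Ω ^ 2 / (2 * (1 - 2 * r₀ ^ 2 * s))

/-- The standing assumptions on the ambient temperature `θ₀ : [0,H] → (a,b)`: smoothness on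
`(0,H)`, condition (A1) `θ₀(z) - zθ₀'(z) > 0`, and condition (A2), Lipschitz continuity.
Only the values of `θ` on `[0,H]` are ever used. -/
structure IsAmbient (H a b : ℝ) (θ : ℝ → ℝ) : Prop where
  mapsTo : MapsTo θ (Icc 0 H) (Ioo a b)
  smooth : ContDiffOn ℝ ∞ θ (Ioo 0 H)
  condA1 : ∀ z ∈ Ioo 0 H, 0 < θ z - z * deriv θ z
  condA2 : ∃ L, LipschitzOnWith L θ (Icc 0 H)

/-- Condition (A1'): `inf (θ₀(z) - zθ₀'(z)) > 0`. -/
def CondA1' (H : ℝ) (θ : ℝ → ℝ) : Prop :=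
  ∃ ε > 0, ∀ z ∈ Ioo 0 H, ε ≤ θ z - z * deriv θ z

/-- `φ(z) = z / θ₀(z)`. -/
def phi (θ : ℝ → ℝ) (z : ℝ) : ℝ := z / θ z

/-- `𝐟(s,z) = (s, z/θ₀(z))`. -/
def bff (θ : ℝ → ℝ) (p : ℝ × ℝ) : ℝ × ℝ := (p.1, phi θ p.2)

/-- The cost `c(p,m,q) = sΥ + zZ/m`. -/
def cost (p : ℝ × ℝ) (m : ℝ) (q : ℝ × ℝ) : ℝ := p.1 * q.1 + p.2 * q.2 / m

/-- `ℛ`: the Borel functions `[0,H] → [0, 1/(2r₀²))`. -/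
def R (r₀ H : ℝ) : Set (ℝ → ℝ) :=
  {ϱ | Measurable ((Icc 0 H).domRestrict ϱ) ∧ MapsTo ϱ (Icc 0 H) (Ico 0 (1 / (2 * r₀ ^ 2)))}

/-- `D_ϱ = {(s,z) : 0 ≤ s ≤ ϱ(z), z ∈ [0,H]}`. -/
def D (H : ℝ) (ϱ : ℝ → ℝ) : Set (ℝ × ℝ) :=
  {p | p.2 ∈ Icc 0 H ∧ 0 ≤ p.1 ∧ p.1 ≤ ϱ p.2}

/-- The measure `μ_ϱ` with Lebesgue density `(2f₀(s)/Ω²)² 1_{D_ϱ}(s,z)`. -/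
def mu (r₀ Ω H : ℝ) (ϱ : ℝ → ℝ) : Measure (ℝ × ℝ) :=
  (volume.restrict (D H ϱ)).withDensity
    fun p => ENNReal.ofReal ((2 * f₀ r₀ Ω p.1 / Ω ^ 2) ^ 2)

/-- `ℛ₀`: those `ϱ ∈ ℛ` for which `μ_ϱ` is a probability measure. -/
def R₀ (r₀ Ω H : ℝ) : Set (ℝ → ℝ) :=
  {ϱ | ϱ ∈ R r₀ H ∧ IsProbabilityMeasure (mu r₀ Ω H ϱ)}

/-- The squared quadratic Wasserstein distance on `ℝ²` for the Euclidean distance. -/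
def W2sq (μ ν : Measure (ℝ × ℝ)) : ENNReal :=
  ⨅ γ ∈ {γ : Measure ((ℝ × ℝ) × (ℝ × ℝ)) | γ.map Prod.fst = μ ∧ γ.map Prod.snd = ν},
    ∫⁻ x, ENNReal.ofReal ((x.1.1 - x.2.1) ^ 2 + (x.1.2 - x.2.2) ^ 2) ∂γ

open Classical in
/-- The primal functional, with values in `(-∞, ∞]`:
`𝒦[σ](ϱ) = ½W₂²(σ, 𝐟#μ_ϱ) + ∫ (f₀(s) - ½(s² + z²/θ₀(z)²)) dμ_ϱ` for `ϱ ∈ ℛ₀`, and `∞` otherwise.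
On `D_ϱ` the function `f₀` is positive and possibly not integrable, so its integral is taken in
`[0,∞]`; the remaining integrand is bounded. -/
def K (r₀ Ω H : ℝ) (θ : ℝ → ℝ) (σ : Measure (ℝ × ℝ)) (ϱ : ℝ → ℝ) : EReal :=
  if ϱ ∈ R₀ r₀ Ω H then
    (((1 / 2 : ENNReal) * W2sq σ ((mu r₀ Ω H ϱ).map (bff θ)) : ENNReal) : EReal)
      + ((∫⁻ p, ENNReal.ofReal (f₀ r₀ Ω p.1) ∂(mu r₀ Ω H ϱ) : ENNReal) : EReal)
      - ((∫ p, (1 / 2) * (p.1 ^ 2 + p.2 ^ 2 / θ p.2 ^ 2) ∂(mu r₀ Ω H ϱ) : ℝ) : EReal)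
  else ⊤

/-- `𝐦₂[σ] = ∫ ½|q|² dσ`. -/
def m₂ (σ : Measure (ℝ × ℝ)) : ℝ := ∫ q, (1 / 2) * (q.1 ^ 2 + q.2 ^ 2) ∂σ

/-- `𝒮_{θ₀}[P](ϱ,z) = ∫₀^ϱ (f₀(s) - P(s,z,θ₀(z))) (2f₀(s)/Ω²)² ds`. -/
def Sfun (r₀ Ω : ℝ) (θ : ℝ → ℝ) (P : ℝ × ℝ → ℝ → ℝ) (ϱ z : ℝ) : ℝ :=
  ∫ s in (0 : ℝ)..ϱ, (f₀ r₀ Ω s - P (s, z) (θ z)) * (2 * f₀ r₀ Ω s / Ω ^ 2) ^ 2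

/-- `ℋ(P) = inf_{ϱ ∈ ℛ} ∫₀^H 𝒮_{θ₀}[P](ϱ(z),z) dz`. For bounded `P` the integrand is bounded below,
so a `ϱ` with a non-integrable integrand has the value `+∞` and is left out of the infimum;
`ϱ = 0` is always admissible. -/
def scrH (r₀ Ω H : ℝ) (θ : ℝ → ℝ) (P : ℝ × ℝ → ℝ → ℝ) : ℝ :=
  sInf {x | ∃ ϱ ∈ R r₀ H, IntegrableOn (fun z => Sfun r₀ Ω θ P (ϱ z) z) (Icc 0 H) ∧
    x = ∫ z in Icc 0 H, Sfun r₀ Ω θ P (ϱ z) z}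

/-- The dual functional `𝒥[σ](P,Ψ) = -∫ Ψ dσ + ℋ(P)`. -/
def J (r₀ Ω H : ℝ) (θ : ℝ → ℝ) (σ : Measure (ℝ × ℝ))
    (x : (ℝ × ℝ → ℝ → ℝ) × (ℝ × ℝ → ℝ)) : ℝ :=
  -(∫ q, x.2 q ∂σ) + scrH r₀ Ω H θ x.1

/-- `𝒰`: the pairs `(P,Ψ)` of continuous functions, `P` on the closure of `𝒲 × (a,b)` and `Ψ` on
`ℝ²₊`, with `P(p,m) + Ψ(q) ≥ c(p,m,q)` on `𝒲 × (a,b) × ℝ²₊`. Values elsewhere play no role. -/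
def U (r₀ H a b : ℝ) : Set ((ℝ × ℝ → ℝ → ℝ) × (ℝ × ℝ → ℝ)) :=
  {x | ContinuousOn (fun y : (ℝ × ℝ) × ℝ => x.1 y.1 y.2) (closure (W r₀ H ×ˢ Ioo a b)) ∧
    ContinuousOn x.2 quadrant ∧
    ∀ p ∈ W r₀ H, ∀ m ∈ Ioo a b, ∀ q ∈ quadrant, cost p m q ≤ x.1 p m + x.2 q}

/-- `𝒰₀`: the pairs in `𝒰` that are `c`-transforms of each other,
`P(p,m) = sup {c(p,m,q) - Ψ(q) : q ∈ closure B_l⁺}` on `𝒲 × (a,b)` and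
`Ψ(q) = sup {c(p,m,q) - P(p,m) : (p,m) ∈ 𝒲 × (a,b)}` for `q ∈ B_l` (in the domain of `Ψ`). -/
def U₀ (r₀ H a b l : ℝ) : Set ((ℝ × ℝ → ℝ → ℝ) × (ℝ × ℝ → ℝ)) :=
  {x | x ∈ U r₀ H a b ∧
    (∀ p ∈ W r₀ H, ∀ m ∈ Ioo a b,
      IsLUB ((fun q => cost p m q - x.2 q) '' closure (discPlus l)) (x.1 p m)) ∧
    (∀ q ∈ disc l ∩ quadrant,
      IsLUB ((fun y : (ℝ × ℝ) × ℝ => cost y.1 y.2 q - x.1 y.1 y.2) '' (W r₀ H ×ˢ Ioo a b))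
        (x.2 q))}

/-- `x = (P,Ψ)` lies in `𝒰₀` and maximizes `𝒥[σ]` over `𝒰`. -/
def IsDualMaximizer (r₀ Ω H a b l : ℝ) (θ : ℝ → ℝ) (σ : Measure (ℝ × ℝ))
    (x : (ℝ × ℝ → ℝ → ℝ) × (ℝ × ℝ → ℝ)) : Prop :=
  x ∈ U₀ r₀ H a b l ∧ IsMaxOn (J r₀ Ω H θ σ) (U r₀ H a b) x

/-- `𝒯[P](p) = (∂ₛP(p,θ₀(z)), θ₀(z) ∂_zP(p,θ₀(z)))`, `p = (s,z)`; the partial derivatives are taken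
with the third argument `m` of `P` frozen at `θ₀(z)`. -/
def T (θ : ℝ → ℝ) (P : ℝ × ℝ → ℝ → ℝ) (p : ℝ × ℝ) : ℝ × ℝ :=
  (deriv (fun s => P (s, p.2) (θ p.2)) p.1, θ p.2 * deriv (fun z => P (p.1, z) (θ p.2)) p.2)

/-- `∂_ZΨ(q)`. -/
def dZ (Ψ : ℝ × ℝ → ℝ) (q : ℝ × ℝ) : ℝ := deriv (fun Z => Ψ (q.1, Z)) q.2

/-- `𝒮[Ψ](q) = (∂_ΥΨ(q), φ⁻¹(∂_ZΨ(q)))`, with `φ⁻¹` the inverse of `φ` on `[0,H]`. -/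
def S (H : ℝ) (θ : ℝ → ℝ) (Ψ : ℝ × ℝ → ℝ) (q : ℝ × ℝ) : ℝ × ℝ :=
  (deriv (fun Υ => Ψ (Υ, q.2)) q.1, Function.invFunOn (phi θ) (Icc 0 H) (dZ Ψ q))

end Vortex

end

namespace Vortex

open Filter Topology

/-! The cost is the Euclidean pairing of `(s, z/m)` with `q`, so the temperature enters the dual
problem only through the ratio `ζ = z/m`. A pair in `U₀` is thus a planar Legendre pair: `P(p,m)` is
the value of `pot l Ψ` at `(s, z/m)`, and on the disc `Ψ` is the conjugate of that potential over
`srcRect`. The dual problem becomes the maximization of `dualJ` over continuous functions `ψ` on the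
closed quarter disc, with the infimum over `ϱ` taken height by height.

At each height the blow-up of `f₀` makes the set of optimal depths nonempty and compact. The
potential increases with `ζ`, and `φ` increases with `z`, so the least optimal depth `lo` and the
greatest one `hi` are nondecreasing. Replacing `ψ` by its double conjugate does not lower `dualJ`
and gives equi-Lipschitz functions, so Arzelà-Ascoli yields a maximizer (`exists_isMaxDual`).

The core is `map_grad_eq`: at a maximizer the gradient of the potential carries the layer of depth
`lo` to `σ`. Vary `ψ` to `ψ + εh`. Optimal depths need not be unique, so the perturbed layers are
controlled only outside the gap between `lo` and `hi`. But off countably many heights a gap forces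
the potential to be constant in `ζ` to the right, so its gradient there lies on the axis `Z = 0`.
Test functions vanishing on that axis do not see the gap (`tendsto_variation`). Since `σ` does not
charge the axis, it only remains to bound the mass of the layer by that of `σ`, which follows from
variation by positive constants (`mu_lo_real_univ_le`).

The transport identity gives the mass constraint and, by equality in Fenchel's inequality, the
absence of a duality gap (`K_lo_eq`). Any other minimizer has optimal depths at almost every height,
hence depths at least `lo`; as its mass is the same, it agrees with `lo` almost everywhere
(`ae_eq_lo`). The free boundary equation is the first-order condition for the depth, and the inverse
map comes from the symmetry of Legendre contact.

For (ii), the optimal map of one maximizer realizes contact for every other one, so full support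
gives common subgradients. The potentials then differ by a constant, which the free boundary
equation fixes. For (iii), the free boundary equation is subtracted at two heights. -/

/-! ### Conjugate functions on the plane -/

/-- The Euclidean pairing on `ℝ²`. -/
def dot (x q : ℝ × ℝ) : ℝ := x.1 * q.1 + x.2 * q.2

lemma dot_comm (x q : ℝ × ℝ) : dot x q = dot q x := by unfold dot; ring

lemma continuous_dot : Continuous fun z : (ℝ × ℝ) × (ℝ × ℝ) => dot z.1 z.2 := by
  unfold dot; fun_prop

lemma continuous_dot_right (x : ℝ × ℝ) : Continuous fun q => dot x q := by
  unfold dot; fun_prop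

/-- The Legendre conjugate of `ψ`, with the supremum taken over `K`. -/
noncomputable def conj (K : Set (ℝ × ℝ)) (ψ : ℝ × ℝ → ℝ) (x : ℝ × ℝ) : ℝ :=
  sSup ((fun q => dot x q - ψ q) '' K)

/-- The gradient of a function on the plane, read off from its Fréchet derivative. -/
noncomputable def grad (f : ℝ × ℝ → ℝ) (x : ℝ × ℝ) : ℝ × ℝ :=
  (fderiv ℝ f x (1, 0), fderiv ℝ f x (0, 1))

section Conj

variable {K : Set (ℝ × ℝ)} {ψ χ : ℝ × ℝ → ℝ} {x y q : ℝ × ℝ} {R : ℝ}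

lemma exists_conj_eq (hK : IsCompact K) (hne : K.Nonempty) (hψ : ContinuousOn ψ K) (x : ℝ × ℝ) :
    ∃ q ∈ K, conj K ψ x = dot x q - ψ q ∧ ∀ q' ∈ K, dot x q' - ψ q' ≤ dot x q - ψ q := by
  obtain ⟨q, hq, hmax⟩ := hK.exists_isMaxOn hne
    ((continuous_dot_right x).continuousOn.sub hψ)
  refine ⟨q, hq, ?_, fun q' hq' => hmax hq'⟩
  exact IsGreatest.csSup_eq ⟨⟨q, hq, rfl⟩, by rintro _ ⟨q', hq', rfl⟩; exact hmax hq'⟩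

lemma le_conj (hK : IsCompact K) (hψ : ContinuousOn ψ K) (hq : q ∈ K) :
    dot x q - ψ q ≤ conj K ψ x := by
  obtain ⟨q', -, h, hmax⟩ := exists_conj_eq hK ⟨q, hq⟩ hψ x
  rw [h]; exact hmax q hq

lemma conj_le {b : ℝ} (hne : K.Nonempty) (h : ∀ q ∈ K, dot x q - ψ q ≤ b) : conj K ψ x ≤ b := by
  refine csSup_le (hne.image _) ?_
  rintro _ ⟨q, hq, rfl⟩
  exact h q hq

lemma isLUB_conj (hK : IsCompact K) (hne : K.Nonempty) (hψ : ContinuousOn ψ K) (x : ℝ × ℝ) :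
    IsLUB ((fun q => dot x q - ψ q) '' K) (conj K ψ x) := by
  refine ⟨?_, fun b hb => conj_le hne fun q hq => hb ⟨q, hq, rfl⟩⟩
  rintro _ ⟨q, hq, rfl⟩
  exact le_conj hK hψ hq

lemma conj_congr (h : ∀ q ∈ K, ψ q = χ q) : conj K ψ = conj K χ := by
  funext x
  unfold conj
  congr 1
  exact image_congr fun q hq => by simp only [h q hq]

lemma conj_sub_conj_le (hK : IsCompact K) (hne : K.Nonempty) (hψ : ContinuousOn ψ K)
    (hR : ∀ q ∈ K, |q.1| ≤ R ∧ |q.2| ≤ R) :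
    conj K ψ x - conj K ψ y ≤ R * |x.1 - y.1| + R * |x.2 - y.2| := by
  obtain ⟨q, hq, h, -⟩ := exists_conj_eq hK hne hψ x
  have h1 := le_conj (x := y) hK hψ hq
  have h2 : (x.1 - y.1) * q.1 ≤ R * |x.1 - y.1| := by
    refine (le_abs_self _).trans ?_
    rw [abs_mul, mul_comm]
    exact mul_le_mul_of_nonneg_right (hR q hq).1 (abs_nonneg _)
  have h3 : (x.2 - y.2) * q.2 ≤ R * |x.2 - y.2| := by
    refine (le_abs_self _).trans ?_
    rw [abs_mul, mul_comm]
    exact mul_le_mul_of_nonneg_right (hR q hq).2 (abs_nonneg _)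
  rw [h]
  unfold dot at *
  linarith

lemma abs_conj_sub_conj_le (hK : IsCompact K) (hne : K.Nonempty) (hψ : ContinuousOn ψ K)
    (hR : ∀ q ∈ K, |q.1| ≤ R ∧ |q.2| ≤ R) :
    |conj K ψ x - conj K ψ y| ≤ R * |x.1 - y.1| + R * |x.2 - y.2| := by
  rw [abs_sub_le_iff]
  refine ⟨conj_sub_conj_le hK hne hψ hR, ?_⟩
  rw [abs_sub_comm x.1, abs_sub_comm x.2]
  exact conj_sub_conj_le hK hne hψ hR

/-- The constant depends only on the size of `K`, not on `ψ`. Double conjugates are therefore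
equi-Lipschitz, and potentials are differentiable almost everywhere. -/
lemma lipschitzWith_conj (hK : IsCompact K) (hne : K.Nonempty) (hψ : ContinuousOn ψ K)
    (hR0 : 0 ≤ R) (hR : ∀ q ∈ K, |q.1| ≤ R ∧ |q.2| ≤ R) :
    LipschitzWith (Real.toNNReal (2 * R)) (conj K ψ) := by
  refine LipschitzWith.of_dist_le_mul fun x y => ?_
  rw [Real.dist_eq, Real.coe_toNNReal _ (by positivity)]
  have h1 : |x.1 - y.1| ≤ dist x y := by
    rw [← Real.dist_eq, Prod.dist_eq]; exact le_max_left _ _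
  have h2 : |x.2 - y.2| ≤ dist x y := by
    rw [← Real.dist_eq, Prod.dist_eq]; exact le_max_right _ _
  have := abs_conj_sub_conj_le (x := x) (y := y) hK hne hψ hR
  nlinarith [mul_le_mul_of_nonneg_left h1 hR0, mul_le_mul_of_nonneg_left h2 hR0]

lemma exists_bound_of_isCompact (hK : IsCompact K) :
    ∃ R, 0 ≤ R ∧ ∀ q ∈ K, |q.1| ≤ R ∧ |q.2| ≤ R := by
  obtain ⟨C, hC⟩ := hK.isBounded.exists_norm_le
  refine ⟨max C 0, le_max_right _ _, fun q hq => ?_⟩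
  have := (hC q hq).trans (le_max_left C 0)
  exact ⟨(norm_fst_le q).trans this, (norm_snd_le q).trans this⟩

lemma continuous_conj (hK : IsCompact K) (hne : K.Nonempty) (hψ : ContinuousOn ψ K) :
    Continuous (conj K ψ) := by
  obtain ⟨R, hR0, hR⟩ := exists_bound_of_isCompact hK
  exact (lipschitzWith_conj hK hne hψ hR0 hR).continuous

lemma conj_mono_left (hK : IsCompact K) (hne : K.Nonempty) (hψ : ContinuousOn ψ K)
    (hpos : ∀ q ∈ K, 0 ≤ q.1 ∧ 0 ≤ q.2) (h1 : x.1 ≤ y.1) (h2 : x.2 ≤ y.2) :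
    conj K ψ x ≤ conj K ψ y := by
  refine conj_le hne fun q hq => le_trans ?_ (le_conj hK hψ hq)
  have := mul_le_mul_of_nonneg_right h1 (hpos q hq).1
  have := mul_le_mul_of_nonneg_right h2 (hpos q hq).2
  unfold dot
  linarith

lemma conj_le_conj_add (hK : IsCompact K) (hne : K.Nonempty) (hψ : ContinuousOn ψ K) {δ : ℝ}
    (h : ∀ q ∈ K, ψ q ≤ χ q + δ) : conj K χ x ≤ conj K ψ x + δ := by
  refine conj_le hne fun q hq => ?_
  have := le_conj (x := x) hK hψ hq
  have := h q hq
  linarith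

lemma abs_conj_sub_le (hK : IsCompact K) (hne : K.Nonempty) (hψ : ContinuousOn ψ K)
    (hχ : ContinuousOn χ K) {δ : ℝ} (h : ∀ q ∈ K, |ψ q - χ q| ≤ δ) :
    |conj K ψ x - conj K χ x| ≤ δ := by
  rw [abs_sub_le_iff]
  constructor
  · have := conj_le_conj_add (x := x) (χ := ψ) hK hne hχ
      (fun q hq => by have := (abs_sub_le_iff.1 (h q hq)).2; linarith : ∀ q ∈ K, χ q ≤ ψ q + δ)
    linarith
  · have := conj_le_conj_add (x := x) hK hne hψ
      (fun q hq => by have := (abs_sub_le_iff.1 (h q hq)).1; linarith : ∀ q ∈ K, ψ q ≤ χ q + δ)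
    linarith

/-- A function touched from below by the pairing with `q` has derivative `q`. -/
lemma fderiv_eq_dot {f : ℝ × ℝ → ℝ} (hf : DifferentiableAt ℝ f x)
    (hq : ∀ᶠ y in 𝓝 x, f x - dot x q ≤ f y - dot y q) (v : ℝ × ℝ) :
    fderiv ℝ f x v = dot v q := by
  let L : ℝ × ℝ →L[ℝ] ℝ :=
    q.1 • ContinuousLinearMap.fst ℝ ℝ ℝ + q.2 • ContinuousLinearMap.snd ℝ ℝ ℝ
  have hL : ∀ y, L y = dot y q := fun y => by
    simp [L, dot, mul_comm]
  have hmin : IsLocalMin (fun y => f y - L y) x := by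
    filter_upwards [hq] with y hy
    simpa only [hL] using hy
  have h := hmin.hasFDerivAt_eq_zero (hf.hasFDerivAt.sub L.hasFDerivAt)
  have h2 : fderiv ℝ f x = L := sub_eq_zero.1 h
  rw [h2, hL]

lemma grad_eq {f : ℝ × ℝ → ℝ} (hf : DifferentiableAt ℝ f x)
    (hq : ∀ᶠ y in 𝓝 x, f x - dot x q ≤ f y - dot y q) : grad f x = q := by
  unfold grad
  rw [fderiv_eq_dot hf hq, fderiv_eq_dot hf hq]
  simp [dot]

/-- The affine function `y ↦ dot y q - ψ q` lies below the conjugate and touches it at `x`. So at a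
point of differentiability the maximizing `q` is unique and is the gradient. -/
lemma grad_conj_eq (hK : IsCompact K) (hψ : ContinuousOn ψ K)
    (hd : DifferentiableAt ℝ (conj K ψ) x) (hq : q ∈ K) (h : conj K ψ x ≤ dot x q - ψ q) :
    grad (conj K ψ) x = q := by
  refine grad_eq hd (Eventually.of_forall fun y => ?_)
  have := le_conj (x := y) hK hψ hq
  linarith

lemma grad_conj_mem (hK : IsCompact K) (hne : K.Nonempty) (hψ : ContinuousOn ψ K)
    (hd : DifferentiableAt ℝ (conj K ψ) x) :
    grad (conj K ψ) x ∈ K ∧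
      conj K ψ x = dot x (grad (conj K ψ) x) - ψ (grad (conj K ψ) x) := by
  obtain ⟨q, hq, h, -⟩ := exists_conj_eq hK hne hψ x
  rw [grad_conj_eq hK hψ hd hq h.le]
  exact ⟨hq, h⟩

lemma measurable_grad (f : ℝ × ℝ → ℝ) : Measurable (grad f) :=
  (measurable_fderiv_apply_const ℝ f _).prodMk (measurable_fderiv_apply_const ℝ f _)

/-- The first variation of the conjugate at a point of differentiability. -/
lemma tendsto_conj_variation (hK : IsCompact K) (hne : K.Nonempty) (hψ : ContinuousOn ψ K)
    {h : ℝ × ℝ → ℝ} (hh : ContinuousOn h K) {ε : ℕ → ℝ} (hε : Tendsto ε atTop (𝓝 0))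
    (hε0 : ∀ n, ε n ≠ 0) (hd : DifferentiableAt ℝ (conj K ψ) x) :
    Tendsto (fun n => (conj K ψ x - conj K (fun q => ψ q + ε n * h q) x) / ε n) atTop
      (𝓝 (h (grad (conj K ψ) x))) := by
  obtain ⟨hq₀, hq₀'⟩ := grad_conj_mem hK hne hψ hd
  set q₀ := grad (conj K ψ) x with hq₀def
  obtain ⟨C, hC⟩ := (hK.image_of_continuousOn hh).isBounded.exists_norm_le
  have hC' : ∀ q ∈ K, |h q| ≤ C := fun q hq => hC _ ⟨q, hq, rfl⟩
  rw [Metric.tendsto_atTop]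
  intro η hη
  -- a gap between the maximum and the values at points where `h` is far from `h q₀`
  obtain ⟨κ, hκ, hgap⟩ : ∃ κ > 0, ∀ q ∈ K, η ≤ |h q - h q₀| → dot x q - ψ q ≤ conj K ψ x - κ := by
    set K' := K ∩ (fun q => |h q - h q₀|) ⁻¹' Ici η
    have hc : ContinuousOn (fun q => |h q - h q₀|) K := (hh.sub continuousOn_const).abs
    have hK' : IsCompact K' :=
      hK.of_isClosed_subset (hc.preimage_isClosed_of_isClosed hK.isClosed isClosed_Ici)
        inter_subset_left
    rcases K'.eq_empty_or_nonempty with hem | hne'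
    · refine ⟨1, one_pos, fun q hq hqη => ?_⟩
      have : q ∈ K' := ⟨hq, hqη⟩
      simp [hem] at this
    · obtain ⟨q₁, hq₁, heq, hmax⟩ := exists_conj_eq hK' hne' (hψ.mono inter_subset_left) x
      refine ⟨conj K ψ x - (dot x q₁ - ψ q₁), ?_, fun q hq hqη => ?_⟩
      · by_contra hcon
        have : q₀ = q₁ := grad_conj_eq hK hψ hd hq₁.1 (by linarith)
        have h2 : η ≤ |h q₁ - h q₀| := hq₁.2
        rw [this] at h2
        simp at h2
        linarith
      · have := hmax q ⟨hq, hqη⟩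
        linarith
  have hev : ∀ᶠ n in atTop, |ε n| * (2 * (C + 1)) < κ := by
    have : Tendsto (fun n => |ε n| * (2 * (C + 1))) atTop (𝓝 (|0| * (2 * (C + 1)))) :=
      hε.abs.mul_const _
    rw [abs_zero, zero_mul] at this
    exact this.eventually (gt_mem_nhds hκ)
  rw [eventually_atTop] at hev
  obtain ⟨N, hN⟩ := hev
  refine ⟨N, fun n hn => ?_⟩
  have hψn : ContinuousOn (fun q => ψ q + ε n * h q) K := hψ.add (continuousOn_const.mul hh)
  obtain ⟨q₁, hq₁, heq, -⟩ := exists_conj_eq hK hne hψn x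
  have h1 := le_conj (x := x) hK hψn hq₀
  have h2 := le_conj (x := x) hK hψ hq₁
  have hb0 := abs_le.1 (hC' q₀ hq₀)
  have hb1 := abs_le.1 (hC' q₁ hq₁)
  -- If `h q₁` were far from `h q₀`, then `q₁` would lose at least `κ` in the unperturbed problem,
  -- while the perturbation can win back at most `2C|ε n| < κ`.
  have hnear : |h q₁ - h q₀| < η := by
    by_contra hcon
    have h3 := hgap q₁ hq₁ (not_lt.1 hcon)
    have h4 := hN n hn
    have h5 : |ε n * (h q₀ - h q₁)| ≤ |ε n| * (2 * C) := by
      rw [abs_mul]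
      refine mul_le_mul_of_nonneg_left ?_ (abs_nonneg _)
      rw [abs_le]; constructor <;> linarith
    have h6 := (abs_le.1 h5).2
    have h7 := abs_nonneg (ε n)
    nlinarith
  rw [Real.dist_eq, heq]
  -- Each maximizer is tested in the other problem: `q₁` without the perturbation, `q₀` with it. For
  -- either sign of `ε n` the difference quotient then lies between `h q₀` and `h q₁`.
  have e1 : ε n * h q₁ ≤ conj K ψ x - (dot x q₁ - (ψ q₁ + ε n * h q₁)) := by linarith
  have e2 : conj K ψ x - (dot x q₁ - (ψ q₁ + ε n * h q₁)) ≤ ε n * h q₀ := by linarith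
  set t := conj K ψ x - (dot x q₁ - (ψ q₁ + ε n * h q₁))
  rw [abs_lt] at hnear ⊢
  rcases lt_or_gt_of_ne (hε0 n) with hneg | hpos
  · have i1 : t / ε n ≤ h q₁ := by rw [div_le_iff_of_neg hneg]; linarith
    have i2 : h q₀ ≤ t / ε n := by rw [le_div_iff_of_neg hneg]; linarith
    constructor <;> linarith
  · have i1 : h q₁ ≤ t / ε n := by rw [le_div_iff₀ hpos]; linarith
    have i2 : t / ε n ≤ h q₀ := by rw [div_le_iff₀ hpos]; linarith
    constructor <;> linarith

end Conj

/-! ### The one-dimensional layer problem -/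

/-- The weight `(2f₀(s)/Ω²)²`. -/
noncomputable def wt (r₀ Ω s : ℝ) : ℝ := (2 * f₀ r₀ Ω s / Ω ^ 2) ^ 2

/-- The cost `∫₀^ϱ (f₀(s) - u(s)) (2f₀(s)/Ω²)² ds` of a layer of depth `ϱ`. -/
noncomputable def layerCost (r₀ Ω : ℝ) (u : ℝ → ℝ) (ϱ : ℝ) : ℝ :=
  ∫ s in (0 : ℝ)..ϱ, (f₀ r₀ Ω s - u s) * wt r₀ Ω s

/-- The mass `∫₀^ϱ (2f₀(s)/Ω²)² ds` of a layer of depth `ϱ`. -/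
noncomputable def layerMass (r₀ Ω : ℝ) (ϱ : ℝ) : ℝ := ∫ s in (0 : ℝ)..ϱ, wt r₀ Ω s

/-- The depths that minimize the layer cost. -/
def argmins (r₀ Ω : ℝ) (u : ℝ → ℝ) : Set ℝ :=
  {ϱ | ϱ ∈ Ico 0 (1 / (2 * r₀ ^ 2)) ∧
    ∀ ϱ' ∈ Ico 0 (1 / (2 * r₀ ^ 2)), layerCost r₀ Ω u ϱ ≤ layerCost r₀ Ω u ϱ'}

/-- The least minimizing depth. -/
noncomputable def loDepth (r₀ Ω : ℝ) (u : ℝ → ℝ) : ℝ := sInf (argmins r₀ Ω u)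

/-- The greatest minimizing depth. -/
noncomputable def hiDepth (r₀ Ω : ℝ) (u : ℝ → ℝ) : ℝ := sSup (argmins r₀ Ω u)

section Layer

variable {r₀ Ω : ℝ} {u u' : ℝ → ℝ}

lemma one_sub_pos (hr₀ : 0 < r₀) {s : ℝ} (hs : s < 1 / (2 * r₀ ^ 2)) :
    0 < 1 - 2 * r₀ ^ 2 * s := by
  rw [lt_div_iff₀ (by positivity)] at hs
  linarith

lemma f₀_pos (hr₀ : 0 < r₀) (hΩ : 0 < Ω) {s : ℝ} (hs : s < 1 / (2 * r₀ ^ 2)) :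
    0 < f₀ r₀ Ω s := by
  have := one_sub_pos hr₀ hs
  unfold f₀
  positivity

lemma wt_pos (hr₀ : 0 < r₀) (hΩ : 0 < Ω) {s : ℝ} (hs : s < 1 / (2 * r₀ ^ 2)) :
    0 < wt r₀ Ω s := by
  have := f₀_pos hr₀ hΩ hs
  unfold wt
  positivity

lemma wt_nonneg (r₀ Ω s : ℝ) : 0 ≤ wt r₀ Ω s := sq_nonneg _

lemma continuousOn_f₀ (hr₀ : 0 < r₀) : ContinuousOn (f₀ r₀ Ω) (Iio (1 / (2 * r₀ ^ 2))) := by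
  unfold f₀
  refine ContinuousOn.div (by fun_prop) (by fun_prop) fun s hs => ?_
  have := one_sub_pos hr₀ hs
  positivity

lemma continuousOn_wt (hr₀ : 0 < r₀) : ContinuousOn (wt r₀ Ω) (Iio (1 / (2 * r₀ ^ 2))) := by
  unfold wt
  have := continuousOn_f₀ (Ω := Ω) hr₀
  fun_prop

lemma measurable_f₀ (r₀ Ω : ℝ) : Measurable (f₀ r₀ Ω) := by
  unfold f₀
  fun_prop

lemma measurable_wt (r₀ Ω : ℝ) : Measurable (wt r₀ Ω) := by
  unfold wt
  exact (((measurable_f₀ r₀ Ω).const_mul 2).div_const _).pow_const 2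

lemma f₀_strictMonoOn (hr₀ : 0 < r₀) (hΩ : 0 < Ω) :
    StrictMonoOn (f₀ r₀ Ω) (Iio (1 / (2 * r₀ ^ 2))) := by
  intro s hs t ht hst
  have h1 := one_sub_pos hr₀ hs
  have h2 := one_sub_pos hr₀ ht
  unfold f₀
  have : 2 * r₀ ^ 2 * s < 2 * r₀ ^ 2 * t := by gcongr
  apply div_lt_div_of_pos_left <;> [positivity; positivity; linarith]

lemma top_pos (hr₀ : 0 < r₀) : 0 < 1 / (2 * r₀ ^ 2) := by positivity

/-- Blow-up of `f₀` at the right end compensates for the range of depths not being compact: it keeps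
optimal depths below a cap controlled by a bound on the potential. -/
lemma exists_lt_f₀ (hr₀ : 0 < r₀) (hΩ : 0 < Ω) (B : ℝ) :
    ∃ S ∈ Ico 0 (1 / (2 * r₀ ^ 2)), ∀ s ∈ Ico S (1 / (2 * r₀ ^ 2)), B < f₀ r₀ Ω s := by
  set δ := min 1 (r₀ ^ 2 * Ω ^ 2 / (2 * (|B| + 1)))
  have hδ : 0 < δ := lt_min one_pos (by positivity)
  have hδ1 : δ ≤ 1 := min_le_left _ _
  have hδ2 : δ ≤ r₀ ^ 2 * Ω ^ 2 / (2 * (|B| + 1)) := min_le_right _ _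
  refine ⟨(1 - δ) * (1 / (2 * r₀ ^ 2)), ⟨?_, ?_⟩, fun s hs => ?_⟩
  · have := top_pos hr₀
    have : 0 ≤ 1 - δ := by linarith
    positivity
  · have := top_pos hr₀
    nlinarith
  · have h1 := one_sub_pos hr₀ hs.2
    have h2 : 1 - 2 * r₀ ^ 2 * s ≤ δ := by
      have := mul_le_mul_of_nonneg_left hs.1 (by positivity : 0 ≤ 2 * r₀ ^ 2)
      have e : 2 * r₀ ^ 2 * ((1 - δ) * (1 / (2 * r₀ ^ 2))) = 1 - δ := by field_simp
      linarith
    have h3 : |B| + 1 ≤ f₀ r₀ Ω s := by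
      unfold f₀
      rw [le_div_iff₀ (by positivity)]
      have h4 := h2.trans hδ2
      rw [le_div_iff₀ (by positivity)] at h4
      linarith
    linarith [le_abs_self B]

lemma uIcc_subset_Iio {x y c : ℝ} (hx : x < c) (hy : y < c) : uIcc x y ⊆ Iio c := fun _ hs =>
  lt_of_le_of_lt hs.2 (max_lt hx hy)

lemma intervalIntegrable_cost (hr₀ : 0 < r₀) (hu : Continuous u) {x y : ℝ}
    (hx : x < 1 / (2 * r₀ ^ 2)) (hy : y < 1 / (2 * r₀ ^ 2)) :
    IntervalIntegrable (fun s => (f₀ r₀ Ω s - u s) * wt r₀ Ω s) volume x y :=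
  ((((continuousOn_f₀ hr₀).sub hu.continuousOn).mul (continuousOn_wt hr₀)).mono
    (uIcc_subset_Iio hx hy)).intervalIntegrable

lemma intervalIntegrable_wt (hr₀ : 0 < r₀) {x y : ℝ}
    (hx : x < 1 / (2 * r₀ ^ 2)) (hy : y < 1 / (2 * r₀ ^ 2)) :
    IntervalIntegrable (wt r₀ Ω) volume x y :=
  ((continuousOn_wt hr₀).mono (uIcc_subset_Iio hx hy)).intervalIntegrable

lemma layerCost_sub (hr₀ : 0 < r₀) (hu : Continuous u) {x y : ℝ}
    (hx : x < 1 / (2 * r₀ ^ 2)) (hy : y < 1 / (2 * r₀ ^ 2)) :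
    layerCost r₀ Ω u y - layerCost r₀ Ω u x =
      ∫ s in x..y, (f₀ r₀ Ω s - u s) * wt r₀ Ω s :=
  intervalIntegral.integral_interval_sub_left
    (intervalIntegrable_cost hr₀ hu (top_pos hr₀) hy)
    (intervalIntegrable_cost hr₀ hu (top_pos hr₀) hx)

lemma hasDerivAt_layerCost (hr₀ : 0 < r₀) (hu : Continuous u) {x : ℝ}
    (hx : x < 1 / (2 * r₀ ^ 2)) :
    HasDerivAt (layerCost r₀ Ω u) ((f₀ r₀ Ω x - u x) * wt r₀ Ω x) x := by
  have hc : ContinuousOn (fun s => (f₀ r₀ Ω s - u s) * wt r₀ Ω s) (Iio (1 / (2 * r₀ ^ 2))) :=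
    ((continuousOn_f₀ hr₀).sub hu.continuousOn).mul (continuousOn_wt hr₀)
  exact intervalIntegral.integral_hasDerivAt_right
    (intervalIntegrable_cost hr₀ hu (top_pos hr₀) hx)
    (hc.stronglyMeasurableAtFilter isOpen_Iio x hx) (hc.continuousAt (Iio_mem_nhds hx))

lemma continuousOn_layerCost (hr₀ : 0 < r₀) (hu : Continuous u) :
    ContinuousOn (layerCost r₀ Ω u) (Iio (1 / (2 * r₀ ^ 2))) := fun _ hx =>
  (hasDerivAt_layerCost hr₀ hu hx).continuousAt.continuousWithinAt

lemma layerCost_congr {ϱ : ℝ} (hϱ : ϱ ∈ Ico 0 (1 / (2 * r₀ ^ 2)))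
    (h : ∀ s ∈ Ico 0 (1 / (2 * r₀ ^ 2)), u s = u' s) :
    layerCost r₀ Ω u ϱ = layerCost r₀ Ω u' ϱ := by
  refine intervalIntegral.integral_congr fun s hs => ?_
  rw [uIcc_of_le hϱ.1] at hs
  simp only [h s ⟨hs.1, hs.2.trans_lt hϱ.2⟩]

lemma argmins_congr (h : ∀ s ∈ Ico 0 (1 / (2 * r₀ ^ 2)), u s = u' s) :
    argmins r₀ Ω u = argmins r₀ Ω u' := by
  ext ϱ
  constructor
  · rintro ⟨h1, h2⟩
    refine ⟨h1, fun ϱ' hϱ' => ?_⟩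
    rw [← layerCost_congr h1 h, ← layerCost_congr hϱ' h]
    exact h2 ϱ' hϱ'
  · rintro ⟨h1, h2⟩
    refine ⟨h1, fun ϱ' hϱ' => ?_⟩
    rw [layerCost_congr h1 h, layerCost_congr hϱ' h]
    exact h2 ϱ' hϱ'

lemma layerCost_lt_of_lt (hr₀ : 0 < r₀) (hΩ : 0 < Ω) (hu : Continuous u) {x y : ℝ} (hxy : x < y)
    (hy : y < 1 / (2 * r₀ ^ 2)) (h : ∀ s ∈ Icc x y, u s < f₀ r₀ Ω s) :
    layerCost r₀ Ω u x < layerCost r₀ Ω u y := by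
  rw [← sub_pos, layerCost_sub hr₀ hu (hxy.trans hy) hy]
  refine intervalIntegral.intervalIntegral_pos_of_pos_on
    (intervalIntegrable_cost hr₀ hu (hxy.trans hy) hy) (fun s hs => ?_) hxy
  exact mul_pos (sub_pos.2 (h s ⟨hs.1.le, hs.2.le⟩)) (wt_pos hr₀ hΩ (hs.2.trans hy))

lemma argmins_subset (hr₀ : 0 < r₀) (hΩ : 0 < Ω) (hu : Continuous u) {S : ℝ}
    (hS : S ∈ Ico 0 (1 / (2 * r₀ ^ 2)))
    (hB : ∀ s ∈ Ico S (1 / (2 * r₀ ^ 2)), u s < f₀ r₀ Ω s) : argmins r₀ Ω u ⊆ Icc 0 S := by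
  rintro ϱ ⟨h1, h2⟩
  refine ⟨h1.1, not_lt.1 fun hlt => ?_⟩
  exact absurd (h2 S hS) (not_le.2 (layerCost_lt_of_lt hr₀ hΩ hu hlt h1.2
    fun s hs => hB s ⟨hs.1, hs.2.trans_lt h1.2⟩))

lemma exists_isMin_layerCost (hr₀ : 0 < r₀) (hΩ : 0 < Ω) (hu : Continuous u) {S : ℝ}
    (hS : S ∈ Ico 0 (1 / (2 * r₀ ^ 2)))
    (hB : ∀ s ∈ Ico S (1 / (2 * r₀ ^ 2)), u s < f₀ r₀ Ω s) :
    (argmins r₀ Ω u).Nonempty := by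
  obtain ⟨ϱ, hϱ, hmin⟩ := isCompact_Icc.exists_isMinOn (nonempty_Icc.2 hS.1)
    ((continuousOn_layerCost (Ω := Ω) hr₀ hu).mono fun s hs => hs.2.trans_lt hS.2)
  refine ⟨ϱ, ⟨hϱ.1, hϱ.2.trans_lt hS.2⟩, fun ϱ' hϱ' => ?_⟩
  rcases le_or_gt ϱ' S with h | h
  · exact hmin ⟨hϱ'.1, h⟩
  · exact (hmin ⟨hS.1, le_rfl⟩).trans (layerCost_lt_of_lt hr₀ hΩ hu h hϱ'.2
      fun s hs => hB s ⟨hs.1, hs.2.trans_lt hϱ'.2⟩).le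

lemma isCompact_argmins (hr₀ : 0 < r₀) (hΩ : 0 < Ω) (hu : Continuous u) {S : ℝ}
    (hS : S ∈ Ico 0 (1 / (2 * r₀ ^ 2)))
    (hB : ∀ s ∈ Ico S (1 / (2 * r₀ ^ 2)), u s < f₀ r₀ Ω s) :
    IsCompact (argmins r₀ Ω u) := by
  obtain ⟨ϱ₀, h1, h2⟩ := exists_isMin_layerCost hr₀ hΩ hu hS hB
  have hc : ContinuousOn (layerCost r₀ Ω u) (Icc 0 S) :=
    (continuousOn_layerCost (Ω := Ω) hr₀ hu).mono fun s hs => hs.2.trans_lt hS.2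
  have : argmins r₀ Ω u = Icc 0 S ∩ layerCost r₀ Ω u ⁻¹' Iic (layerCost r₀ Ω u ϱ₀) := by
    ext ϱ
    constructor
    · intro h
      exact ⟨argmins_subset hr₀ hΩ hu hS hB h, h.2 _ h1⟩
    · rintro ⟨h, h'⟩
      exact ⟨⟨h.1, h.2.trans_lt hS.2⟩, fun ϱ' hϱ' => le_trans h' (h2 ϱ' hϱ')⟩
  rw [this]
  exact isCompact_Icc.of_isClosed_subset
    (hc.preimage_isClosed_of_isClosed isClosed_Icc isClosed_Iic) inter_subset_left

/-- The derivative of the layer cost is `f₀ - u` times a positive weight, and a positive optimal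
depth is an interior minimum. This is the free boundary equation. -/
lemma eq_f₀_of_mem_argmins (hr₀ : 0 < r₀) (hΩ : 0 < Ω) (hu : Continuous u) {ϱ : ℝ}
    (h : ϱ ∈ argmins r₀ Ω u) (hpos : 0 < ϱ) : f₀ r₀ Ω ϱ = u ϱ := by
  have hmin : IsLocalMin (layerCost r₀ Ω u) ϱ := by
    filter_upwards [Ioo_mem_nhds hpos h.1.2] with y hy
    exact h.2 y ⟨hy.1.le, hy.2⟩
  have := hmin.hasDerivAt_eq_zero (hasDerivAt_layerCost hr₀ hu h.1.2)
  rcases mul_eq_zero.1 this with h' | h'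
  · linarith
  · exact absurd h' (wt_pos hr₀ hΩ h.1.2).ne'

lemma layerMass_strictMonoOn (hr₀ : 0 < r₀) (hΩ : 0 < Ω) :
    StrictMonoOn (layerMass r₀ Ω) (Iio (1 / (2 * r₀ ^ 2))) := by
  intro x hx y hy hxy
  rw [← sub_pos]
  unfold layerMass
  rw [intervalIntegral.integral_interval_sub_left
    (intervalIntegrable_wt hr₀ (top_pos hr₀) hy) (intervalIntegrable_wt hr₀ (top_pos hr₀) hx)]
  exact intervalIntegral.intervalIntegral_pos_of_pos_on (intervalIntegrable_wt hr₀ hx hy)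
    (fun s hs => wt_pos hr₀ hΩ (hs.2.trans hy)) hxy

lemma layerMass_zero : layerMass r₀ Ω 0 = 0 := intervalIntegral.integral_same

lemma layerMass_nonneg {ϱ : ℝ} (h : 0 ≤ ϱ) : 0 ≤ layerMass r₀ Ω ϱ :=
  intervalIntegral.integral_nonneg h fun _ _ => wt_nonneg _ _ _

lemma layerCost_sub_layerCost (hr₀ : 0 < r₀) (hu : Continuous u) (hu' : Continuous u') {ϱ : ℝ}
    (hϱ : ϱ < 1 / (2 * r₀ ^ 2)) :
    layerCost r₀ Ω u ϱ - layerCost r₀ Ω u' ϱ =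
      ∫ s in (0 : ℝ)..ϱ, (u' s - u s) * wt r₀ Ω s := by
  unfold layerCost
  rw [← intervalIntegral.integral_sub (intervalIntegrable_cost hr₀ hu (top_pos hr₀) hϱ)
    (intervalIntegrable_cost hr₀ hu' (top_pos hr₀) hϱ)]
  congr 1
  funext s
  ring

lemma layerCost_le_add (hr₀ : 0 < r₀) (hu : Continuous u) (hu' : Continuous u')
    {ϱ δ : ℝ} (hϱ : ϱ ∈ Ico 0 (1 / (2 * r₀ ^ 2)))
    (h : ∀ s ∈ Ico 0 (1 / (2 * r₀ ^ 2)), u' s - u s ≤ δ) :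
    layerCost r₀ Ω u ϱ ≤ layerCost r₀ Ω u' ϱ + δ * layerMass r₀ Ω ϱ := by
  rw [← sub_le_iff_le_add', layerCost_sub_layerCost hr₀ hu hu' hϱ.2, layerMass,
    ← intervalIntegral.integral_const_mul]
  have hi := intervalIntegrable_wt (Ω := Ω) hr₀ (top_pos hr₀) hϱ.2
  refine intervalIntegral.integral_mono_on hϱ.1 (hi.continuousOn_mul
    (hu'.sub hu).continuousOn) (hi.const_mul δ) fun s hs => ?_
  exact mul_le_mul_of_nonneg_right (h s ⟨hs.1, hs.2.trans_lt hϱ.2⟩) (wt_nonneg _ _ _)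

/-- Minimizing depths are stable under uniform perturbations. -/
lemma argmins_stable (hr₀ : 0 < r₀) (hΩ : 0 < Ω) (hu : Continuous u) {S : ℝ}
    (hS : S ∈ Ico 0 (1 / (2 * r₀ ^ 2))) (hne : (argmins r₀ Ω u).Nonempty)
    (hsub : argmins r₀ Ω u ⊆ Icc 0 S)
    {K : Set ℝ} (hK : IsCompact K) (hKS : K ⊆ Icc 0 S) (hd : Disjoint K (argmins r₀ Ω u)) :
    ∃ δ > 0, ∀ u' : ℝ → ℝ, Continuous u' →
      (∀ s ∈ Ico 0 (1 / (2 * r₀ ^ 2)), |u' s - u s| ≤ δ) → Disjoint K (argmins r₀ Ω u') := by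
  rcases K.eq_empty_or_nonempty with rfl | hKne
  · exact ⟨1, one_pos, fun _ _ _ => empty_disjoint _⟩
  have hIco : Icc 0 S ⊆ Ico 0 (1 / (2 * r₀ ^ 2)) := fun s hs => ⟨hs.1, hs.2.trans_lt hS.2⟩
  obtain ⟨ϱ, hϱ⟩ := hne
  obtain ⟨κ, hκ, hmin⟩ := hK.exists_isMinOn hKne
    ((continuousOn_layerCost (Ω := Ω) hr₀ hu).mono fun s hs => (hIco (hKS hs)).2)
  have hgap : layerCost r₀ Ω u ϱ < layerCost r₀ Ω u κ := by
    refine lt_of_le_of_ne (hϱ.2 κ (hIco (hKS hκ))) fun heq => ?_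
    refine Set.disjoint_left.1 hd hκ ⟨hIco (hKS hκ), fun ϱ' hϱ' => ?_⟩
    rw [← heq]
    exact hϱ.2 ϱ' hϱ'
  set m := layerMass r₀ Ω S
  have hm : 0 ≤ m := layerMass_nonneg hS.1
  have hmle : ∀ x ∈ Icc 0 S, layerMass r₀ Ω x ≤ m := fun x hx =>
    (layerMass_strictMonoOn hr₀ hΩ).monotoneOn (hIco hx).2 hS.2 hx.2
  set g := layerCost r₀ Ω u κ - layerCost r₀ Ω u ϱ
  have hg : 0 < g := sub_pos.2 hgap
  -- The perturbation moves each of the two costs being compared by at most `δ * m`, so `2 * (δ *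
  -- m)` must be less than the gap `g`; the summand `1` covers `m = 0`.
  refine ⟨g / (2 * m + 1) / 2, by positivity, fun u' hu' hclose => ?_⟩
  rw [Set.disjoint_left]
  rintro x hx ⟨-, hx2⟩
  set δ := g / (2 * m + 1) / 2
  have hδ : 0 < δ := by positivity
  have hδg : 2 * (δ * m) < g := by
    have : 2 * (δ * m) = g * (m / (2 * m + 1)) := by
      simp only [δ]; field_simp
    rw [this]
    have : m / (2 * m + 1) < 1 := by rw [div_lt_one (by positivity)]; linarith
    nlinarith
  have h1 := layerCost_le_add (Ω := Ω) (δ := δ) hr₀ hu hu' (hIco (hKS hx)) fun s hs =>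
    (abs_le.1 (hclose s hs)).2
  have h2 := layerCost_le_add (Ω := Ω) (δ := δ) hr₀ hu' hu hϱ.1 fun s hs => by
    have := (abs_le.1 (hclose s hs)).1; linarith
  have h3 := hx2 ϱ hϱ.1
  have h4 : layerCost r₀ Ω u κ ≤ layerCost r₀ Ω u x := hmin hx
  have h5 := mul_le_mul_of_nonneg_left (hmle x (hKS hx)) hδ.le
  have h6 := mul_le_mul_of_nonneg_left (hmle ϱ (hsub hϱ)) hδ.le
  simp only [g] at hδg
  linarith

/-- If the minimizing depths of two ordered problems are in the wrong order, then the two data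
agree in between and both depths are optimal for both problems. -/
lemma argmins_compare (hr₀ : 0 < r₀) (hΩ : 0 < Ω) (hu : Continuous u) (hu' : Continuous u')
    (hle : ∀ s ∈ Ico 0 (1 / (2 * r₀ ^ 2)), u s ≤ u' s) {x y : ℝ} (hx : x ∈ argmins r₀ Ω u)
    (hy : y ∈ argmins r₀ Ω u') (hyx : y < x) :
    x ∈ argmins r₀ Ω u' ∧ y ∈ argmins r₀ Ω u ∧ ∀ s ∈ Icc y x, u s = u' s := by
  have h1 := hx.2 y hy.1
  have h2 := hy.2 x hx.1
  have e1 := layerCost_sub (Ω := Ω) hr₀ hu hy.1.2 hx.1.2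
  have e2 := layerCost_sub (Ω := Ω) hr₀ hu' hy.1.2 hx.1.2
  have hi := intervalIntegrable_cost (Ω := Ω) hr₀ hu hy.1.2 hx.1.2
  have hi' := intervalIntegrable_cost (Ω := Ω) hr₀ hu' hy.1.2 hx.1.2
  have hnn : ∀ s ∈ Icc y x, (f₀ r₀ Ω s - u' s) * wt r₀ Ω s ≤ (f₀ r₀ Ω s - u s) * wt r₀ Ω s :=
    fun s hs => mul_le_mul_of_nonneg_right
      (by linarith [hle s ⟨hy.1.1.trans hs.1, hs.2.trans_lt hx.1.2⟩]) (wt_nonneg _ _ _)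
  -- Optimality of `x` for `u` makes the integral over `[y, x]` with `u` nonpositive, and optimality
  -- of `y` for `u'` makes the one with `u'` nonnegative. Since the integrand with `u'` is the
  -- smaller one, both integrals vanish.
  have h3 := intervalIntegral.integral_mono_on hyx.le hi' hi hnn
  refine ⟨⟨hx.1, fun z hz => ?_⟩, ⟨hy.1, fun z hz => ?_⟩, ?_⟩
  · have := hy.2 z hz; linarith
  · have := hx.2 z hz; linarith
  · by_contra hcon
    push Not at hcon
    obtain ⟨s, hs, hne⟩ := hcon
    have hsub : Icc y x ⊆ Iio (1 / (2 * r₀ ^ 2)) := fun t ht => ht.2.trans_lt hx.1.2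
    have hc : ∀ {v : ℝ → ℝ}, Continuous v →
        ContinuousOn (fun s => (f₀ r₀ Ω s - v s) * wt r₀ Ω s) (Icc y x) := fun hv =>
      (((continuousOn_f₀ hr₀).sub hv.continuousOn).mul (continuousOn_wt hr₀)).mono hsub
    have := intervalIntegral.integral_lt_integral_of_continuousOn_of_le_of_exists_lt hyx (hc hu')
      (hc hu) (fun t ht => hnn t ⟨ht.1.le, ht.2⟩) ⟨s, hs, by
        have h5 := wt_pos (Ω := Ω) hr₀ hΩ (hsub hs)
        have h6 := lt_of_le_of_ne (hle s ⟨hy.1.1.trans hs.1, hs.2.trans_lt hx.1.2⟩) hne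
        exact mul_lt_mul_of_pos_right (by linarith) h5⟩
    linarith

end Layer

/-! ### The change of variables `φ` -/

section Phi

variable {H a b : ℝ} {θ : ℝ → ℝ}

lemma IsAmbient.pos (hθ : IsAmbient H a b θ) (ha : 0 < a) {z : ℝ} (hz : z ∈ Icc 0 H) :
    0 < θ z := ha.trans (hθ.mapsTo hz).1

lemma IsAmbient.continuousOn (hθ : IsAmbient H a b θ) : ContinuousOn θ (Icc 0 H) := by
  obtain ⟨L, hL⟩ := hθ.condA2
  exact hL.continuousOn

lemma continuousOn_phi (hθ : IsAmbient H a b θ) (ha : 0 < a) :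
    ContinuousOn (phi θ) (Icc 0 H) :=
  continuousOn_id.div hθ.continuousOn fun _ hz => (hθ.pos ha hz).ne'

lemma hasDerivAt_phi (hθ : IsAmbient H a b θ) (ha : 0 < a) {z : ℝ} (hz : z ∈ Ioo 0 H) :
    HasDerivAt (phi θ) ((θ z - z * deriv θ z) / θ z ^ 2) z := by
  have h1 : DifferentiableAt ℝ θ z :=
    ((hθ.smooth.contDiffAt (isOpen_Ioo.mem_nhds hz)).differentiableAt (by simp))
  have := (hasDerivAt_id z).div h1.hasDerivAt (hθ.pos ha ⟨hz.1.le, hz.2.le⟩).ne'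
  rwa [id, one_mul] at this

lemma strictMonoOn_phi (hθ : IsAmbient H a b θ) (ha : 0 < a) :
    StrictMonoOn (phi θ) (Icc 0 H) := by
  refine strictMonoOn_of_deriv_pos (convex_Icc 0 H) (continuousOn_phi hθ ha) fun z hz => ?_
  rw [interior_Icc] at hz
  rw [(hasDerivAt_phi hθ ha hz).deriv]
  have := hθ.pos ha ⟨hz.1.le, hz.2.le⟩
  have := hθ.condA1 z hz
  positivity

lemma phi_mem (hθ : IsAmbient H a b θ) (ha : 0 < a) {z : ℝ} (hz : z ∈ Icc 0 H) :
    phi θ z ∈ Icc 0 (H / a) := by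
  have h1 := hθ.pos ha hz
  have h2 := (hθ.mapsTo hz).1
  refine ⟨div_nonneg hz.1 h1.le, ?_⟩
  unfold phi
  exact div_le_div₀ (hz.1.trans hz.2) hz.2 ha h2.le

/-- A null set of the plane is almost never met after the change of variables `𝐟`. -/
lemma ae_notMem_of_phi (hθ : IsAmbient H a b θ) (ha : 0 < a) {N : Set (ℝ × ℝ)}
    (hN : volume N = 0) (hNm : MeasurableSet N) :
    ∀ᵐ p : ℝ × ℝ, p.2 ∈ Ioo 0 H → bff θ p ∉ N := by
  have hcont : ContinuousOn (phi θ) (Ioo 0 H) :=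
    (continuousOn_phi hθ ha).mono Ioo_subset_Icc_self
  -- Outside the interval `θ` is arbitrary, so `phi θ` is replaced by a globally measurable function
  -- before slicing.
  obtain ⟨g, hg, hgeq⟩ : ∃ g : ℝ → ℝ, Measurable g ∧ ∀ z ∈ Ioo 0 H, g z = phi θ z := by
    obtain ⟨g, hg, h⟩ := (MeasurableEmbedding.subtype_coe
      (measurableSet_Ioo (a := (0 : ℝ)) (b := H))).exists_measurable_extend
      (hcont.domRestrict.measurable) (fun _ => ⟨0⟩)
    exact ⟨g, hg, fun z hz => congrFun h ⟨z, hz⟩⟩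
  have key : ∀ᵐ z : ℝ, z ∈ Ioo 0 H → volume ((fun s => (s, g z)) ⁻¹' N) = 0 := by
    have hsl : Measurable fun ζ : ℝ => volume ((fun s : ℝ => (s, ζ)) ⁻¹' N) :=
      measurable_measure_prodMk_right hNm
    have h0 : ∫⁻ ζ : ℝ, volume ((fun s : ℝ => (s, ζ)) ⁻¹' N) = 0 := by
      rw [← Measure.prod_apply_symm hNm, ← Measure.volume_eq_prod, hN]
    -- A change of variables in the height alone, applied to the lengths of the horizontal slices of
    -- `N`. By (A1) the Jacobian `φ'` is positive, so the slices themselves are null.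
    have h1 : ∫⁻ z in Ioo 0 H, ENNReal.ofReal |deriv (phi θ) z| *
        volume ((fun s : ℝ => (s, phi θ z)) ⁻¹' N) = 0 := by
      have := lintegral_image_eq_lintegral_abs_deriv_mul measurableSet_Ioo
        (fun z hz => (hasDerivAt_phi hθ ha hz).differentiableAt.hasDerivAt.hasDerivWithinAt)
        ((strictMonoOn_phi hθ ha).injOn.mono Ioo_subset_Icc_self)
        (fun ζ => volume ((fun s : ℝ => (s, ζ)) ⁻¹' N))
      rw [← this]
      exact le_antisymm ((setLIntegral_le_lintegral _ _).trans h0.le) bot_le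
    have h2 : ∫⁻ z in Ioo 0 H, ENNReal.ofReal |deriv (phi θ) z| *
        volume ((fun s : ℝ => (s, g z)) ⁻¹' N) = 0 := by
      rw [← h1]
      refine setLIntegral_congr_fun measurableSet_Ioo fun z hz => ?_
      simp only [hgeq z hz]
    have hmz : Measurable fun z : ℝ => ENNReal.ofReal |deriv (phi θ) z| *
        volume ((fun s : ℝ => (s, g z)) ⁻¹' N) :=
      (measurable_deriv (phi θ)).abs.ennreal_ofReal.mul (hsl.comp hg)
    have h3 := (ae_restrict_iff' measurableSet_Ioo).1 ((lintegral_eq_zero_iff hmz).1 h2)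
    filter_upwards [h3] with z hz hzI
    rcases mul_eq_zero.1 (hz hzI) with h | h
    · rw [ENNReal.ofReal_eq_zero, (hasDerivAt_phi hθ ha hzI).deriv] at h
      have := hθ.pos ha ⟨hzI.1.le, hzI.2.le⟩
      have := hθ.condA1 z hzI
      have : 0 < (θ z - z * deriv θ z) / θ z ^ 2 := by positivity
      rw [abs_of_pos this] at h
      linarith
    · exact h
  have hm : MeasurableSet {p : ℝ × ℝ | p.2 ∈ Ioo 0 H ∧ (p.1, g p.2) ∈ N} := by
    refine (measurable_snd measurableSet_Ioo).inter ?_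
    exact (measurable_fst.prodMk (hg.comp measurable_snd)) hNm
  have hzero : volume {p : ℝ × ℝ | p.2 ∈ Ioo 0 H ∧ (p.1, g p.2) ∈ N} = 0 := by
    rw [Measure.volume_eq_prod, Measure.prod_apply_symm hm, lintegral_eq_zero_iff
      (measurable_measure_prodMk_right hm)]
    filter_upwards [key] with z hz
    by_cases hzI : z ∈ Ioo 0 H
    · refine measure_mono_null ?_ (hz hzI)
      intro s hs
      exact hs.2
    · have : (fun s => (s, z)) ⁻¹' {p : ℝ × ℝ | p.2 ∈ Ioo 0 H ∧ (p.1, g p.2) ∈ N} = ∅ := by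
        ext s
        simp only [mem_preimage, mem_ofPred_eq, mem_empty_iff_false, iff_false]
        exact fun h => hzI h.1
      rw [this, measure_empty]
      rfl
  have := measure_eq_zero_iff_ae_notMem.1 hzero
  filter_upwards [this] with p hp hpI hpN
  refine hp ⟨hpI, ?_⟩
  rw [hgeq _ hpI]
  exact hpN

end Phi

/-! ### The measures `μ_ϱ` -/

section Mu

variable {r₀ Ω H : ℝ} {ϱ ϱ' : ℝ → ℝ}

lemma exists_measurable_eqOn (hϱ : ϱ ∈ R r₀ H) :
    ∃ g : ℝ → ℝ, Measurable g ∧ ∀ z ∈ Icc 0 H, g z = ϱ z := by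
  obtain ⟨g, hg, h⟩ := (MeasurableEmbedding.subtype_coe
    (measurableSet_Icc (a := (0 : ℝ)) (b := H))).exists_measurable_extend hϱ.1 (fun _ => ⟨0⟩)
  exact ⟨g, hg, fun z hz => congrFun h ⟨z, hz⟩⟩

lemma measurableSet_D (hϱ : ϱ ∈ R r₀ H) : MeasurableSet (D H ϱ) := by
  obtain ⟨g, hg, h⟩ := exists_measurable_eqOn hϱ
  have : D H ϱ = {p | p.2 ∈ Icc 0 H ∧ 0 ≤ p.1 ∧ p.1 ≤ g p.2} := by
    ext p
    simp only [D, mem_ofPred_eq]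
    refine and_congr_right fun hp => ?_
    rw [h _ hp]
  rw [this]
  exact (measurable_snd measurableSet_Icc).inter
    ((measurableSet_le measurable_const measurable_fst).inter
      (measurableSet_le measurable_fst (hg.comp measurable_snd)))

lemma measurable_density : Measurable fun p : ℝ × ℝ => ENNReal.ofReal (wt r₀ Ω p.1) :=
  ((measurable_wt r₀ Ω).comp measurable_fst).ennreal_ofReal

lemma mu_eq (hϱ : ϱ ∈ R r₀ H) : mu r₀ Ω H ϱ =
    (volume.withDensity fun p : ℝ × ℝ => ENNReal.ofReal (wt r₀ Ω p.1)).restrict (D H ϱ) :=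
  (restrict_withDensity (measurableSet_D hϱ) _).symm

lemma mu_absolutelyContinuous : mu r₀ Ω H ϱ ≪ volume :=
  (withDensity_absolutelyContinuous _ _).trans Measure.absolutelyContinuous_restrict

/-- Every layer below a cap is cut out of one fixed finite measure. Limits along varying layers
thereby become limits of indicators. -/
lemma mu_restrict (hϱ : ϱ ∈ R r₀ H) (hϱ' : ϱ' ∈ R r₀ H) (h : ∀ z ∈ Icc 0 H, ϱ z ≤ ϱ' z) :
    mu r₀ Ω H ϱ = (mu r₀ Ω H ϱ').restrict (D H ϱ) := by
  rw [mu_eq hϱ, mu_eq hϱ', Measure.restrict_restrict (measurableSet_D hϱ)]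
  congr 1
  refine (inter_eq_left.2 fun p hp => ?_).symm
  exact ⟨hp.1, hp.2.1, hp.2.2.trans (h _ hp.1)⟩

lemma ae_mem_D (hϱ : ϱ ∈ R r₀ H) : ∀ᵐ p ∂(mu r₀ Ω H ϱ), p ∈ D H ϱ := by
  rw [mu_eq hϱ]
  exact ae_restrict_mem (measurableSet_D hϱ)

lemma const_mem_R {S : ℝ} (hS : S ∈ Ico 0 (1 / (2 * r₀ ^ 2))) : (fun _ => S) ∈ R r₀ H :=
  ⟨measurable_const, fun _ _ => hS⟩

lemma isFiniteMeasure_mu_const (hr₀ : 0 < r₀) {S : ℝ} (hS : S ∈ Ico 0 (1 / (2 * r₀ ^ 2))) :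
    IsFiniteMeasure (mu r₀ Ω H fun _ => S) := by
  have hc : ContinuousOn (wt r₀ Ω) (Icc 0 S) :=
    (continuousOn_wt hr₀).mono fun s hs => hs.2.trans_lt hS.2
  obtain ⟨C, hC⟩ := (isCompact_Icc.image_of_continuousOn hc).isBounded.exists_norm_le
  have hD : D H (fun _ => S) ⊆ Icc 0 S ×ˢ Icc 0 H := fun p hp => ⟨⟨hp.2.1, hp.2.2⟩, hp.1⟩
  have hfin : volume (D H (fun _ => S)) < ⊤ :=
    (measure_mono hD).trans_lt (isCompact_Icc.prod isCompact_Icc).measure_lt_top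
  refine ⟨?_⟩
  rw [mu, withDensity_apply _ MeasurableSet.univ, Measure.restrict_univ]
  calc ∫⁻ p in D H (fun _ => S), ENNReal.ofReal ((2 * f₀ r₀ Ω p.1 / Ω ^ 2) ^ 2)
      ≤ ∫⁻ p in D H (fun _ => S), ENNReal.ofReal C :=
        setLIntegral_mono measurable_const fun p hp =>
          ENNReal.ofReal_le_ofReal ((le_abs_self _).trans (hC _ ⟨p.1, (hD hp).1, rfl⟩))
    _ < ⊤ := by
        rw [setLIntegral_const]
        exact ENNReal.mul_lt_top ENNReal.ofReal_lt_top hfin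

lemma isFiniteMeasure_mu (hr₀ : 0 < r₀) (hϱ : ϱ ∈ R r₀ H) {S : ℝ}
    (hS : S ∈ Ico 0 (1 / (2 * r₀ ^ 2))) (h : ∀ z ∈ Icc 0 H, ϱ z ≤ S) :
    IsFiniteMeasure (mu r₀ Ω H ϱ) := by
  have := isFiniteMeasure_mu_const (Ω := Ω) (H := H) hr₀ hS
  rw [mu_restrict hϱ (const_mem_R hS) h]
  infer_instance

lemma mu_congr (h : ϱ =ᵐ[volume.restrict (Icc 0 H)] ϱ') : mu r₀ Ω H ϱ = mu r₀ Ω H ϱ' := by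
  unfold mu
  congr 1
  refine Measure.restrict_congr_set ?_
  have h1 : ∀ᵐ z : ℝ, z ∈ Icc 0 H → ϱ z = ϱ' z := (ae_restrict_iff' measurableSet_Icc).1 h
  have h2 : ∀ᵐ p : ℝ × ℝ, p.2 ∈ Icc 0 H → ϱ p.2 = ϱ' p.2 :=
    (Measure.quasiMeasurePreserving_snd (μ := volume) (ν := volume)).ae h1
  filter_upwards [h2] with p hp
  refine propext ⟨fun hD => ?_, fun hD => ?_⟩
  · exact ⟨hD.1, hD.2.1, (hp hD.1) ▸ hD.2.2⟩
  · exact ⟨hD.1, hD.2.1, (hp hD.1).symm ▸ hD.2.2⟩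

/-- Integration against `μ_ϱ` as an iterated integral. -/
lemma integral_mu (hϱ : ϱ ∈ R r₀ H) {F : ℝ × ℝ → ℝ} (hF : Integrable F (mu r₀ Ω H ϱ)) :
    IntegrableOn (fun z => ∫ s in (0 : ℝ)..ϱ z, F (s, z) * wt r₀ Ω s) (Icc 0 H) ∧
      ∫ p, F p ∂(mu r₀ Ω H ϱ) =
        ∫ z in Icc 0 H, ∫ s in (0 : ℝ)..ϱ z, F (s, z) * wt r₀ Ω s := by
  have hD := measurableSet_D hϱ
  have hmeas : Measurable fun p : ℝ × ℝ => ENNReal.ofReal (wt r₀ Ω p.1) := measurable_density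
  have hlt : ∀ᵐ p : ℝ × ℝ ∂(volume.restrict (D H ϱ)), ENNReal.ofReal (wt r₀ Ω p.1) < ⊤ :=
    Eventually.of_forall fun _ => ENNReal.ofReal_lt_top
  have h1 : Integrable (fun p : ℝ × ℝ => (D H ϱ).indicator (fun p => F p * wt r₀ Ω p.1) p)
      (volume.prod volume) := by
    rw [← Measure.volume_eq_prod, integrable_indicator_iff hD]
    have := (integrable_withDensity_iff hmeas hlt).1 hF
    refine this.congr (Eventually.of_forall fun p => ?_)
    simp only [ENNReal.toReal_ofReal (wt_nonneg _ _ _)]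
  have h2 : ∫ p, F p ∂(mu r₀ Ω H ϱ) =
      ∫ p, (D H ϱ).indicator (fun p => F p * wt r₀ Ω p.1) p ∂(volume.prod volume) := by
    rw [← Measure.volume_eq_prod, integral_indicator hD, mu]
    refine (integral_withDensity_eq_integral_toReal_smul hmeas hlt F).trans ?_
    refine integral_congr_ae (Eventually.of_forall fun p => ?_)
    simp only [smul_eq_mul]
    rw [ENNReal.toReal_ofReal (wt_nonneg _ _ _), mul_comm]
  have h3 : ∀ z, ∫ s, (D H ϱ).indicator (fun p => F p * wt r₀ Ω p.1) (s, z) =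
      (Icc 0 H).indicator (fun z => ∫ s in (0 : ℝ)..ϱ z, F (s, z) * wt r₀ Ω s) z := by
    intro z
    by_cases hz : z ∈ Icc 0 H
    · rw [indicator_of_mem hz, intervalIntegral.integral_of_le (hϱ.2 hz).1,
        ← integral_Icc_eq_integral_Ioc, ← integral_indicator measurableSet_Icc]
      refine integral_congr_ae (Eventually.of_forall fun s => ?_)
      by_cases hs : s ∈ Icc 0 (ϱ z)
      · have : (s, z) ∈ D H ϱ := ⟨hz, hs.1, hs.2⟩
        simp only [indicator_of_mem this, indicator_of_mem hs]
      · have : (s, z) ∉ D H ϱ := fun h => hs ⟨h.2.1, h.2.2⟩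
        simp only [indicator_of_notMem this, indicator_of_notMem hs]
    · rw [indicator_of_notMem hz]
      have : ∀ s, (s, z) ∉ D H ϱ := fun s h => hz h.1
      simp only [indicator_of_notMem (this _), integral_zero]
  constructor
  · have := h1.integral_prod_right
    simp only [h3] at this
    rwa [integrable_indicator_iff measurableSet_Icc] at this
  · rw [h2, integral_prod_symm _ h1]
    simp only [h3]
    rw [integral_indicator measurableSet_Icc]

/-- Almost every point avoids a given measurable graph over the second coordinate. -/
lemma ae_fst_ne {g : ℝ → ℝ} (hg : Measurable g) : ∀ᵐ p : ℝ × ℝ, p.1 ≠ g p.2 := by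
  have hm : MeasurableSet {p : ℝ × ℝ | p.1 = g p.2} :=
    measurableSet_eq_fun measurable_fst (hg.comp measurable_snd)
  have h0 : volume {p : ℝ × ℝ | p.1 = g p.2} = 0 := by
    rw [Measure.volume_eq_prod, Measure.prod_apply_symm hm]
    have : ∀ z, volume ((fun s : ℝ => (s, z)) ⁻¹' {p : ℝ × ℝ | p.1 = g p.2}) = 0 := fun z =>
      measure_mono_null (t := {g z}) (fun s hs => hs) (measure_singleton _)
    simp only [this, lintegral_zero]
  exact measure_eq_zero_iff_ae_notMem.1 h0

lemma ae_fst_ne_of_mem_R (hϱ : ϱ ∈ R r₀ H) :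
    ∀ᵐ p : ℝ × ℝ, p.2 ∈ Icc 0 H → p.1 ≠ ϱ p.2 := by
  obtain ⟨g, hg, h⟩ := exists_measurable_eqOn hϱ
  filter_upwards [ae_fst_ne hg] with p hp hpI
  rwa [← h _ hpI]

lemma ae_snd_notMem {E : Set ℝ} (hE : E.Countable) : ∀ᵐ p : ℝ × ℝ, p.2 ∉ E :=
  (Measure.quasiMeasurePreserving_snd (μ := (volume : Measure ℝ)) (ν := volume)).ae
    (hE.ae_notMem volume)

/-- `μ_ϱ`-almost every point is interior to the layer. -/
lemma ae_interior (hϱ : ϱ ∈ R r₀ H) :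
    ∀ᵐ p ∂(mu r₀ Ω H ϱ), p.2 ∈ Ioo 0 H ∧ 0 < p.1 ∧ p.1 < ϱ p.2 := by
  filter_upwards [ae_mem_D hϱ, mu_absolutelyContinuous (ae_fst_ne_of_mem_R hϱ),
    mu_absolutelyContinuous (ae_fst_ne (measurable_const (a := (0 : ℝ)))),
    mu_absolutelyContinuous (ae_snd_notMem ((countable_singleton (0 : ℝ)).insert H))]
    with p h1 h2 h3 h4
  simp only [mem_insert_iff, mem_singleton_iff, not_or] at h4
  exact ⟨⟨lt_of_le_of_ne h1.1.1 (Ne.symm h4.2), lt_of_le_of_ne h1.1.2 h4.1⟩,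
    lt_of_le_of_ne h1.2.1 (Ne.symm h3), lt_of_le_of_ne h1.2.2 (h2 h1.1)⟩

end Mu

/-! ### The depth fields of a potential -/

/-- The properties of the potentials `p(s,ζ)` used in the layer problem: they are Lipschitz and
nondecreasing in both variables. -/
structure IsPotential (p : ℝ × ℝ → ℝ) : Prop where
  lipschitz : ∃ L, LipschitzWith L p
  mono : ∀ x y : ℝ × ℝ, x.1 ≤ y.1 → x.2 ≤ y.2 → p x ≤ p y

/-- The cap `S` bounds the minimizing depths of `p`. -/
structure IsCap (r₀ Ω H a : ℝ) (p : ℝ × ℝ → ℝ) (S : ℝ) : Prop where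
  mem : S ∈ Ico 0 (1 / (2 * r₀ ^ 2))
  lt : ∀ s ∈ Ico S (1 / (2 * r₀ ^ 2)), p (1 / (2 * r₀ ^ 2), H / a) < f₀ r₀ Ω s

/-- The least minimizing depth at height `z`. -/
noncomputable def lo (r₀ Ω : ℝ) (θ : ℝ → ℝ) (p : ℝ × ℝ → ℝ) (z : ℝ) : ℝ :=
  loDepth r₀ Ω fun s => p (s, phi θ z)

/-- The greatest minimizing depth at height `z`. -/
noncomputable def hi (r₀ Ω : ℝ) (θ : ℝ → ℝ) (p : ℝ × ℝ → ℝ) (z : ℝ) : ℝ :=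
  hiDepth r₀ Ω fun s => p (s, phi θ z)

section Fields

variable {r₀ Ω H a b S : ℝ} {θ : ℝ → ℝ} {p p' : ℝ × ℝ → ℝ} {ϱ : ℝ → ℝ}

lemma IsPotential.continuous (hp : IsPotential p) : Continuous p := by
  obtain ⟨L, hL⟩ := hp.lipschitz
  exact hL.continuous

lemma IsPotential.continuous_slice (hp : IsPotential p) (ζ : ℝ) :
    Continuous fun s => p (s, ζ) :=
  hp.continuous.comp (by fun_prop)

/-- The cap depends on `B` alone, so all potentials bounded by `B` at the upper corner share it. -/
lemma exists_isCap (hr₀ : 0 < r₀) (hΩ : 0 < Ω) (H a B : ℝ) :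
    ∃ S, ∀ p : ℝ × ℝ → ℝ, p (1 / (2 * r₀ ^ 2), H / a) ≤ B → IsCap r₀ Ω H a p S := by
  obtain ⟨S, hS, h⟩ := exists_lt_f₀ hr₀ hΩ B
  exact ⟨S, fun p hp => ⟨hS, fun s hs => hp.trans_lt (h s hs)⟩⟩

lemma IsPotential.le_top (hp : IsPotential p) (hθ : IsAmbient H a b θ) (ha : 0 < a) {s z : ℝ}
    (hs : s ≤ 1 / (2 * r₀ ^ 2)) (hz : z ∈ Icc 0 H) :
    p (s, phi θ z) ≤ p (1 / (2 * r₀ ^ 2), H / a) :=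
  hp.mono _ _ hs (phi_mem hθ ha hz).2

lemma IsCap.slice_lt (hc : IsCap r₀ Ω H a p S) (hp : IsPotential p) (hθ : IsAmbient H a b θ)
    (ha : 0 < a) {z : ℝ} (hz : z ∈ Icc 0 H) :
    ∀ s ∈ Ico S (1 / (2 * r₀ ^ 2)), p (s, phi θ z) < f₀ r₀ Ω s := fun s hs =>
  (hp.le_top hθ ha hs.2.le hz).trans_lt (hc.lt s hs)

variable (hr₀ : 0 < r₀) (hΩ : 0 < Ω) (ha : 0 < a) (hθ : IsAmbient H a b θ)
  (hp : IsPotential p) (hc : IsCap r₀ Ω H a p S)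

include hr₀ hΩ ha hθ hp hc

lemma isCompact_slice_argmins {z : ℝ} (hz : z ∈ Icc 0 H) :
    IsCompact (argmins r₀ Ω fun s => p (s, phi θ z)) :=
  isCompact_argmins hr₀ hΩ (hp.continuous_slice _) hc.mem (hc.slice_lt hp hθ ha hz)

lemma nonempty_slice_argmins {z : ℝ} (hz : z ∈ Icc 0 H) :
    (argmins r₀ Ω fun s => p (s, phi θ z)).Nonempty :=
  exists_isMin_layerCost hr₀ hΩ (hp.continuous_slice _) hc.mem (hc.slice_lt hp hθ ha hz)

lemma slice_argmins_subset {z : ℝ} (hz : z ∈ Icc 0 H) :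
    (argmins r₀ Ω fun s => p (s, phi θ z)) ⊆ Icc 0 S :=
  argmins_subset hr₀ hΩ (hp.continuous_slice _) hc.mem (hc.slice_lt hp hθ ha hz)

lemma lo_mem {z : ℝ} (hz : z ∈ Icc 0 H) :
    lo r₀ Ω θ p z ∈ argmins r₀ Ω fun s => p (s, phi θ z) :=
  (isCompact_slice_argmins hr₀ hΩ ha hθ hp hc hz).sInf_mem
    (nonempty_slice_argmins hr₀ hΩ ha hθ hp hc hz)

lemma hi_mem {z : ℝ} (hz : z ∈ Icc 0 H) :
    hi r₀ Ω θ p z ∈ argmins r₀ Ω fun s => p (s, phi θ z) :=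
  (isCompact_slice_argmins hr₀ hΩ ha hθ hp hc hz).sSup_mem
    (nonempty_slice_argmins hr₀ hΩ ha hθ hp hc hz)

lemma lo_le {z x : ℝ} (hz : z ∈ Icc 0 H) (hx : x ∈ argmins r₀ Ω fun s => p (s, phi θ z)) :
    lo r₀ Ω θ p z ≤ x :=
  csInf_le (isCompact_slice_argmins hr₀ hΩ ha hθ hp hc hz).bddBelow hx

lemma le_hi {z x : ℝ} (hz : z ∈ Icc 0 H) (hx : x ∈ argmins r₀ Ω fun s => p (s, phi θ z)) :
    x ≤ hi r₀ Ω θ p z :=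
  le_csSup (isCompact_slice_argmins hr₀ hΩ ha hθ hp hc hz).bddAbove hx

lemma lo_le_cap {z : ℝ} (hz : z ∈ Icc 0 H) : lo r₀ Ω θ p z ≤ S :=
  (slice_argmins_subset hr₀ hΩ ha hθ hp hc hz (lo_mem hr₀ hΩ ha hθ hp hc hz)).2

omit hc in
lemma slice_argmins_compare {z z' x y : ℝ} (hz : z ∈ Icc 0 H) (hz' : z' ∈ Icc 0 H) (hzz : z ≤ z')
    (hx : x ∈ argmins r₀ Ω fun s => p (s, phi θ z))
    (hy : y ∈ argmins r₀ Ω fun s => p (s, phi θ z')) (hyx : y < x) :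
    x ∈ (argmins r₀ Ω fun s => p (s, phi θ z')) ∧
      y ∈ (argmins r₀ Ω fun s => p (s, phi θ z)) ∧
      ∀ s ∈ Icc y x, p (s, phi θ z) = p (s, phi θ z') :=
  argmins_compare hr₀ hΩ (hp.continuous_slice _) (hp.continuous_slice _)
    (fun s _ => hp.mono (s, phi θ z) (s, phi θ z') le_rfl
      ((strictMonoOn_phi hθ ha).monotoneOn hz hz' hzz)) hx hy hyx

/-- Were the least depths in the wrong order, the smaller one would by comparison also be optimal at
the lower height, against minimality there. -/
lemma lo_monotoneOn : MonotoneOn (lo r₀ Ω θ p) (Icc 0 H) := by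
  intro z hz z' hz' hzz
  by_contra! hlt
  have := slice_argmins_compare hr₀ hΩ ha hθ hp hz hz' hzz (lo_mem hr₀ hΩ ha hθ hp hc hz)
    (lo_mem hr₀ hΩ ha hθ hp hc hz') hlt
  exact absurd (lo_le hr₀ hΩ ha hθ hp hc hz this.2.1) (not_le.2 hlt)

lemma hi_monotoneOn : MonotoneOn (hi r₀ Ω θ p) (Icc 0 H) := by
  intro z hz z' hz' hzz
  by_contra! hlt
  have := slice_argmins_compare hr₀ hΩ ha hθ hp hz hz' hzz (hi_mem hr₀ hΩ ha hθ hp hc hz)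
    (hi_mem hr₀ hΩ ha hθ hp hc hz') hlt
  exact absurd (le_hi hr₀ hΩ ha hθ hp hc hz' this.1) (not_le.2 hlt)

omit hr₀ hΩ ha hθ hp hc in
lemma mem_R_of_monotoneOn (hm : MonotoneOn ϱ (Icc 0 H))
    (h : ∀ z ∈ Icc 0 H, ϱ z ∈ Ico 0 (1 / (2 * r₀ ^ 2))) : ϱ ∈ R r₀ H := by
  refine ⟨Monotone.measurable fun z z' hzz => hm z.2 z'.2 hzz, h⟩

lemma lo_mem_R : lo r₀ Ω θ p ∈ R r₀ H :=
  mem_R_of_monotoneOn (lo_monotoneOn hr₀ hΩ ha hθ hp hc)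
    fun _ hz => (lo_mem hr₀ hΩ ha hθ hp hc hz).1

lemma hi_mem_R : hi r₀ Ω θ p ∈ R r₀ H :=
  mem_R_of_monotoneOn (hi_monotoneOn hr₀ hΩ ha hθ hp hc)
    fun _ hz => (hi_mem hr₀ hΩ ha hθ hp hc hz).1

/-- Depths of nearby problems do not fall much below the least depth. -/
lemma exists_lt_of_lt_lo {z t : ℝ} (hz : z ∈ Icc 0 H) (ht : t < lo r₀ Ω θ p z) :
    ∃ δ > 0, ∀ u : ℝ → ℝ, Continuous u →
      (∀ s ∈ Ico 0 (1 / (2 * r₀ ^ 2)), |u s - p (s, phi θ z)| ≤ δ) →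
      ∀ x ∈ argmins r₀ Ω u, t < x := by
  have hlo := lo_mem hr₀ hΩ ha hθ hp hc hz
  obtain ⟨δ, hδ, h⟩ := argmins_stable hr₀ hΩ (hp.continuous_slice (phi θ z)) hc.mem
    (nonempty_slice_argmins hr₀ hΩ ha hθ hp hc hz)
    (slice_argmins_subset hr₀ hΩ ha hθ hp hc hz) (K := Icc 0 t) isCompact_Icc
    (Icc_subset_Icc_right (ht.le.trans (lo_le_cap hr₀ hΩ ha hθ hp hc hz)))
    (Set.disjoint_left.2 fun x hx hx' =>
      absurd (lo_le hr₀ hΩ ha hθ hp hc hz hx') (not_le.2 (hx.2.trans_lt ht)))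
  refine ⟨δ, hδ, fun u hu hclose x hx => ?_⟩
  by_contra! hle
  exact Set.disjoint_left.1 (h u hu hclose) ⟨hx.1.1, hle⟩ hx

/-- Depths of nearby problems do not rise much above the greatest depth. -/
lemma exists_lt_of_hi_lt {z t : ℝ} (hz : z ∈ Icc 0 H) (ht : hi r₀ Ω θ p z < t) :
    ∃ δ > 0, ∀ u : ℝ → ℝ, Continuous u →
      (∀ s ∈ Ico 0 (1 / (2 * r₀ ^ 2)), |u s - p (s, phi θ z)| ≤ δ) →
      ∀ x ∈ argmins r₀ Ω u, x ≤ S → x < t := by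
  obtain ⟨δ, hδ, h⟩ := argmins_stable hr₀ hΩ (hp.continuous_slice (phi θ z)) hc.mem
    (nonempty_slice_argmins hr₀ hΩ ha hθ hp hc hz)
    (slice_argmins_subset hr₀ hΩ ha hθ hp hc hz) (K := Icc t S) isCompact_Icc
    (Icc_subset_Icc_left ((hi_mem hr₀ hΩ ha hθ hp hc hz).1.1.trans ht.le))
    (Set.disjoint_left.2 fun x hx hx' =>
      absurd (le_hi hr₀ hΩ ha hθ hp hc hz hx') (not_le.2 (ht.trans_le hx.1)))
  refine ⟨δ, hδ, fun u hu hclose x hx hxS => ?_⟩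
  by_contra! hle
  exact Set.disjoint_left.1 (h u hu hclose) ⟨hle, hxS⟩ hx

/-- The least depth is lower semicontinuous in the height. -/
lemma eventually_lt_lo {z t : ℝ} (hz : z ∈ Icc 0 H) (ht : t < lo r₀ Ω θ p z) :
    ∀ᶠ z' in 𝓝[Icc 0 H] z, t < lo r₀ Ω θ p z' := by
  obtain ⟨δ, hδ, h⟩ := exists_lt_of_lt_lo hr₀ hΩ ha hθ hp hc hz ht
  obtain ⟨L, hL⟩ := hp.lipschitz
  have h1 : Tendsto (fun z' => L * |phi θ z' - phi θ z|) (𝓝[Icc 0 H] z) (𝓝 0) := by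
    have := ((continuousOn_phi hθ ha z hz).sub_const (phi θ z)).abs.const_mul (L : ℝ)
    simpa using this
  filter_upwards [h1.eventually (gt_mem_nhds hδ), self_mem_nhdsWithin] with z' hz1 hz2
  refine h _ (hp.continuous_slice (phi θ z')) (fun s _ => ?_) _
    (lo_mem hr₀ hΩ ha hθ hp hc hz2)
  rw [← Real.dist_eq]
  refine (hL.dist_le_mul _ _).trans ?_
  rw [Prod.dist_eq, dist_self, max_eq_right dist_nonneg, Real.dist_eq]
  exact hz1.le

/-- Off a countable set of heights, the potential is locally constant in its second variable
between the least and the greatest depth. -/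
lemma exists_countable_tie : ∃ E : Set ℝ, E.Countable ∧ ∀ z ∈ Ioo 0 H, z ∉ E →
    ∀ s, lo r₀ Ω θ p z < s → s < hi r₀ Ω θ p z →
      ∃ ζ', phi θ z < ζ' ∧ ∀ ζ ∈ Icc (phi θ z) ζ', p (s, ζ) = p (s, phi θ z) := by
  rcases le_or_gt H 0 with hH | hH
  · exact ⟨∅, countable_empty, fun z hz => absurd (hz.1.trans hz.2) (not_lt.2 hH)⟩
  -- The constant extension beyond `[0, H]` is monotone on the whole line, so its discontinuities
  -- are countable; they form the exceptional set.
  set g : ℝ → ℝ := fun z => lo r₀ Ω θ p (projIcc 0 H hH.le z)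
  have hg : Monotone g := fun x y hxy =>
    lo_monotoneOn hr₀ hΩ ha hθ hp hc (projIcc 0 H hH.le x).2 (projIcc 0 H hH.le y).2
      (monotone_projIcc hH.le hxy)
  refine ⟨_, hg.countable_not_continuousAt, fun z hz hzE s hs1 hs2 => ?_⟩
  have hzc : ContinuousAt g z := by simpa using hzE
  have hgz : ∀ z' ∈ Icc 0 H, g z' = lo r₀ Ω θ p z' := fun z' hz' => by
    simp only [g, projIcc_of_mem hH.le hz']
  have hzI : z ∈ Icc 0 H := ⟨hz.1.le, hz.2.le⟩
  -- At a continuity point the least depth at some `z' > z` is still below `s`, hence below the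
  -- greatest depth at `z`. This wrong order forces the slices at `z` and `z'` to agree at `s`, and
  -- monotonicity fills in the values of `ζ` between.
  have h1 : ∀ᶠ z' in 𝓝[>] z, g z' < s := by
    refine nhdsWithin_le_nhds (hzc.eventually (gt_mem_nhds ?_))
    rwa [hgz z hzI]
  obtain ⟨z', hz'1, hz'2⟩ := (h1.and (Ioo_mem_nhdsGT hz.2)).exists
  have hz'I : z' ∈ Icc 0 H := ⟨hz.1.le.trans hz'2.1.le, hz'2.2.le⟩
  rw [hgz z' hz'I] at hz'1
  have h2 := (slice_argmins_compare hr₀ hΩ ha hθ hp hzI hz'I hz'2.1.le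
    (hi_mem hr₀ hΩ ha hθ hp hc hzI) (lo_mem hr₀ hΩ ha hθ hp hc hz'I) (hz'1.trans hs2)).2.2 s
    ⟨hz'1.le, hs2.le⟩
  refine ⟨phi θ z', strictMonoOn_phi hθ ha hzI hz'I hz'2.1, fun ζ hζ => le_antisymm ?_ ?_⟩
  · rw [h2]
    exact hp.mono _ _ le_rfl hζ.2
  · exact hp.mono _ _ le_rfl hζ.1

end Fields

/-! ### Integrals of potentials over layers -/

section Integrals

variable {r₀ Ω H a b S : ℝ} {θ : ℝ → ℝ} {p p' : ℝ × ℝ → ℝ} {ϱ : ℝ → ℝ}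

/-- The minimal total layer cost. -/
noncomputable def minCost (r₀ Ω H : ℝ) (θ : ℝ → ℝ) (p : ℝ × ℝ → ℝ) : ℝ :=
  ∫ z in Icc 0 H, layerCost r₀ Ω (fun s => p (s, phi θ z)) (lo r₀ Ω θ p z)

lemma continuousOn_bff (hθ : IsAmbient H a b θ) (ha : 0 < a) :
    ContinuousOn (bff θ) (univ ×ˢ Icc 0 H) := by
  refine continuousOn_fst.prodMk ?_
  exact (continuousOn_phi hθ ha).comp continuousOn_snd fun p hp => hp.2

lemma mu_absolutelyContinuous_strip :
    mu r₀ Ω H ϱ ≪ volume.restrict ((univ : Set ℝ) ×ˢ Icc 0 H) :=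
  (withDensity_absolutelyContinuous _ _).trans
    (Measure.absolutelyContinuous_of_le
      (Measure.restrict_mono (fun _ hp => mem_prod.2 ⟨mem_univ _, hp.1⟩) le_rfl))

lemma aemeasurable_bff (hθ : IsAmbient H a b θ) (ha : 0 < a) :
    AEMeasurable (bff θ) (mu r₀ Ω H ϱ) :=
  ((continuousOn_bff hθ ha).aemeasurable
    (MeasurableSet.univ.prod measurableSet_Icc)).mono_ac mu_absolutelyContinuous_strip

lemma bff_mem (hθ : IsAmbient H a b θ) (ha : 0 < a) (hϱ : ϱ ∈ R r₀ H) {x : ℝ × ℝ}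
    (hx : x ∈ D H ϱ) : bff θ x ∈ Icc 0 (1 / (2 * r₀ ^ 2)) ×ˢ Icc 0 (H / a) :=
  ⟨⟨hx.2.1, hx.2.2.trans (hϱ.2 hx.1).2.le⟩, phi_mem hθ ha hx.1⟩

lemma integrable_comp_bff (hθ : IsAmbient H a b θ) (ha : 0 < a) (hϱ : ϱ ∈ R r₀ H)
    [IsFiniteMeasure (mu r₀ Ω H ϱ)] {g : ℝ × ℝ → ℝ} (hg : Continuous g) :
    Integrable (fun x => g (bff θ x)) (mu r₀ Ω H ϱ) := by
  obtain ⟨C, hC⟩ := ((isCompact_Icc.prod isCompact_Icc).image_of_continuousOn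
    (hg.continuousOn (s := Icc 0 (1 / (2 * r₀ ^ 2)) ×ˢ Icc 0 (H / a)))).isBounded.exists_norm_le
  refine Integrable.of_bound (hg.measurable.comp_aemeasurable
    (aemeasurable_bff hθ ha)).aestronglyMeasurable C ?_
  filter_upwards [ae_mem_D hϱ] with x hx
  exact hC _ ⟨_, bff_mem hθ ha hϱ hx, rfl⟩

lemma integrable_f₀_of_le (hr₀ : 0 < r₀) (hΩ : 0 < Ω) (hϱ : ϱ ∈ R r₀ H)
    (hS : S ∈ Ico 0 (1 / (2 * r₀ ^ 2))) (hle : ∀ z ∈ Icc 0 H, ϱ z ≤ S) :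
    Integrable (fun x : ℝ × ℝ => f₀ r₀ Ω x.1) (mu r₀ Ω H ϱ) := by
  have := isFiniteMeasure_mu (Ω := Ω) hr₀ hϱ hS hle
  refine Integrable.of_bound ((measurable_f₀ r₀ Ω).comp measurable_fst).aestronglyMeasurable
    (f₀ r₀ Ω S) ?_
  filter_upwards [ae_mem_D hϱ] with x hx
  have h1 : x.1 ≤ S := hx.2.2.trans (hle _ hx.1)
  rw [Real.norm_of_nonneg (f₀_pos hr₀ hΩ (h1.trans_lt hS.2)).le]
  exact (f₀_strictMonoOn hr₀ hΩ).monotoneOn (h1.trans_lt hS.2) hS.2 h1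

lemma integral_cost (hθ : IsAmbient H a b θ) (ha : 0 < a) (hp : Continuous p) (hϱ : ϱ ∈ R r₀ H)
    [IsFiniteMeasure (mu r₀ Ω H ϱ)]
    (hf : Integrable (fun x : ℝ × ℝ => f₀ r₀ Ω x.1) (mu r₀ Ω H ϱ)) :
    IntegrableOn (fun z => layerCost r₀ Ω (fun s => p (s, phi θ z)) (ϱ z)) (Icc 0 H) ∧
      ∫ x, (f₀ r₀ Ω x.1 - p (bff θ x)) ∂(mu r₀ Ω H ϱ) =
        ∫ z in Icc 0 H, layerCost r₀ Ω (fun s => p (s, phi θ z)) (ϱ z) :=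
  integral_mu hϱ (hf.sub (integrable_comp_bff hθ ha hϱ hp))

lemma integral_layerMass (hϱ : ϱ ∈ R r₀ H) [IsFiniteMeasure (mu r₀ Ω H ϱ)] :
    IntegrableOn (fun z => layerMass r₀ Ω (ϱ z)) (Icc 0 H) ∧
      (mu r₀ Ω H ϱ).real univ = ∫ z in Icc 0 H, layerMass r₀ Ω (ϱ z) := by
  have := integral_mu (Ω := Ω) hϱ (integrable_const (1 : ℝ))
  simp only [one_mul, integral_const, smul_eq_mul, mul_one] at this
  exact this

variable (hr₀ : 0 < r₀) (hΩ : 0 < Ω) (ha : 0 < a) (hθ : IsAmbient H a b θ)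
  (hp : IsPotential p) (hc : IsCap r₀ Ω H a p S)

include hr₀ hΩ ha hθ hp hc

lemma integral_cost_lo :
    IntegrableOn (fun z => layerCost r₀ Ω (fun s => p (s, phi θ z)) (lo r₀ Ω θ p z)) (Icc 0 H) ∧
      ∫ x, (f₀ r₀ Ω x.1 - p (bff θ x)) ∂(mu r₀ Ω H (lo r₀ Ω θ p)) = minCost r₀ Ω H θ p := by
  have hR := lo_mem_R hr₀ hΩ ha hθ hp hc
  have hle : ∀ z ∈ Icc 0 H, lo r₀ Ω θ p z ≤ S := fun _ hz => lo_le_cap hr₀ hΩ ha hθ hp hc hz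
  have := isFiniteMeasure_mu (Ω := Ω) hr₀ hR hc.mem hle
  exact integral_cost hθ ha hp.continuous hR (integrable_f₀_of_le hr₀ hΩ hR hc.mem hle)

lemma minCost_le (hϱ : ϱ ∈ R r₀ H)
    (hi : IntegrableOn (fun z => layerCost r₀ Ω (fun s => p (s, phi θ z)) (ϱ z)) (Icc 0 H)) :
    minCost r₀ Ω H θ p ≤ ∫ z in Icc 0 H, layerCost r₀ Ω (fun s => p (s, phi θ z)) (ϱ z) :=
  setIntegral_mono_on (integral_cost_lo hr₀ hΩ ha hθ hp hc).1 hi measurableSet_Icc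
    fun _ hz => (lo_mem hr₀ hΩ ha hθ hp hc hz).2 _ (hϱ.2 hz)

/-- A field of depths attaining the minimal total cost is optimal at almost every height. -/
lemma ae_mem_argmins (hϱ : ϱ ∈ R r₀ H)
    (hi : IntegrableOn (fun z => layerCost r₀ Ω (fun s => p (s, phi θ z)) (ϱ z)) (Icc 0 H))
    (h : ∫ z in Icc 0 H, layerCost r₀ Ω (fun s => p (s, phi θ z)) (ϱ z) ≤ minCost r₀ Ω H θ p) :
    ∀ᵐ z ∂(volume.restrict (Icc 0 H)), ϱ z ∈ argmins r₀ Ω fun s => p (s, phi θ z) := by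
  have hlo := (integral_cost_lo hr₀ hΩ ha hθ hp hc).1
  have hnn : 0 ≤ᵐ[volume.restrict (Icc 0 H)] fun z =>
      layerCost r₀ Ω (fun s => p (s, phi θ z)) (ϱ z) -
        layerCost r₀ Ω (fun s => p (s, phi θ z)) (lo r₀ Ω θ p z) := by
    filter_upwards [ae_restrict_mem measurableSet_Icc] with z hz
    exact sub_nonneg.2 ((lo_mem hr₀ hΩ ha hθ hp hc hz).2 _ (hϱ.2 hz))
  have h0 : ∫ z in Icc 0 H, (layerCost r₀ Ω (fun s => p (s, phi θ z)) (ϱ z) -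
        layerCost r₀ Ω (fun s => p (s, phi θ z)) (lo r₀ Ω θ p z)) = 0 := by
    refine le_antisymm ?_ (integral_nonneg_of_ae hnn)
    rw [integral_sub hi hlo]
    exact sub_nonpos.2 h
  have := (integral_eq_zero_iff_of_nonneg_ae hnn (hi.sub hlo)).1 h0
  filter_upwards [this, ae_restrict_mem measurableSet_Icc] with z hz hzI
  have he : layerCost r₀ Ω (fun s => p (s, phi θ z)) (ϱ z) =
        layerCost r₀ Ω (fun s => p (s, phi θ z)) (lo r₀ Ω θ p z) := sub_eq_zero.1 hz
  refine ⟨hϱ.2 hzI, fun y hy => ?_⟩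
  rw [he]
  exact (lo_mem hr₀ hΩ ha hθ hp hc hzI).2 y hy

/-- Infimum and integral commute because the pointwise minimizer `lo` is monotone, hence Borel, and
is itself an admissible field of depths. -/
lemma scrH_eq {P : ℝ × ℝ → ℝ → ℝ}
    (hP : ∀ s ∈ Ico 0 (1 / (2 * r₀ ^ 2)), ∀ z ∈ Icc 0 H, P (s, z) (θ z) = p (s, phi θ z)) :
    scrH r₀ Ω H θ P = minCost r₀ Ω H θ p := by
  have hS : ∀ ϱ ∈ R r₀ H, ∀ z ∈ Icc 0 H, Sfun r₀ Ω θ P (ϱ z) z =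
      layerCost r₀ Ω (fun s => p (s, phi θ z)) (ϱ z) := fun ϱ hϱ z hz =>
    layerCost_congr (u := fun s => P (s, z) (θ z)) (hϱ.2 hz) fun s hs => hP s hs z hz
  have hR := lo_mem_R hr₀ hΩ ha hθ hp hc
  refine IsLeast.csInf_eq ⟨⟨lo r₀ Ω θ p, hR, ?_, ?_⟩, ?_⟩
  · exact (integral_cost_lo hr₀ hΩ ha hθ hp hc).1.congr_fun
      (fun z hz => (hS _ hR z hz).symm) measurableSet_Icc
  · exact setIntegral_congr_fun measurableSet_Icc fun z hz => (hS _ hR z hz).symm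
  · rintro _ ⟨ϱ, hϱ, hi, rfl⟩
    rw [setIntegral_congr_fun measurableSet_Icc (hS ϱ hϱ)]
    exact minCost_le hr₀ hΩ ha hθ hp hc hϱ (hi.congr_fun (hS ϱ hϱ) measurableSet_Icc)

end Integrals

/-! ### The target region -/

section Target

variable {l : ℝ} {ψ : ℝ × ℝ → ℝ}

lemma isOpen_discPlus : IsOpen (discPlus l) := by
  refine IsOpen.inter ?_ (isOpen_Ioi.prod isOpen_Ioi)
  exact isOpen_lt (by fun_prop) continuous_const

lemma discPlus_subset_Icc (hl : 0 < l) : discPlus l ⊆ Icc 0 l ×ˢ Icc 0 l := by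
  rintro q ⟨h, h1, h2⟩
  have h1' : 0 < q.1 := h1
  have h2' : 0 < q.2 := h2
  have h' : q.1 ^ 2 + q.2 ^ 2 < l ^ 2 := h
  refine ⟨⟨h1'.le, ?_⟩, ⟨h2'.le, ?_⟩⟩ <;> nlinarith

lemma closure_discPlus_subset (hl : 0 < l) : closure (discPlus l) ⊆ Icc 0 l ×ˢ Icc 0 l :=
  closure_minimal (discPlus_subset_Icc hl) (isClosed_Icc.prod isClosed_Icc)

lemma isCompact_closure_discPlus (hl : 0 < l) : IsCompact (closure (discPlus l)) :=
  (isCompact_Icc.prod isCompact_Icc).of_isClosed_subset isClosed_closure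
    (closure_discPlus_subset hl)

lemma zero_mem_closure_discPlus (hl : 0 < l) : ((0, 0) : ℝ × ℝ) ∈ closure (discPlus l) := by
  have h1 : Tendsto (fun t : ℝ => (t, t)) (𝓝[>] 0) (𝓝 ((0, 0) : ℝ × ℝ)) :=
    Tendsto.mono_left (Continuous.tendsto' (f := fun t : ℝ => (t, t)) (by fun_prop) 0 _ rfl)
      nhdsWithin_le_nhds
  refine mem_closure_of_tendsto h1 ?_
  filter_upwards [Ioo_mem_nhdsGT (by positivity : 0 < l / 2)] with t ht
  refine ⟨?_, ht.1, ht.1⟩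
  change t ^ 2 + t ^ 2 < l ^ 2
  nlinarith [ht.1, ht.2]

lemma closure_discPlus_nonempty (hl : 0 < l) : (closure (discPlus l)).Nonempty :=
  ⟨_, zero_mem_closure_discPlus hl⟩

lemma discPlus_subset : discPlus l ⊆ disc l ∩ quadrant := fun _ hq =>
  ⟨hq.1, (mem_Ioi.1 hq.2.1).le, (mem_Ioi.1 hq.2.2).le⟩

lemma closure_discPlus_subset_quadrant (hl : 0 < l) : closure (discPlus l) ⊆ quadrant :=
  fun _ hq => ⟨(closure_discPlus_subset hl hq).1.1, (closure_discPlus_subset hl hq).2.1⟩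

lemma abs_le_of_mem_closure_discPlus (hl : 0 < l) :
    ∀ q ∈ closure (discPlus l), |q.1| ≤ l ∧ |q.2| ≤ l := fun q hq => by
  obtain ⟨h1, h2⟩ := closure_discPlus_subset hl hq
  rw [abs_of_nonneg h1.1, abs_of_nonneg h2.1]
  exact ⟨h1.2, h2.2⟩

/-- The potential conjugate to `ψ`. -/
noncomputable def pot (l : ℝ) (ψ : ℝ × ℝ → ℝ) : ℝ × ℝ → ℝ := conj (closure (discPlus l)) ψ

lemma isPotential_pot (hl : 0 < l) (hψ : ContinuousOn ψ (closure (discPlus l))) :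
    IsPotential (pot l ψ) where
  lipschitz := ⟨_, lipschitzWith_conj (isCompact_closure_discPlus hl)
    (closure_discPlus_nonempty hl) hψ hl.le (abs_le_of_mem_closure_discPlus hl)⟩
  mono _ _ := conj_mono_left (isCompact_closure_discPlus hl)
    (closure_discPlus_nonempty hl) hψ
    fun _ hq => ⟨(closure_discPlus_subset hl hq).1.1, (closure_discPlus_subset hl hq).2.1⟩

lemma IsPotential.ae_differentiableAt_bff {p : ℝ × ℝ → ℝ} (hp : IsPotential p) {H a b : ℝ}
    {θ : ℝ → ℝ} (hθ : IsAmbient H a b θ) (ha : 0 < a) :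
    ∀ᵐ x : ℝ × ℝ, x.2 ∈ Ioo 0 H → DifferentiableAt ℝ p (bff θ x) := by
  obtain ⟨L, hL⟩ := hp.lipschitz
  have h0 : volume {x | DifferentiableAt ℝ p x}ᶜ = 0 := hL.ae_differentiableAt (μ := volume)
  filter_upwards [ae_notMem_of_phi hθ ha h0
    (measurableSet_of_differentiableAt ℝ p).compl] with x hx hxI
  simpa using hx hxI

end Target

/-! ### The reduced dual functional and its first variation -/

/-- The dual functional as a function of the target potential alone. -/
noncomputable def dualJ (r₀ Ω H l : ℝ) (θ : ℝ → ℝ) (σ : Measure (ℝ × ℝ)) (ψ : ℝ × ℝ → ℝ) : ℝ :=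
  -(∫ q, ψ q ∂σ) + minCost r₀ Ω H θ (pot l ψ)

/-- `ψ` maximizes the reduced dual functional. -/
structure IsMaxDual (r₀ Ω H l : ℝ) (θ : ℝ → ℝ) (σ : Measure (ℝ × ℝ)) (ψ : ℝ × ℝ → ℝ) :
    Prop where
  cont : ContinuousOn ψ (closure (discPlus l))
  le : ∀ χ, ContinuousOn χ (closure (discPlus l)) →
    dualJ r₀ Ω H l θ σ χ ≤ dualJ r₀ Ω H l θ σ ψ

section Sigma

variable {l : ℝ} {σ : Measure (ℝ × ℝ)} {ψ : ℝ × ℝ → ℝ}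

lemma ae_mem_discPlus (hσ : σ (discPlus l)ᶜ = 0) : ∀ᵐ q ∂σ, q ∈ discPlus l := hσ

lemma aestronglyMeasurable_of_continuousOn (hσ : σ (discPlus l)ᶜ = 0)
    (hψ : ContinuousOn ψ (closure (discPlus l))) : AEStronglyMeasurable ψ σ := by
  rw [← Measure.restrict_eq_self_of_ae_mem (ae_mem_discPlus hσ)]
  exact (hψ.mono subset_closure).aestronglyMeasurable isOpen_discPlus.measurableSet

lemma integrable_of_continuousOn (hl : 0 < l) [IsFiniteMeasure σ] (hσ : σ (discPlus l)ᶜ = 0)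
    (hψ : ContinuousOn ψ (closure (discPlus l))) : Integrable ψ σ := by
  obtain ⟨C, hC⟩ :=
    ((isCompact_closure_discPlus hl).image_of_continuousOn hψ).isBounded.exists_norm_le
  refine Integrable.of_bound (aestronglyMeasurable_of_continuousOn hσ hψ) C ?_
  filter_upwards [ae_mem_discPlus hσ] with q hq
  exact hC _ ⟨q, subset_closure hq, rfl⟩

end Sigma

section Variation

variable {r₀ Ω H a b l S : ℝ} {θ : ℝ → ℝ} {σ : Measure (ℝ × ℝ)} {ψ χ : ℝ × ℝ → ℝ}

variable (hr₀ : 0 < r₀) (hΩ : 0 < Ω) (ha : 0 < a) (hl : 0 < l) (hθ : IsAmbient H a b θ)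

include hr₀ hΩ ha hl hθ

/-- The layer optimal for `χ` is exact for `χ` and only a competitor for `ψ`. Combined with
maximality of `ψ`, this gives the variational inequality, with the measure taken at the perturbed
potential. -/
lemma integral_pot_sub_le [IsFiniteMeasure σ] (hσ : σ (discPlus l)ᶜ = 0)
    (hψ : IsMaxDual r₀ Ω H l θ σ ψ)
    (hχ : ContinuousOn χ (closure (discPlus l))) (hc : IsCap r₀ Ω H a (pot l ψ) S)
    (hc' : IsCap r₀ Ω H a (pot l χ) S) :
    ∫ x, (pot l ψ (bff θ x) - pot l χ (bff θ x)) ∂(mu r₀ Ω H (lo r₀ Ω θ (pot l χ))) ≤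
      ∫ q, (χ q - ψ q) ∂σ := by
  have hp := isPotential_pot hl hψ.cont
  have hp' := isPotential_pot hl hχ
  have hR := lo_mem_R hr₀ hΩ ha hθ hp' hc'
  have hle : ∀ z ∈ Icc 0 H, lo r₀ Ω θ (pot l χ) z ≤ S := fun _ hz =>
    lo_le_cap hr₀ hΩ ha hθ hp' hc' hz
  have := isFiniteMeasure_mu (Ω := Ω) hr₀ hR hc.mem hle
  have hf := integrable_f₀_of_le hr₀ hΩ hR hc.mem hle
  have e1 := (integral_cost_lo hr₀ hΩ ha hθ hp' hc').2
  obtain ⟨i2, e2⟩ := integral_cost hθ ha hp.continuous hR hf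
  have e3 := minCost_le hr₀ hΩ ha hθ hp hc hR i2
  have e4 := hψ.le χ hχ
  unfold dualJ at e4
  have j1 := integrable_comp_bff (Ω := Ω) hθ ha hR hp.continuous
  have j2 := integrable_comp_bff (Ω := Ω) hθ ha hR hp'.continuous
  rw [integral_sub hf j2] at e1
  rw [integral_sub hf j1] at e2
  rw [integral_sub j1 j2, integral_sub (integrable_of_continuousOn hl hσ hχ)
    (integrable_of_continuousOn hl hσ hψ.cont)]
  linarith

omit hl in
/-- Convergence of the depths of perturbed potentials, away from the ties. -/
lemma eventually_depth {p : ℝ × ℝ → ℝ} {pn : ℕ → ℝ × ℝ → ℝ} (hp : IsPotential p)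
    (hpn : ∀ n, IsPotential (pn n)) (hc : IsCap r₀ Ω H a p S)
    (hcn : ∀ n, IsCap r₀ Ω H a (pn n) S) {δ : ℕ → ℝ} (hδ : Tendsto δ atTop (𝓝 0))
    (hclose : ∀ n x, |pn n x - p x| ≤ δ n) {z s : ℝ} (hz : z ∈ Icc 0 H) :
    (s < lo r₀ Ω θ p z → ∀ᶠ n in atTop, s < lo r₀ Ω θ (pn n) z) ∧
      (hi r₀ Ω θ p z < s → ∀ᶠ n in atTop, lo r₀ Ω θ (pn n) z < s) := by
  constructor
  · intro hs
    obtain ⟨δ', hδ', h⟩ := exists_lt_of_lt_lo hr₀ hΩ ha hθ hp hc hz hs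
    filter_upwards [hδ.eventually (gt_mem_nhds hδ')] with n hn
    exact h _ ((hpn n).continuous_slice (phi θ z)) (fun t _ => (hclose n _).trans hn.le) _
      (lo_mem hr₀ hΩ ha hθ (hpn n) (hcn n) hz)
  · intro hs
    obtain ⟨δ', hδ', h⟩ := exists_lt_of_hi_lt hr₀ hΩ ha hθ hp hc hz hs
    filter_upwards [hδ.eventually (gt_mem_nhds hδ')] with n hn
    exact h _ ((hpn n).continuous_slice (phi θ z)) (fun t _ => (hclose n _).trans hn.le) _
      (lo_mem hr₀ hΩ ha hθ (hpn n) (hcn n) hz) (lo_le_cap hr₀ hΩ ha hθ (hpn n) (hcn n) hz)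

omit hr₀ hΩ ha hθ in
lemma abs_pot_add_sub_le {h : ℝ × ℝ → ℝ} {C ε : ℝ}
    (hψ : ContinuousOn ψ (closure (discPlus l)))
    (hh : Continuous h) (hC : ∀ q, |h q| ≤ C) (x : ℝ × ℝ) :
    |pot l (fun q => ψ q + ε * h q) x - pot l ψ x| ≤ |ε| * C := by
  refine abs_conj_sub_le (isCompact_closure_discPlus hl) (closure_discPlus_nonempty hl)
    (hψ.add (continuous_const.mul hh).continuousOn) hψ fun q _ => ?_
  change |ψ q + ε * h q - ψ q| ≤ _
  rw [add_sub_cancel_left, abs_mul]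
  exact mul_le_mul_of_nonneg_left (hC q) (abs_nonneg _)

/-- The first variation of the layer term, for variations vanishing on the horizontal axis. -/
lemma tendsto_variation {h : ℝ × ℝ → ℝ} {C : ℝ} {ε : ℕ → ℝ}
    (hψ : ContinuousOn ψ (closure (discPlus l))) (hh : Continuous h) (hC : ∀ q, |h q| ≤ C)
    (hh0 : ∀ q : ℝ × ℝ, q.2 = 0 → h q = 0)
    (hε : Tendsto ε atTop (𝓝 0)) (hε0 : ∀ n, ε n ≠ 0)
    (hc : IsCap r₀ Ω H a (pot l ψ) S)
    (hcn : ∀ n, IsCap r₀ Ω H a (pot l fun q => ψ q + ε n * h q) S) :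
    Tendsto (fun n => ∫ x, (pot l ψ (bff θ x) - pot l (fun q => ψ q + ε n * h q) (bff θ x)) / ε n
        ∂(mu r₀ Ω H (lo r₀ Ω θ (pot l fun q => ψ q + ε n * h q)))) atTop
      (𝓝 (∫ x, h (grad (pot l ψ) (bff θ x)) ∂(mu r₀ Ω H (lo r₀ Ω θ (pot l ψ))))) := by
  have hp := isPotential_pot hl hψ
  have hψn : ∀ n, ContinuousOn (fun q => ψ q + ε n * h q) (closure (discPlus l)) := fun n =>
    hψ.add (continuous_const.mul hh).continuousOn
  have hpn := fun n => isPotential_pot hl (hψn n)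
  have hC0 : 0 ≤ C := (abs_nonneg _).trans (hC 0)
  have hclose : ∀ n x, |pot l (fun q => ψ q + ε n * h q) x - pot l ψ x| ≤ |ε n| * C := fun n x =>
    abs_pot_add_sub_le hl hψ hh hC x
  have hδ : Tendsto (fun n => |ε n| * C) atTop (𝓝 0) := by
    simpa using hε.abs.mul_const C
  have hR := lo_mem_R hr₀ hΩ ha hθ hp hc
  have hRh := hi_mem_R hr₀ hΩ ha hθ hp hc
  have hRn := fun n => lo_mem_R hr₀ hΩ ha hθ (hpn n) (hcn n)
  have hS := const_mem_R (H := H) hc.mem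
  have hfin := isFiniteMeasure_mu_const (Ω := Ω) (H := H) hr₀ hc.mem
  obtain ⟨E, hE, htie⟩ := exists_countable_tie hr₀ hΩ ha hθ hp hc
  -- All the layers are expressed as restrictions of the layer of constant depth `S`, so that
  -- dominated convergence applies.
  have hrw := mu_restrict (Ω := Ω) hR hS fun z hz => lo_le_cap hr₀ hΩ ha hθ hp hc hz
  have hrwn := fun n => mu_restrict (Ω := Ω) (hRn n) hS fun z hz =>
    lo_le_cap hr₀ hΩ ha hθ (hpn n) (hcn n) hz
  rw [hrw]
  simp only [hrwn]
  rw [← integral_indicator (measurableSet_D hR)]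
  have hind := fun n => integral_indicator (μ := mu r₀ Ω H fun _ => S)
    (f := fun x => (pot l ψ (bff θ x) - pot l (fun q => ψ q + ε n * h q) (bff θ x)) / ε n)
    (measurableSet_D (hRn n))
  simp only [← hind]
  have hbd : ∀ n x, |(pot l ψ x - pot l (fun q => ψ q + ε n * h q) x) / ε n| ≤ C := fun n x => by
    rw [abs_div, div_le_iff₀ (abs_pos.2 (hε0 n)), abs_sub_comm, mul_comm]
    exact hclose n x
  refine tendsto_integral_of_dominated_convergence (fun _ => C) (fun n => ?_)
    (integrable_const C) (fun n => Eventually.of_forall fun x => ?_) ?_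
  · refine AEStronglyMeasurable.indicator ?_ (measurableSet_D (hRn n))
    have hcont : Continuous fun x =>
        (pot l ψ x - pot l (fun q => ψ q + ε n * h q) x) / ε n :=
      (hp.continuous.sub (hpn n).continuous).div_const _
    exact (hcont.measurable.comp_aemeasurable (aemeasurable_bff hθ ha)).aestronglyMeasurable
  · by_cases hx : x ∈ D H (lo r₀ Ω θ (pot l fun q => ψ q + ε n * h q))
    · rw [indicator_of_mem hx]
      exact hbd n _
    · rw [indicator_of_notMem hx, norm_zero]
      exact hC0
  · filter_upwards [ae_interior hS, mu_absolutelyContinuous (ae_fst_ne_of_mem_R hR),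
      mu_absolutelyContinuous (ae_fst_ne_of_mem_R hRh), mu_absolutelyContinuous (ae_snd_notMem hE),
      mu_absolutelyContinuous (hp.ae_differentiableAt_bff hθ ha)] with x h1 h2 h3 h4 h5
    have hz : x.2 ∈ Icc 0 H := ⟨h1.1.1.le, h1.1.2.le⟩
    have hd := h5 h1.1
    have hlim := tendsto_conj_variation (isCompact_closure_discPlus hl)
      (closure_discPlus_nonempty hl) hψ hh.continuousOn hε hε0 hd
    have hev := eventually_depth (s := x.1) hr₀ hΩ ha hθ hp hpn hc hcn hδ hclose hz
    rcases lt_or_gt_of_ne (h2 hz) with hlt | hgt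
    · rw [indicator_of_mem (show x ∈ D H (lo r₀ Ω θ (pot l ψ)) from ⟨hz, h1.2.1.le, hlt.le⟩)]
      refine hlim.congr' ?_
      filter_upwards [hev.1 hlt] with n hn
      rw [indicator_of_mem (show x ∈ D H (lo r₀ Ω θ (pot l fun q => ψ q + ε n * h q)) from
        ⟨hz, h1.2.1.le, hn.le⟩)]
      rfl
    · rw [indicator_of_notMem (show x ∉ D H (lo r₀ Ω θ (pot l ψ)) from fun hD =>
        absurd hD.2.2 (not_le.2 hgt))]
      -- Inside the gap between `lo` and `hi` nothing is known about the indicators. There the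
      -- potential is constant in `ζ` to the right, so its gradient lies on the axis, `h` vanishes
      -- at it, and the integrand tends to zero whatever the indicators do.
      rcases lt_or_gt_of_ne (h3 hz) with hlt' | hgt'
      · obtain ⟨ζ', hζ, hconst⟩ := htie x.2 h1.1 h4 x.1 hgt hlt'
        have hg0 : (grad (pot l ψ) (bff θ x)).2 = 0 := by
          have hder : HasDerivAt (fun ζ => pot l ψ (x.1, ζ))
              (fderiv ℝ (pot l ψ) (bff θ x) (0, 1)) (phi θ x.2) := by
            have hline : HasDerivAt (fun ζ : ℝ => (x.1, ζ)) ((0 : ℝ), (1 : ℝ)) (phi θ x.2) :=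
              (hasDerivAt_const _ _).prodMk (hasDerivAt_id _)
            exact HasFDerivAt.comp_hasDerivAt (phi θ x.2) hd.hasFDerivAt hline
          have hder0 : HasDerivWithinAt (fun ζ => pot l ψ (x.1, ζ)) 0 (Icc (phi θ x.2) ζ')
              (phi θ x.2) :=
            (hasDerivWithinAt_const _ _ (pot l ψ (x.1, phi θ x.2))).congr
              (fun ζ hζ' => hconst ζ hζ') rfl
          exact (uniqueDiffOn_Icc hζ _ (left_mem_Icc.2 hζ.le)).eq_deriv _ hder.hasDerivWithinAt
            hder0
        have hlim0 : Tendsto (fun n => (pot l ψ (bff θ x) -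
            pot l (fun q => ψ q + ε n * h q) (bff θ x)) / ε n) atTop (𝓝 0) := by
          rw [← hh0 _ hg0]
          exact hlim
        refine squeeze_zero_norm (fun n => ?_) (hlim0.norm.trans (by simp))
        exact norm_indicator_le_norm_self _ _
      · refine tendsto_const_nhds.congr' ?_
        filter_upwards [hev.2 hgt'] with n hn
        rw [indicator_of_notMem]
        exact fun hD => absurd hD.2.2 (not_le.2 hn)

end Variation

open scoped BoundedContinuousFunction

/-- Finite measures that agree on the continuous functions vanishing on the horizontal axis are
equal if one of them does not charge the axis and the other has no larger mass. -/
lemma measure_eq_of_forall_vanishing {ν σ : Measure (ℝ × ℝ)} [IsFiniteMeasure ν]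
    [IsFiniteMeasure σ] (hσ : ∀ᵐ q ∂σ, q.2 ≠ 0) (hmass : ν.real univ ≤ σ.real univ)
    (h : ∀ (g : ℝ × ℝ → ℝ) (C : ℝ), Continuous g → (∀ q, |g q| ≤ C) →
      (∀ q : ℝ × ℝ, q.2 = 0 → g q = 0) → ∫ q, g q ∂ν = ∫ q, g q ∂σ) : ν = σ := by
  -- The cutoffs `min 1 (k|Z|)` vanish on the axis and increase to the indicator of its complement,
  -- so they make every bounded continuous function admissible in the limit.
  have hlim : ∀ (τ : Measure (ℝ × ℝ)) [IsFiniteMeasure τ] (g : ℝ × ℝ →ᵇ ℝ),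
      Tendsto (fun k : ℕ => ∫ q, g q * min 1 (k * |q.2|) ∂τ) atTop
        (𝓝 (∫ q, {q : ℝ × ℝ | q.2 ≠ 0}.indicator g q ∂τ)) := by
    intro τ _ g
    refine tendsto_integral_of_dominated_convergence (fun _ => ‖g‖) (fun k => ?_)
      (integrable_const _) (fun k => Eventually.of_forall fun q => ?_)
      (Eventually.of_forall fun q => ?_)
    · exact (g.continuous.mul (by fun_prop)).aestronglyMeasurable
    · rw [norm_mul]
      have h1 : ‖min 1 ((k : ℝ) * |q.2|)‖ ≤ 1 := by
        rw [Real.norm_of_nonneg (by positivity)]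
        exact min_le_left _ _
      calc ‖g q‖ * ‖min 1 ((k : ℝ) * |q.2|)‖ ≤ ‖g‖ * 1 :=
            mul_le_mul (g.norm_coe_le_norm q) h1 (norm_nonneg _) (norm_nonneg _)
        _ = ‖g‖ := mul_one _
    · by_cases hq : q.2 = 0
      · rw [indicator_of_notMem (by simpa using hq), hq]
        simp
      · rw [indicator_of_mem (show q ∈ {q : ℝ × ℝ | q.2 ≠ 0} from hq)]
        have hpos : 0 < |q.2| := abs_pos.2 hq
        refine tendsto_const_nhds.congr' ?_
        obtain ⟨N, hN⟩ := exists_nat_gt (1 / |q.2|)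
        filter_upwards [eventually_ge_atTop N] with k hk
        have : 1 ≤ (k : ℝ) * |q.2| := by
          rw [← div_le_iff₀ hpos]
          exact hN.le.trans (by exact_mod_cast hk)
        rw [min_eq_left this, mul_one]
  have heq : ∀ g : ℝ × ℝ →ᵇ ℝ, ∫ q, {q : ℝ × ℝ | q.2 ≠ 0}.indicator g q ∂ν = ∫ q, g q ∂σ := by
    intro g
    have e : ∫ q, {q : ℝ × ℝ | q.2 ≠ 0}.indicator g q ∂σ = ∫ q, g q ∂σ := by
      refine integral_congr_ae ?_
      filter_upwards [hσ] with q hq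
      exact indicator_of_mem (show q ∈ {q : ℝ × ℝ | q.2 ≠ 0} from hq) _
    rw [← e]
    refine tendsto_nhds_unique (hlim ν g) ((hlim σ g).congr fun k => ?_)
    refine (h _ ‖g‖ (g.continuous.mul (by fun_prop)) (fun q => ?_) fun q hq => ?_).symm
    · rw [Pi.mul_apply, abs_mul]
      have h1 : |min 1 ((k : ℝ) * |q.2|)| ≤ 1 := by
        rw [abs_of_nonneg (by positivity)]
        exact min_le_left _ _
      calc |g q| * |min 1 ((k : ℝ) * |q.2|)| ≤ ‖g‖ * 1 :=
            mul_le_mul (g.norm_coe_le_norm q) h1 (abs_nonneg _) (norm_nonneg _)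
        _ = ‖g‖ := mul_one _
    · rw [Pi.mul_apply, hq]; simp
  have hms : MeasurableSet {q : ℝ × ℝ | q.2 ≠ 0} :=
    (measurableSet_eq_fun measurable_snd measurable_const).compl
  -- Testing with the constant one shows that the mass of `ν` off the axis is already the full mass
  -- of `σ`; by `hmass` nothing is left for the axis.
  have hν : ∀ᵐ q ∂ν, q.2 ≠ 0 := by
    have h1 : ∫ q, {q : ℝ × ℝ | q.2 ≠ 0}.indicator (fun _ => (1 : ℝ)) q ∂ν = ∫ _, (1 : ℝ) ∂σ :=
      heq (BoundedContinuousFunction.const _ 1)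
    simp only [integral_indicator hms, integral_const, smul_eq_mul, mul_one,
      measureReal_restrict_apply_univ] at h1
    have h2 := measureReal_add_measureReal_compl (μ := ν) hms
    have h3 : ν.real {q : ℝ × ℝ | q.2 ≠ 0}ᶜ = 0 :=
      le_antisymm (by linarith) measureReal_nonneg
    rwa [measureReal_eq_zero_iff] at h3
  refine ext_of_forall_integral_eq_of_IsFiniteMeasure fun g => ?_
  rw [← heq g]
  refine integral_congr_ae ?_
  filter_upwards [hν] with q hq
  exact (indicator_of_mem (show q ∈ {q : ℝ × ℝ | q.2 ≠ 0} from hq) _).symm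

/-! ### The transport identity at a dual maximizer. -/

section Variation

variable {r₀ Ω H a b l S : ℝ} {θ : ℝ → ℝ} {σ : Measure (ℝ × ℝ)} {ψ χ : ℝ × ℝ → ℝ}

variable (hr₀ : 0 < r₀) (hΩ : 0 < Ω) (ha : 0 < a) (hl : 0 < l) (hθ : IsAmbient H a b θ)

include hr₀ hΩ ha hl hθ

omit hl in
lemma isFiniteMeasure_mu_lo {p : ℝ × ℝ → ℝ} (hp : IsPotential p) (hc : IsCap r₀ Ω H a p S) :
    IsFiniteMeasure (mu r₀ Ω H (lo r₀ Ω θ p)) :=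
  isFiniteMeasure_mu hr₀ (lo_mem_R hr₀ hΩ ha hθ hp hc) hc.mem
    fun _ hz => lo_le_cap hr₀ hΩ ha hθ hp hc hz

omit ha hθ in
lemma exists_common_cap (hψ : ContinuousOn ψ (closure (discPlus l))) (C : ℝ) :
    ∃ S, IsCap r₀ Ω H a (pot l ψ) S ∧ ∀ (h : ℝ × ℝ → ℝ) (ε : ℝ), Continuous h →
      (∀ q, |h q| ≤ C) → |ε| ≤ 1 → IsCap r₀ Ω H a (pot l fun q => ψ q + ε * h q) S := by
  obtain ⟨S, hS⟩ := exists_isCap hr₀ hΩ H a (pot l ψ (1 / (2 * r₀ ^ 2), H / a) + |C|)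
  refine ⟨S, hS _ (by linarith [abs_nonneg C]), fun h ε hh hC hε => hS _ ?_⟩
  have h1 := (abs_le.1 (abs_pot_add_sub_le (ε := ε) hl hψ hh hC
    (1 / (2 * r₀ ^ 2), H / a))).2
  have h2 : |ε| * C ≤ |C| := by
    have : 0 ≤ C := (abs_nonneg _).trans (hC 0)
    rw [abs_of_nonneg this]
    nlinarith
  linarith

/-- The variational inequality is divided by `ε = 1/(n+1)` and by `ε = -1/(n+1)`. The sign reverses
it, and the two limits give both inequalities. -/
lemma integral_grad_eq [IsFiniteMeasure σ] (hσ : σ (discPlus l)ᶜ = 0)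
    (hψ : IsMaxDual r₀ Ω H l θ σ ψ) {h : ℝ × ℝ → ℝ} {C : ℝ} (hh : Continuous h)
    (hC : ∀ q, |h q| ≤ C) (hh0 : ∀ q : ℝ × ℝ, q.2 = 0 → h q = 0) :
    ∫ x, h (grad (pot l ψ) (bff θ x)) ∂(mu r₀ Ω H (lo r₀ Ω θ (pot l ψ))) = ∫ q, h q ∂σ := by
  obtain ⟨S, hc, hcn⟩ := exists_common_cap (H := H) (a := a) hr₀ hΩ hl hψ.cont C
  have hpos : ∀ n : ℕ, (0 : ℝ) < 1 / (n + 1) := fun n => by positivity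
  have hle1 : ∀ n : ℕ, (1 : ℝ) / (n + 1) ≤ 1 := fun n => by
    rw [div_le_one (by positivity)]
    linarith [(Nat.cast_nonneg n : (0 : ℝ) ≤ n)]
  have hlim := tendsto_one_div_add_atTop_nhds_zero_nat (𝕜 := ℝ)
  have hvar : ∀ ε : ℝ, |ε| ≤ 1 →
      ∫ x, (pot l ψ (bff θ x) - pot l (fun q => ψ q + ε * h q) (bff θ x))
        ∂(mu r₀ Ω H (lo r₀ Ω θ (pot l fun q => ψ q + ε * h q))) ≤ ε * ∫ q, h q ∂σ := by
    intro ε hε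
    have := integral_pot_sub_le hr₀ hΩ ha hl hθ hσ hψ
      (hψ.cont.add (continuous_const.mul hh).continuousOn) hc (hcn h ε hh hC hε)
    refine this.trans (le_of_eq ?_)
    rw [← integral_const_mul]
    refine integral_congr_ae (Eventually.of_forall fun q => ?_)
    change ψ q + ε * h q - ψ q = ε * h q
    ring
  refine le_antisymm ?_ ?_
  · refine le_of_tendsto (tendsto_variation (ε := fun n : ℕ => 1 / ((n : ℝ) + 1)) hr₀ hΩ ha hl hθ
      hψ.cont hh hC hh0 hlim (fun n => (hpos n).ne') hc
      fun n => hcn h _ hh hC (by rw [abs_of_pos (hpos n)]; exact hle1 n))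
      (Eventually.of_forall fun n => ?_)
    rw [integral_div, div_le_iff₀ (hpos n), mul_comm]
    exact hvar _ (by rw [abs_of_pos (hpos n)]; exact hle1 n)
  · refine ge_of_tendsto (tendsto_variation (ε := fun n : ℕ => -(1 / ((n : ℝ) + 1))) hr₀ hΩ ha hl hθ
      hψ.cont hh hC hh0 (by simpa using hlim.neg) (fun n => (neg_lt_zero.2 (hpos n)).ne) hc
      fun n => hcn h _ hh hC (by rw [abs_neg, abs_of_pos (hpos n)]; exact hle1 n))
      (Eventually.of_forall fun n => ?_)
    rw [integral_div, le_div_iff_of_neg (neg_lt_zero.2 (hpos n)), mul_comm]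
    exact hvar _ (by rw [abs_neg, abs_of_pos (hpos n)]; exact hle1 n)

/-- Adding `ε > 0` to `ψ` lowers the potential by `ε`, so the variational inequality bounds the mass
of the perturbed layer by that of `σ`. By stability from below, the perturbed layers eventually
contain almost every point of the layer of depth `lo`. The gap above `lo` plays no role. -/
lemma mu_lo_real_univ_le [IsFiniteMeasure σ] (hσ : σ (discPlus l)ᶜ = 0)
    (hψ : IsMaxDual r₀ Ω H l θ σ ψ) :
    (mu r₀ Ω H (lo r₀ Ω θ (pot l ψ))).real univ ≤ σ.real univ := by
  obtain ⟨S, hc, hcn⟩ := exists_common_cap (H := H) (a := a) hr₀ hΩ hl hψ.cont 1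
  set ε : ℕ → ℝ := fun n => 1 / ((n : ℝ) + 1)
  have hpos : ∀ n : ℕ, 0 < ε n := fun n => by positivity
  have hle1 : ∀ n : ℕ, |ε n| ≤ 1 := fun n => by
    rw [abs_of_pos (hpos n), div_le_one (by positivity)]
    linarith [(Nat.cast_nonneg n : (0 : ℝ) ≤ n)]
  have hlim : Tendsto ε atTop (𝓝 0) := tendsto_one_div_add_atTop_nhds_zero_nat
  have h1 : Continuous fun _ : ℝ × ℝ => (1 : ℝ) := continuous_const
  have h1' : ∀ q : ℝ × ℝ, |(fun _ : ℝ × ℝ => (1 : ℝ)) q| ≤ 1 := fun _ => by simp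
  have hp := isPotential_pot hl hψ.cont
  have hψn : ∀ n, ContinuousOn (fun q => ψ q + ε n * 1) (closure (discPlus l)) := fun n =>
    hψ.cont.add continuousOn_const
  have hpn := fun n => isPotential_pot hl (hψn n)
  have hcn' := fun n => hcn _ (ε n) h1 h1' (hle1 n)
  have hR := lo_mem_R hr₀ hΩ ha hθ hp hc
  have hRn := fun n => lo_mem_R hr₀ hΩ ha hθ (hpn n) (hcn' n)
  have hfin := isFiniteMeasure_mu_lo hr₀ hΩ ha hθ hp hc
  have hfinn := fun n => isFiniteMeasure_mu_lo hr₀ hΩ ha hθ (hpn n) (hcn' n)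
  have hmass : ∀ n, (mu r₀ Ω H (lo r₀ Ω θ (pot l fun q => ψ q + ε n * 1))).real univ ≤
      σ.real univ := by
    intro n
    have h2 := integral_pot_sub_le hr₀ hΩ ha hl hθ hσ hψ (hψn n) hc (hcn' n)
    have h3 : ∀ x, ε n ≤ pot l ψ x - pot l (fun q => ψ q + ε n * 1) x := fun x => by
      have : pot l (fun q => ψ q + ε n * 1) x ≤ pot l ψ x + -ε n :=
        conj_le_conj_add (isCompact_closure_discPlus hl) (closure_discPlus_nonempty hl) hψ.cont
          fun q _ => by simp
      linarith
    have h4 := integral_mono_ae (integrable_const (ε n))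
      ((integrable_comp_bff (Ω := Ω) hθ ha (hRn n) hp.continuous).sub
        (integrable_comp_bff (Ω := Ω) hθ ha (hRn n) (hpn n).continuous))
      (Eventually.of_forall fun x => h3 (bff θ x))
    have h5 := h4.trans h2
    simp only [add_sub_cancel_left, integral_const, smul_eq_mul] at h5
    exact le_of_mul_le_mul_right (h5.trans_eq (by rw [mul_one])) (hpos n)
  have hlimD : Tendsto (fun n => ∫ x, (D H (lo r₀ Ω θ (pot l fun q => ψ q + ε n * 1))).indicator
      (fun _ => (1 : ℝ)) x ∂(mu r₀ Ω H (lo r₀ Ω θ (pot l ψ)))) atTop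
      (𝓝 (∫ _, (1 : ℝ) ∂(mu r₀ Ω H (lo r₀ Ω θ (pot l ψ))))) := by
    refine tendsto_integral_of_dominated_convergence (fun _ => 1)
      (fun n => (measurable_const.indicator (measurableSet_D (hRn n))).aestronglyMeasurable)
      (integrable_const _) (fun n => Eventually.of_forall fun x => ?_) ?_
    · refine (norm_indicator_le_norm_self _ _).trans ?_
      simp
    · filter_upwards [ae_interior hR] with x hx
      have hz : x.2 ∈ Icc 0 H := ⟨hx.1.1.le, hx.1.2.le⟩
      refine tendsto_const_nhds.congr' ?_
      filter_upwards [(eventually_depth hr₀ hΩ ha hθ hp hpn hc hcn' (δ := fun n => |ε n| * 1)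
        (by simpa using hlim.abs)
        (fun n x => abs_pot_add_sub_le hl hψ.cont h1 h1' x) hz).1 hx.2.2] with n hn
      rw [indicator_of_mem (show x ∈ D H _ from ⟨hz, hx.2.1.le, hn.le⟩)]
  rw [integral_const, smul_eq_mul, mul_one] at hlimD
  refine le_of_tendsto hlimD (Eventually.of_forall fun n => ?_)
  rw [integral_indicator (measurableSet_D (hRn n)), integral_const, smul_eq_mul, mul_one,
    measureReal_restrict_apply_univ]
  refine le_trans ?_ (hmass n)
  refine ENNReal.toReal_mono (measure_ne_top _ _) ?_
  rw [mu_eq hR, mu_eq (hRn n), Measure.restrict_apply (measurableSet_D (hRn n)),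
    Measure.restrict_apply_univ]
  exact measure_mono inter_subset_left

/-- At a maximizer of the reduced dual functional, the gradient of the potential transports the
layer of least depth to the target measure. -/
theorem map_grad_eq [IsProbabilityMeasure σ] (hσ : σ (discPlus l)ᶜ = 0)
    (hψ : IsMaxDual r₀ Ω H l θ σ ψ) :
    (mu r₀ Ω H (lo r₀ Ω θ (pot l ψ))).map (fun x => grad (pot l ψ) (bff θ x)) = σ := by
  obtain ⟨S, hc, -⟩ := exists_common_cap (H := H) (a := a) hr₀ hΩ hl hψ.cont 1
  have hfin := isFiniteMeasure_mu_lo hr₀ hΩ ha hθ (isPotential_pot hl hψ.cont) hc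
  have hm : AEMeasurable (fun x => grad (pot l ψ) (bff θ x))
      (mu r₀ Ω H (lo r₀ Ω θ (pot l ψ))) :=
    (measurable_grad _).comp_aemeasurable (aemeasurable_bff hθ ha)
  refine measure_eq_of_forall_vanishing ?_ ?_ fun g C hg hC hg0 => ?_
  · filter_upwards [ae_mem_discPlus hσ] with q hq
    exact (mem_Ioi.1 hq.2.2).ne'
  · rw [map_measureReal_apply_of_aemeasurable hm MeasurableSet.univ, preimage_univ]
    exact mu_lo_real_univ_le hr₀ hΩ ha hl hθ hσ hψ
  · rw [integral_map hm hg.aestronglyMeasurable]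
    exact integral_grad_eq hr₀ hΩ ha hl hθ hσ hψ hg hC hg0

end Variation

/-! ### Weak and strong duality -/

/-- Half the squared Euclidean norm. -/
noncomputable def halfSq (q : ℝ × ℝ) : ℝ := (1 / 2) * (q.1 ^ 2 + q.2 ^ 2)

lemma continuous_halfSq : Continuous halfSq := by
  unfold halfSq
  fun_prop

lemma halfSq_add_halfSq (q y : ℝ × ℝ) :
    (q.1 - y.1) ^ 2 + (q.2 - y.2) ^ 2 = 2 * (halfSq q + halfSq y - dot y q) := by
  unfold halfSq dot
  ring

lemma ofReal_integral_le {α : Type*} [MeasurableSpace α] {μ : Measure α} {F : α → ℝ}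
    (hF : Integrable F μ) : ENNReal.ofReal (∫ x, F x ∂μ) ≤ ∫⁻ x, ENNReal.ofReal (F x) ∂μ := by
  have h1 : ∫ x, F x ∂μ ≤ ∫ x, max (F x) 0 ∂μ :=
    integral_mono hF hF.pos_part fun x => le_max_left _ _
  refine (ENNReal.ofReal_le_ofReal h1).trans ?_
  rw [ofReal_integral_eq_lintegral_ofReal hF.pos_part
    (Eventually.of_forall fun x => le_max_right _ _)]
  refine lintegral_mono fun x => ?_
  rcases le_total (F x) 0 with h | h
  · simp [max_eq_right h]
  · simp [max_eq_left h]

section Duality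

variable {r₀ Ω H a b l S : ℝ} {θ : ℝ → ℝ} {σ : Measure (ℝ × ℝ)} {ψ : ℝ × ℝ → ℝ} {ϱ : ℝ → ℝ}

variable (hr₀ : 0 < r₀) (hΩ : 0 < Ω) (ha : 0 < a) (hl : 0 < l) (hθ : IsAmbient H a b θ)

lemma integral_halfSq_bff : ∫ p, (1 / 2) * (p.1 ^ 2 + p.2 ^ 2 / θ p.2 ^ 2) ∂(mu r₀ Ω H ϱ) =
    ∫ x, halfSq (bff θ x) ∂(mu r₀ Ω H ϱ) := by
  refine integral_congr_ae (Eventually.of_forall fun p => ?_)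
  simp only [halfSq, bff, phi, div_pow]

/-- The easy half of Kantorovich duality: the pointwise inequality is integrated against an
arbitrary coupling. -/
lemma two_mul_le_W2sq {ν : Measure (ℝ × ℝ)} [IsProbabilityMeasure σ] {f g : ℝ × ℝ → ℝ}
    (hf : Integrable f σ) (hg : Integrable g ν) (hY : ∀ᵐ q ∂σ, ∀ y, f q + g y ≤
      (1 / 2) * ((q.1 - y.1) ^ 2 + (q.2 - y.2) ^ 2)) :
    ENNReal.ofReal (2 * (∫ q, f q ∂σ + ∫ y, g y ∂ν)) ≤ W2sq σ ν := by
  refine le_iInf₂ fun γ hγ => ?_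
  obtain ⟨h1, h2⟩ := hγ
  have hf' : Integrable (fun x : (ℝ × ℝ) × (ℝ × ℝ) => f x.1) γ := by
    rw [← h1] at hf
    exact hf.comp_measurable measurable_fst
  have hg' : Integrable (fun x : (ℝ × ℝ) × (ℝ × ℝ) => g x.2) γ := by
    rw [← h2] at hg
    exact hg.comp_measurable measurable_snd
  have e1 : ∫ q, f q ∂σ = ∫ x, f x.1 ∂γ := by
    rw [← h1, integral_map measurable_fst.aemeasurable (by rw [h1]; exact hf.aestronglyMeasurable)]
  have e2 : ∫ q, g q ∂ν = ∫ x, g x.2 ∂γ := by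
    rw [← h2, integral_map measurable_snd.aemeasurable (by rw [h2]; exact hg.aestronglyMeasurable)]
  rw [e1, e2, ← integral_add hf' hg', ← integral_const_mul]
  refine (ofReal_integral_le ((hf'.add hg').const_mul 2)).trans ?_
  have hY' : ∀ᵐ x ∂γ, ∀ y, f x.1 + g y ≤
      (1 / 2) * ((x.1.1 - y.1) ^ 2 + (x.1.2 - y.2) ^ 2) := by
    rw [← h1] at hY
    exact ae_of_ae_map measurable_fst.aemeasurable hY
  refine lintegral_mono_ae ?_
  filter_upwards [hY'] with x hx
  refine ENNReal.ofReal_le_ofReal ?_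
  change 2 * (f x.1 + g x.2) ≤ _
  linarith [hx x.2]

lemma K_eq_top (hr₀ : 0 < r₀) (hΩ : 0 < Ω) (hϱ : ϱ ∈ R₀ r₀ Ω H)
    (h : ¬ Integrable (fun x : ℝ × ℝ => f₀ r₀ Ω x.1) (mu r₀ Ω H ϱ)) : K r₀ Ω H θ σ ϱ = ⊤ := by
  have htop : ∫⁻ p, ENNReal.ofReal (f₀ r₀ Ω p.1) ∂(mu r₀ Ω H ϱ) = ⊤ := by
    by_contra hne
    refine h ⟨((measurable_f₀ r₀ Ω).comp measurable_fst).aestronglyMeasurable, ?_⟩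
    rw [hasFiniteIntegral_iff_ofReal]
    · exact lt_top_iff_ne_top.2 hne
    · filter_upwards [ae_mem_D hϱ.1] with x hx
      exact (f₀_pos hr₀ hΩ (hx.2.2.trans_lt (hϱ.1.2 hx.1).2)).le
  rw [K, if_pos hϱ, htop, EReal.coe_ennreal_top,
    EReal.add_top_of_ne_bot (EReal.coe_ennreal_ne_bot _), EReal.top_sub_coe]

lemma lintegral_f₀ (hr₀ : 0 < r₀) (hΩ : 0 < Ω) (hϱ : ϱ ∈ R r₀ H)
    (h : Integrable (fun x : ℝ × ℝ => f₀ r₀ Ω x.1) (mu r₀ Ω H ϱ)) :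
    ∫⁻ p, ENNReal.ofReal (f₀ r₀ Ω p.1) ∂(mu r₀ Ω H ϱ) =
      ENNReal.ofReal (∫ p, f₀ r₀ Ω p.1 ∂(mu r₀ Ω H ϱ)) ∧
      0 ≤ ∫ p, f₀ r₀ Ω p.1 ∂(mu r₀ Ω H ϱ) := by
  have hnn : 0 ≤ᵐ[mu r₀ Ω H ϱ] fun x : ℝ × ℝ => f₀ r₀ Ω x.1 := by
    filter_upwards [ae_mem_D hϱ] with x hx
    exact (f₀_pos hr₀ hΩ (hx.2.2.trans_lt (hϱ.2 hx.1).2)).le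
  exact ⟨(ofReal_integral_eq_lintegral_ofReal h hnn).symm, integral_nonneg_of_ae hnn⟩

include hr₀ hΩ ha hl hθ

/-- Weak duality. -/
lemma le_K [IsProbabilityMeasure σ] (hσ : σ (discPlus l)ᶜ = 0)
    (hψ : ContinuousOn ψ (closure (discPlus l))) (hϱ : ϱ ∈ R₀ r₀ Ω H)
    (hf : Integrable (fun x : ℝ × ℝ => f₀ r₀ Ω x.1) (mu r₀ Ω H ϱ)) :
    ((-(∫ q, ψ q ∂σ) + ∫ x, (f₀ r₀ Ω x.1 - pot l ψ (bff θ x)) ∂(mu r₀ Ω H ϱ) + m₂ σ : ℝ) : EReal)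
      ≤ K r₀ Ω H θ σ ϱ := by
  have := hϱ.2
  have hp := isPotential_pot hl hψ
  have i1 := integrable_of_continuousOn hl hσ hψ
  have i2 := integrable_of_continuousOn hl hσ continuous_halfSq.continuousOn
  have i3 := integrable_comp_bff (Ω := Ω) hθ ha hϱ.1 hp.continuous
  have i4 := integrable_comp_bff (Ω := Ω) hθ ha hϱ.1 continuous_halfSq
  have hmb := aemeasurable_bff (r₀ := r₀) (Ω := Ω) (ϱ := ϱ) hθ ha
  have i5 : Integrable (fun y => halfSq y - pot l ψ y) ((mu r₀ Ω H ϱ).map (bff θ)) :=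
    (integrable_map_measure (continuous_halfSq.sub hp.continuous).aestronglyMeasurable hmb).2
      (i4.sub i3)
  -- With `f = halfSq - ψ` and `g = halfSq - pot l ψ` the required inequality is Fenchel's.
  have hW := two_mul_le_W2sq (i2.sub i1) i5 (by
    filter_upwards [ae_mem_discPlus hσ] with q hq y
    rw [halfSq_add_halfSq, Pi.sub_apply]
    have : dot y q - ψ q ≤ pot l ψ y :=
      le_conj (isCompact_closure_discPlus hl) hψ (subset_closure hq)
    linarith)
  have e1 : ∫ q, (halfSq - ψ) q ∂σ = m₂ σ - ∫ q, ψ q ∂σ := integral_sub i2 i1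
  have e2 : ∫ y, (halfSq y - pot l ψ y) ∂((mu r₀ Ω H ϱ).map (bff θ)) =
      ∫ x, halfSq (bff θ x) ∂(mu r₀ Ω H ϱ) - ∫ x, pot l ψ (bff θ x) ∂(mu r₀ Ω H ϱ) := by
    rw [integral_map hmb i5.aestronglyMeasurable, integral_sub i4 i3]
  rw [e1, e2] at hW
  obtain ⟨e3, h3⟩ := lintegral_f₀ hr₀ hΩ hϱ.1 hf
  rw [K, if_pos hϱ, integral_halfSq_bff, e3, integral_sub hf i3, EReal.coe_ennreal_ofReal,
    max_eq_left h3]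
  set N := ∫ x, halfSq (bff θ x) ∂(mu r₀ Ω H ϱ)
  set Q := ∫ x, pot l ψ (bff θ x) ∂(mu r₀ Ω H ϱ)
  set F := ∫ p, f₀ r₀ Ω p.1 ∂(mu r₀ Ω H ϱ)
  set B := m₂ σ - ∫ q, ψ q ∂σ + (N - Q)
  have h4 : ENNReal.ofReal B ≤ (1 / 2 : ENNReal) * W2sq σ ((mu r₀ Ω H ϱ).map (bff θ)) := by
    refine le_trans (le_of_eq ?_) (mul_le_mul_right hW _)
    rw [ENNReal.ofReal_mul zero_le_two, ← mul_assoc, ENNReal.ofReal_ofNat, one_div,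
      ENNReal.inv_mul_cancel two_ne_zero ENNReal.ofNat_ne_top, one_mul]
  have h5 : (B : EReal) ≤
      (((1 / 2 : ENNReal) * W2sq σ ((mu r₀ Ω H ϱ).map (bff θ)) : ENNReal) : EReal) := by
    refine le_trans ?_ (EReal.coe_ennreal_le_coe_ennreal_iff.2 h4)
    rw [EReal.coe_ennreal_ofReal]
    exact EReal.coe_le_coe_iff.2 (le_max_left _ _)
  calc ((-(∫ q, ψ q ∂σ) + (F - Q) + m₂ σ : ℝ) : EReal) = (B : EReal) + (F : EReal) - (N : EReal) := by
        rw [← EReal.coe_add, ← EReal.coe_sub]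
        congr 1
        simp only [B]
        ring
    _ ≤ _ := EReal.sub_le_sub (add_le_add_left h5 _) le_rfl

/-- Strong duality for a layer that is transported to the target by the gradient. -/
lemma K_le [IsProbabilityMeasure σ] (hσ : σ (discPlus l)ᶜ = 0)
    (hψ : ContinuousOn ψ (closure (discPlus l))) (hϱ : ϱ ∈ R₀ r₀ Ω H)
    (hf : Integrable (fun x : ℝ × ℝ => f₀ r₀ Ω x.1) (mu r₀ Ω H ϱ))
    (hmap : (mu r₀ Ω H ϱ).map (fun x => grad (pot l ψ) (bff θ x)) = σ) :
    K r₀ Ω H θ σ ϱ ≤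
      ((-(∫ q, ψ q ∂σ) + ∫ x, (f₀ r₀ Ω x.1 - pot l ψ (bff θ x)) ∂(mu r₀ Ω H ϱ) + m₂ σ : ℝ) :
        EReal) := by
  have := hϱ.2
  have hp := isPotential_pot hl hψ
  set G : ℝ × ℝ → ℝ × ℝ := fun x => grad (pot l ψ) (bff θ x)
  have hmb := aemeasurable_bff (r₀ := r₀) (Ω := Ω) (ϱ := ϱ) hθ ha
  have hmG : AEMeasurable G (mu r₀ Ω H ϱ) := (measurable_grad _).comp_aemeasurable hmb
  have i1 := integrable_of_continuousOn hl hσ hψ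
  have i2 := integrable_of_continuousOn hl hσ continuous_halfSq.continuousOn
  have i3 := integrable_comp_bff (Ω := Ω) hθ ha hϱ.1 hp.continuous
  have i4 := integrable_comp_bff (Ω := Ω) hθ ha hϱ.1 continuous_halfSq
  have i1' : Integrable (fun x => ψ (G x)) (mu r₀ Ω H ϱ) := by
    rw [← hmap] at i1
    exact (integrable_map_measure i1.aestronglyMeasurable hmG).1 i1
  have i2' : Integrable (fun x => halfSq (G x)) (mu r₀ Ω H ϱ) := by
    rw [← hmap] at i2
    exact (integrable_map_measure i2.aestronglyMeasurable hmG).1 i2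
  have e1 : ∫ q, ψ q ∂σ = ∫ x, ψ (G x) ∂(mu r₀ Ω H ϱ) := by
    have hm := i1.aestronglyMeasurable
    rw [← hmap] at hm ⊢
    exact integral_map hmG hm
  have e2 : m₂ σ = ∫ x, halfSq (G x) ∂(mu r₀ Ω H ϱ) := by
    have hm := i2.aestronglyMeasurable
    rw [← hmap] at hm ⊢
    exact integral_map hmG hm
  set N := ∫ x, halfSq (bff θ x) ∂(mu r₀ Ω H ϱ)
  set Q := ∫ x, pot l ψ (bff θ x) ∂(mu r₀ Ω H ϱ)
  set F := ∫ p, f₀ r₀ Ω p.1 ∂(mu r₀ Ω H ϱ)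
  set B := m₂ σ - ∫ q, ψ q ∂σ + (N - Q)
  -- Equality in Fenchel's inequality: the gradient attains the supremum defining the potential.
  have hcost : ∀ᵐ x ∂(mu r₀ Ω H ϱ), ((G x).1 - (bff θ x).1) ^ 2 + ((G x).2 - (bff θ x).2) ^ 2 =
      2 * ((halfSq (G x) - ψ (G x)) + (halfSq (bff θ x) - pot l ψ (bff θ x))) := by
    filter_upwards [ae_interior hϱ.1, mu_absolutelyContinuous (hp.ae_differentiableAt_bff hθ ha)]
      with x h1 h2
    have h3 : pot l ψ (bff θ x) = dot (bff θ x) (G x) - ψ (G x) :=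
      (grad_conj_mem (isCompact_closure_discPlus hl) (closure_discPlus_nonempty hl) hψ
        (h2 h1.1)).2
    rw [halfSq_add_halfSq, h3]
    ring
  have iR : Integrable (fun x => 2 * ((halfSq (G x) - ψ (G x)) +
      (halfSq (bff θ x) - pot l ψ (bff θ x)))) (mu r₀ Ω H ϱ) :=
    ((i2'.sub i1').add (i4.sub i3)).const_mul 2
  have eB : ∫ x, 2 * ((halfSq (G x) - ψ (G x)) + (halfSq (bff θ x) - pot l ψ (bff θ x)))
      ∂(mu r₀ Ω H ϱ) = 2 * B := by
    have j1 : Integrable (fun x => halfSq (G x) - ψ (G x)) (mu r₀ Ω H ϱ) := i2'.sub i1'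
    have j2 : Integrable (fun x => halfSq (bff θ x) - pot l ψ (bff θ x)) (mu r₀ Ω H ϱ) :=
      i4.sub i3
    rw [integral_const_mul, integral_add j1 j2, integral_sub i2' i1', integral_sub i4 i3, ← e1,
      ← e2]
  have hnn : 0 ≤ᵐ[mu r₀ Ω H ϱ] fun x => 2 * ((halfSq (G x) - ψ (G x)) +
      (halfSq (bff θ x) - pot l ψ (bff θ x))) := by
    filter_upwards [hcost] with x hx
    rw [← hx]
    exact add_nonneg (sq_nonneg _) (sq_nonneg _)
  have hB : 0 ≤ B := by
    have := integral_nonneg_of_ae hnn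
    rw [eB] at this
    linarith
  have hpair : AEMeasurable (fun x => (G x, bff θ x)) (mu r₀ Ω H ϱ) := hmG.prodMk hmb
  -- The competing coupling is the joint law of `G x` and `bff θ x`; its marginals are right because
  -- `G` carries the layer to `σ`.
  have hW : W2sq σ ((mu r₀ Ω H ϱ).map (bff θ)) ≤ ENNReal.ofReal (2 * B) := by
    have hfst : ((mu r₀ Ω H ϱ).map fun x => (G x, bff θ x)).map Prod.fst = σ := by
      rw [AEMeasurable.map_map_of_aemeasurable measurable_fst.aemeasurable hpair]
      exact hmap
    have hsnd : ((mu r₀ Ω H ϱ).map fun x => (G x, bff θ x)).map Prod.snd =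
        (mu r₀ Ω H ϱ).map (bff θ) := by
      rw [AEMeasurable.map_map_of_aemeasurable measurable_snd.aemeasurable hpair]
      rfl
    refine (iInf₂_le ((mu r₀ Ω H ϱ).map fun x => (G x, bff θ x)) ⟨hfst, hsnd⟩).trans
      (le_of_eq ?_)
    have hmc : Measurable fun x : (ℝ × ℝ) × (ℝ × ℝ) =>
        ENNReal.ofReal ((x.1.1 - x.2.1) ^ 2 + (x.1.2 - x.2.2) ^ 2) := by fun_prop
    rw [lintegral_map' hmc.aemeasurable hpair, ← eB,
      ofReal_integral_eq_lintegral_ofReal iR hnn]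
    refine lintegral_congr_ae ?_
    filter_upwards [hcost] with x hx
    rw [hx]
  obtain ⟨e3, h3⟩ := lintegral_f₀ hr₀ hΩ hϱ.1 hf
  rw [K, if_pos hϱ, integral_halfSq_bff, e3, integral_sub hf i3, EReal.coe_ennreal_ofReal,
    max_eq_left h3]
  have h4 : (1 / 2 : ENNReal) * W2sq σ ((mu r₀ Ω H ϱ).map (bff θ)) ≤ ENNReal.ofReal B := by
    refine le_trans (mul_le_mul_right hW _) (le_of_eq ?_)
    rw [ENNReal.ofReal_mul zero_le_two, ← mul_assoc, ENNReal.ofReal_ofNat, one_div,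
      ENNReal.inv_mul_cancel two_ne_zero ENNReal.ofNat_ne_top, one_mul]
  have h5 : (((1 / 2 : ENNReal) * W2sq σ ((mu r₀ Ω H ϱ).map (bff θ)) : ENNReal) : EReal) ≤
      (B : EReal) := by
    refine (EReal.coe_ennreal_le_coe_ennreal_iff.2 h4).trans ?_
    rw [EReal.coe_ennreal_ofReal, max_eq_left hB]
  calc _ ≤ (B : EReal) + (F : EReal) - (N : EReal) :=
        EReal.sub_le_sub (add_le_add_left h5 _) le_rfl
    _ = _ := by
        rw [← EReal.coe_add, ← EReal.coe_sub]
        congr 1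
        simp only [B, Q, N, F]
        ring

end Duality

/-! ### Minimality and uniqueness of the layer of least depth. -/

section Minimizer

variable {r₀ Ω H a b l : ℝ} {θ : ℝ → ℝ} {σ : Measure (ℝ × ℝ)} {ψ : ℝ × ℝ → ℝ} {ϱ : ℝ → ℝ}

variable (hr₀ : 0 < r₀) (hΩ : 0 < Ω) (ha : 0 < a) (hl : 0 < l) (hθ : IsAmbient H a b θ)

include hr₀ hΩ in
lemma exists_isCap_pot (H a : ℝ) (ψ : ℝ × ℝ → ℝ) : ∃ S, IsCap r₀ Ω H a (pot l ψ) S := by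
  obtain ⟨S, hS⟩ := exists_isCap hr₀ hΩ H a (pot l ψ (1 / (2 * r₀ ^ 2), H / a))
  exact ⟨S, hS _ le_rfl⟩

include hr₀ hΩ ha hl hθ

/-- The dual problem does not impose unit mass; it is inherited from `σ` through the transport
identity. -/
lemma lo_mem_R₀ [IsProbabilityMeasure σ] (hσ : σ (discPlus l)ᶜ = 0)
    (hψ : IsMaxDual r₀ Ω H l θ σ ψ) : lo r₀ Ω θ (pot l ψ) ∈ R₀ r₀ Ω H := by
  obtain ⟨S, hc⟩ := exists_isCap_pot (l := l) hr₀ hΩ H a ψ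
  refine ⟨lo_mem_R hr₀ hΩ ha hθ (isPotential_pot hl hψ.cont) hc, ⟨?_⟩⟩
  have hmap := map_grad_eq hr₀ hΩ ha hl hθ hσ hψ
  have hm : AEMeasurable (fun x => grad (pot l ψ) (bff θ x))
      (mu r₀ Ω H (lo r₀ Ω θ (pot l ψ))) :=
    (measurable_grad _).comp_aemeasurable (aemeasurable_bff hθ ha)
  have h1 : σ univ = 1 := measure_univ
  rwa [← hmap, Measure.map_apply_of_aemeasurable hm MeasurableSet.univ, preimage_univ] at h1

lemma K_lo_eq [IsProbabilityMeasure σ] (hσ : σ (discPlus l)ᶜ = 0)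
    (hψ : IsMaxDual r₀ Ω H l θ σ ψ) :
    K r₀ Ω H θ σ (lo r₀ Ω θ (pot l ψ)) = ((dualJ r₀ Ω H l θ σ ψ + m₂ σ : ℝ) : EReal) := by
  obtain ⟨S, hc⟩ := exists_isCap_pot (l := l) hr₀ hΩ H a ψ
  have hp := isPotential_pot hl hψ.cont
  have hR₀ := lo_mem_R₀ hr₀ hΩ ha hl hθ hσ hψ
  have hf := integrable_f₀_of_le hr₀ hΩ hR₀.1 hc.mem fun _ hz => lo_le_cap hr₀ hΩ ha hθ hp hc hz
  unfold dualJ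
  rw [← (integral_cost_lo hr₀ hΩ ha hθ hp hc).2]
  exact le_antisymm (K_le hr₀ hΩ ha hl hθ hσ hψ.cont hR₀ hf (map_grad_eq hr₀ hΩ ha hl hθ hσ hψ))
    (le_K hr₀ hΩ ha hl hθ hσ hψ.cont hR₀ hf)

lemma dualJ_le_K [IsProbabilityMeasure σ] (hσ : σ (discPlus l)ᶜ = 0)
    (hψ : ContinuousOn ψ (closure (discPlus l))) (hϱ : ϱ ∈ R₀ r₀ Ω H) :
    ((dualJ r₀ Ω H l θ σ ψ + m₂ σ : ℝ) : EReal) ≤ K r₀ Ω H θ σ ϱ := by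
  by_cases hf : Integrable (fun x : ℝ × ℝ => f₀ r₀ Ω x.1) (mu r₀ Ω H ϱ)
  · obtain ⟨S, hc⟩ := exists_isCap_pot (l := l) hr₀ hΩ H a ψ
    have hp := isPotential_pot hl hψ
    have := hϱ.2
    refine le_trans ?_ (le_K hr₀ hΩ ha hl hθ hσ hψ hϱ hf)
    obtain ⟨i, e⟩ := integral_cost hθ ha hp.continuous hϱ.1 hf
    have := minCost_le hr₀ hΩ ha hθ hp hc hϱ.1 i
    rw [e, EReal.coe_le_coe_iff]
    unfold dualJ
    linarith
  · rw [K_eq_top hr₀ hΩ hϱ hf]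
    exact le_top

/-- A field `ϱ` with minimal value leaves no gap in weak duality, so its depths are optimal at
almost every height and thus at least `lo`. Both layers have mass one, and the mass is strictly
increasing in the depth. -/
lemma ae_eq_lo [IsProbabilityMeasure σ] (hσ : σ (discPlus l)ᶜ = 0)
    (hψ : IsMaxDual r₀ Ω H l θ σ ψ) (hϱ : ϱ ∈ R₀ r₀ Ω H)
    (hK : K r₀ Ω H θ σ ϱ ≤ ((dualJ r₀ Ω H l θ σ ψ + m₂ σ : ℝ) : EReal)) :
    ϱ =ᵐ[volume.restrict (Icc 0 H)] lo r₀ Ω θ (pot l ψ) := by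
  by_cases hf : Integrable (fun x : ℝ × ℝ => f₀ r₀ Ω x.1) (mu r₀ Ω H ϱ)
  swap
  · rw [K_eq_top hr₀ hΩ hϱ hf, top_le_iff] at hK
    exact absurd hK (EReal.coe_ne_top _)
  obtain ⟨S, hc⟩ := exists_isCap_pot (l := l) hr₀ hΩ H a ψ
  have hp := isPotential_pot hl hψ.cont
  have hR₀ := lo_mem_R₀ hr₀ hΩ ha hl hθ hσ hψ
  have h1 := hϱ.2
  have h2 := hR₀.2
  obtain ⟨i, e⟩ := integral_cost hθ ha hp.continuous hϱ.1 hf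
  have h3 := (le_K hr₀ hΩ ha hl hθ hσ hψ.cont hϱ hf).trans hK
  rw [e, EReal.coe_le_coe_iff] at h3
  unfold dualJ at h3
  have h4 := ae_mem_argmins hr₀ hΩ ha hθ hp hc hϱ.1 i (by linarith)
  obtain ⟨j1, m1⟩ := integral_layerMass (Ω := Ω) hϱ.1
  obtain ⟨j2, m2⟩ := integral_layerMass (Ω := Ω) hR₀.1
  have hnn : 0 ≤ᵐ[volume.restrict (Icc 0 H)] fun z =>
      layerMass r₀ Ω (ϱ z) - layerMass r₀ Ω (lo r₀ Ω θ (pot l ψ) z) := by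
    filter_upwards [h4, ae_restrict_mem measurableSet_Icc] with z hz hzI
    exact sub_nonneg.2 ((layerMass_strictMonoOn hr₀ hΩ).monotoneOn (hR₀.1.2 hzI).2
      (hϱ.1.2 hzI).2 (lo_le hr₀ hΩ ha hθ hp hc hzI hz))
  have h0 : ∫ z in Icc 0 H,
      (layerMass r₀ Ω (ϱ z) - layerMass r₀ Ω (lo r₀ Ω θ (pot l ψ) z)) = 0 := by
    rw [integral_sub j1 j2, ← m1, ← m2, probReal_univ, probReal_univ, sub_self]
  filter_upwards [(integral_eq_zero_iff_of_nonneg_ae hnn (j1.sub j2)).1 h0,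
    ae_restrict_mem measurableSet_Icc] with z hz hzI
  exact (layerMass_strictMonoOn hr₀ hΩ).injOn (hϱ.1.2 hzI).2 (hR₀.1.2 hzI).2 (sub_eq_zero.1 hz)

end Minimizer

/-! ### The double conjugate -/

/-- The rectangle of source points `(s, ζ)`. -/
def srcRect (r₀ H a : ℝ) : Set (ℝ × ℝ) := Icc 0 (1 / (2 * r₀ ^ 2)) ×ˢ Icc 0 (H / a)

lemma isCompact_srcRect (r₀ H a : ℝ) : IsCompact (srcRect r₀ H a) :=
  isCompact_Icc.prod isCompact_Icc

section Bipot

variable {r₀ Ω H a b l S : ℝ} {θ : ℝ → ℝ} {σ : Measure (ℝ × ℝ)} {ψ χ : ℝ × ℝ → ℝ}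
  {p p' : ℝ × ℝ → ℝ}

lemma srcRect_nonempty (hr₀ : 0 < r₀) (hH : 0 < H) (ha : 0 < a) : (srcRect r₀ H a).Nonempty :=
  ⟨(0, 0), ⟨le_rfl, (top_pos hr₀).le⟩, le_rfl, by positivity⟩

lemma conj_srcRect_le (hr₀ : 0 < r₀) (hH : 0 < H) (ha : 0 < a) (hl : 0 < l)
    (hψ : ContinuousOn ψ (closure (discPlus l))) {q : ℝ × ℝ} (hq : q ∈ closure (discPlus l)) :
    conj (srcRect r₀ H a) (pot l ψ) q ≤ ψ q := by
  refine conj_le (srcRect_nonempty hr₀ hH ha) fun x _ => ?_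
  have : dot x q - ψ q ≤ pot l ψ x := le_conj (isCompact_closure_discPlus hl) hψ hq
  rw [dot_comm]
  linarith

lemma continuous_conj_srcRect (hr₀ : 0 < r₀) (hH : 0 < H) (ha : 0 < a) (hp : Continuous p) :
    Continuous (conj (srcRect r₀ H a) p) :=
  continuous_conj (isCompact_srcRect r₀ H a) (srcRect_nonempty hr₀ hH ha) hp.continuousOn

/-- The triple conjugate is the single one. Only points of the rectangle enter the layer cost, so
passing from `ψ` to its double conjugate leaves `minCost` unchanged. -/
lemma pot_conj_srcRect (hr₀ : 0 < r₀) (hH : 0 < H) (ha : 0 < a) (hl : 0 < l)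
    (hψ : ContinuousOn ψ (closure (discPlus l))) {x : ℝ × ℝ} (hx : x ∈ srcRect r₀ H a) :
    pot l (conj (srcRect r₀ H a) (pot l ψ)) x = pot l ψ x := by
  have hp := (isPotential_pot hl hψ).continuous
  refine le_antisymm (conj_le (closure_discPlus_nonempty hl) fun q _ => ?_)
    (conj_le (closure_discPlus_nonempty hl) fun q hq => ?_)
  · have := le_conj (x := q) (isCompact_srcRect r₀ H a) hp.continuousOn hx
    rw [dot_comm]
    linarith
  · have h1 := conj_srcRect_le hr₀ hH ha hl hψ hq
    have h2 : dot x q - conj (srcRect r₀ H a) (pot l ψ) q ≤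
        pot l (conj (srcRect r₀ H a) (pot l ψ)) x :=
      le_conj (isCompact_closure_discPlus hl)
        (continuous_conj_srcRect hr₀ hH ha hp).continuousOn hq
    linarith

lemma minCost_congr (hθ : IsAmbient H a b θ) (ha : 0 < a)
    (hmem : ∀ z ∈ Icc 0 H, lo r₀ Ω θ p z ∈ Ico 0 (1 / (2 * r₀ ^ 2)))
    (h : ∀ x ∈ srcRect r₀ H a, p x = p' x) : minCost r₀ Ω H θ p = minCost r₀ Ω H θ p' := by
  refine setIntegral_congr_fun measurableSet_Icc fun z hz => ?_
  have hs : ∀ s ∈ Ico 0 (1 / (2 * r₀ ^ 2)), p (s, phi θ z) = p' (s, phi θ z) := fun s hs =>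
    h _ ⟨⟨hs.1, hs.2.le⟩, phi_mem hθ ha hz⟩
  have e : lo r₀ Ω θ p z = lo r₀ Ω θ p' z := by
    unfold lo loDepth
    rw [argmins_congr hs]
  have := layerCost_congr (Ω := Ω) (hmem z hz) hs
  change layerCost r₀ Ω (fun s => p (s, phi θ z)) (lo r₀ Ω θ p z) = _
  rw [this, e]

lemma dualJ_congr (hσ : σ (discPlus l)ᶜ = 0) (h : ∀ q ∈ closure (discPlus l), ψ q = χ q) :
    dualJ r₀ Ω H l θ σ ψ = dualJ r₀ Ω H l θ σ χ := by
  unfold dualJ pot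
  rw [conj_congr h]
  congr 2
  refine integral_congr_ae ?_
  filter_upwards [ae_mem_discPlus hσ] with q hq
  exact h q (subset_closure hq)

lemma layerMass_eq (hr₀ : 0 < r₀) (hΩ : 0 < Ω) {ϱ : ℝ} (hϱ : ϱ ∈ Ico 0 (1 / (2 * r₀ ^ 2))) :
    layerMass r₀ Ω ϱ = r₀ ^ 4 * ϱ / (1 - 2 * r₀ ^ 2 * ϱ) := by
  have h := intervalIntegral.integral_eq_sub_of_hasDerivAt
    (f := fun s => r₀ ^ 4 * s / (1 - 2 * r₀ ^ 2 * s)) (f' := wt r₀ Ω) (a := 0) (b := ϱ)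
    (fun s hs => ?_) (intervalIntegrable_wt hr₀ (top_pos hr₀) hϱ.2)
  · simpa [layerMass] using h
  · rw [uIcc_of_le hϱ.1] at hs
    have h0 := one_sub_pos hr₀ (hs.2.trans_lt hϱ.2)
    have hd := ((hasDerivAt_id s).const_mul (r₀ ^ 4)).div
      (((hasDerivAt_id s).const_mul (2 * r₀ ^ 2)).const_sub 1) h0.ne'
    convert! hd using 1
    simp only [wt, f₀, id]
    field_simp
    ring

/-- Although depths are bounded, the weight is not integrable up to the end, so layers of any mass
exist. The witness solves `r₀⁴ϱ = M(1 - 2r₀²ϱ)`. -/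
lemma exists_layerMass_eq (hr₀ : 0 < r₀) (hΩ : 0 < Ω) {M : ℝ} (hM : 0 ≤ M) :
    ∃ ϱ ∈ Ico 0 (1 / (2 * r₀ ^ 2)), layerMass r₀ Ω ϱ = M := by
  have hmem : M / (r₀ ^ 4 + 2 * r₀ ^ 2 * M) ∈ Ico 0 (1 / (2 * r₀ ^ 2)) := by
    refine ⟨by positivity, ?_⟩
    rw [div_lt_div_iff₀ (by positivity) (by positivity)]
    have : 0 < r₀ ^ 4 := by positivity
    linarith
  refine ⟨_, hmem, ?_⟩
  rw [layerMass_eq hr₀ hΩ hmem]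
  have h1 : 1 - 2 * r₀ ^ 2 * (M / (r₀ ^ 4 + 2 * r₀ ^ 2 * M)) =
      r₀ ^ 4 / (r₀ ^ 4 + 2 * r₀ ^ 2 * M) := by
    field_simp
    ring
  rw [h1]
  field_simp

variable (hr₀ : 0 < r₀) (hΩ : 0 < Ω) (hH : 0 < H) (ha : 0 < a) (hl : 0 < l)
  (hθ : IsAmbient H a b θ)

include hr₀ hΩ ha hl hθ

/-- The double conjugate lies below `ψ` and has the same potential on the rectangle, so only the
term `-∫ ψ dσ` changes, and it does not decrease. -/
lemma dualJ_le_conj [IsFiniteMeasure σ] (hH : 0 < H) (hσ : σ (discPlus l)ᶜ = 0)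
    (hψ : ContinuousOn ψ (closure (discPlus l))) :
    dualJ r₀ Ω H l θ σ ψ ≤ dualJ r₀ Ω H l θ σ (conj (srcRect r₀ H a) (pot l ψ)) := by
  obtain ⟨S, hc⟩ := exists_isCap_pot (l := l) hr₀ hΩ H a ψ
  have hp := isPotential_pot hl hψ
  unfold dualJ
  rw [minCost_congr (p := pot l ψ) (p' := pot l (conj (srcRect r₀ H a) (pot l ψ))) hθ ha
    (fun z hz => (lo_mem hr₀ hΩ ha hθ hp hc hz).1)
    fun x hx => (pot_conj_srcRect hr₀ hH ha hl hψ hx).symm]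
  have := integral_mono_ae
    (integrable_of_continuousOn hl hσ
      (continuous_conj_srcRect hr₀ hH ha hp.continuous).continuousOn)
    (integrable_of_continuousOn hl hσ hψ) (by
      filter_upwards [ae_mem_discPlus hσ] with q hq
      exact conj_srcRect_le hr₀ hH ha hl hψ (subset_closure hq))
  linarith

/-- The reduced dual functional is Lipschitz on families with a common cap. -/
lemma dualJ_le_add [IsProbabilityMeasure σ] (hσ : σ (discPlus l)ᶜ = 0)
    (hψ : ContinuousOn ψ (closure (discPlus l))) (hχ : ContinuousOn χ (closure (discPlus l)))
    (hc : IsCap r₀ Ω H a (pot l ψ) S) (hc' : IsCap r₀ Ω H a (pot l χ) S) {δ : ℝ} (hδ : 0 ≤ δ)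
    (h : ∀ q ∈ closure (discPlus l), |ψ q - χ q| ≤ δ) :
    dualJ r₀ Ω H l θ σ χ ≤
      dualJ r₀ Ω H l θ σ ψ + δ * (1 + layerMass r₀ Ω S * volume.real (Icc 0 H)) := by
  have hp := isPotential_pot hl hψ
  have hp' := isPotential_pot hl hχ
  have hR := lo_mem_R hr₀ hΩ ha hθ hp hc
  have hle : ∀ z ∈ Icc 0 H, lo r₀ Ω θ (pot l ψ) z ≤ S := fun _ hz =>
    lo_le_cap hr₀ hΩ ha hθ hp hc hz
  have := isFiniteMeasure_mu (Ω := Ω) hr₀ hR hc.mem hle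
  have hf := integrable_f₀_of_le hr₀ hΩ hR hc.mem hle
  obtain ⟨i, -⟩ := integral_cost hθ ha hp'.continuous hR hf
  -- The layer optimal for `ψ` serves as a competitor for `χ`; the cap bounds its mass, which
  -- multiplies `δ`.
  have h1 := minCost_le hr₀ hΩ ha hθ hp' hc' hR i
  have h2 : ∫ z in Icc 0 H, layerCost r₀ Ω (fun s => pot l χ (s, phi θ z))
      (lo r₀ Ω θ (pot l ψ) z) ≤ minCost r₀ Ω H θ (pot l ψ) +
        δ * layerMass r₀ Ω S * volume.real (Icc 0 H) := by
    have i0 := (integral_cost_lo hr₀ hΩ ha hθ hp hc).1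
    have e : minCost r₀ Ω H θ (pot l ψ) + δ * layerMass r₀ Ω S * volume.real (Icc 0 H) =
        ∫ z in Icc 0 H, (layerCost r₀ Ω (fun s => pot l ψ (s, phi θ z))
          (lo r₀ Ω θ (pot l ψ) z) + δ * layerMass r₀ Ω S) := by
      rw [integral_add i0 (integrable_const _), integral_const, measureReal_restrict_apply_univ,
        smul_eq_mul]
      unfold minCost
      ring
    rw [e]
    refine setIntegral_mono_on i (i0.add (integrable_const _)) measurableSet_Icc fun z hz => ?_
    have h3 := layerCost_le_add (Ω := Ω) (δ := δ) hr₀ (hp'.continuous_slice (phi θ z))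
      (hp.continuous_slice (phi θ z)) (hR.2 hz) fun s _ =>
        (abs_le.1 (abs_conj_sub_le (x := (s, phi θ z)) (isCompact_closure_discPlus hl)
          (closure_discPlus_nonempty hl) hψ hχ h)).2
    refine h3.trans (add_le_add le_rfl (mul_le_mul_of_nonneg_left ?_ hδ))
    exact (layerMass_strictMonoOn hr₀ hΩ).monotoneOn (hR.2 hz).2 hc.mem.2 (hle z hz)
  have h4 : ∫ q, ψ q ∂σ ≤ ∫ q, χ q ∂σ + δ := by
    have : ∫ q, χ q ∂σ + δ = ∫ q, (χ q + δ) ∂σ := by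
      rw [integral_add (integrable_of_continuousOn hl hσ hχ) (integrable_const _), integral_const,
        probReal_univ, one_smul]
    rw [this]
    refine integral_mono_ae (integrable_of_continuousOn hl hσ hψ)
      ((integrable_of_continuousOn hl hσ hχ).add (integrable_const _)) ?_
    filter_upwards [ae_mem_discPlus hσ] with q hq
    have := (abs_le.1 (h q (subset_closure hq))).2
    change ψ q ≤ χ q + δ
    linarith
  unfold dualJ
  linarith

/-- Functions of bounded oscillation whose dual value is not too small are bounded. -/
lemma exists_bound_of_dualJ_ge [IsProbabilityMeasure σ] (hH : 0 < H)
    (hσ : σ (discPlus l)ᶜ = 0) (c L : ℝ) :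
    ∃ M, ∀ ψ, ContinuousOn ψ (closure (discPlus l)) →
      (∀ q ∈ closure (discPlus l), |ψ q - ψ (0, 0)| ≤ L) → c ≤ dualJ r₀ Ω H l θ σ ψ →
        |ψ (0, 0)| ≤ M := by
  -- The constant depth `s₁` gives total mass `2`, more than the mass of `σ`. As competitors, depth
  -- `0` bounds `ψ (0, 0)` from above, through the net coefficient `-1`, and depth `s₁` bounds it
  -- from below, through the net coefficient `2 - 1`.
  obtain ⟨s₁, hs₁, hm⟩ := exists_layerMass_eq hr₀ hΩ (M := 2 / H) (by positivity)
  set F := layerCost r₀ Ω (fun _ => 0) s₁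
  refine ⟨|c| + |L| + H * |F|, fun ψ hψ hosc hcψ => ?_⟩
  obtain ⟨S, hc⟩ := exists_isCap_pot (l := l) hr₀ hΩ H a ψ
  have hp := isPotential_pot hl hψ
  have h1 : ψ (0, 0) - L ≤ ∫ q, ψ q ∂σ := by
    have : ψ (0, 0) - L = ∫ _, (ψ (0, 0) - L) ∂σ := by
      rw [integral_const, probReal_univ, one_smul]
    rw [this]
    refine integral_mono_ae (integrable_const _) (integrable_of_continuousOn hl hσ hψ) ?_
    filter_upwards [ae_mem_discPlus hσ] with q hq
    linarith [(abs_le.1 (hosc q (subset_closure hq))).1]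
  have hconst : ∀ s₂ ∈ Ico 0 (1 / (2 * r₀ ^ 2)), minCost r₀ Ω H θ (pot l ψ) ≤
      H * (layerCost r₀ Ω (fun _ => 0) s₂ + ψ (0, 0) * layerMass r₀ Ω s₂) := by
    intro s₂ hs₂
    have hR := const_mem_R (H := H) hs₂
    have := isFiniteMeasure_mu_const (Ω := Ω) (H := H) hr₀ hs₂
    obtain ⟨i, -⟩ := integral_cost hθ ha hp.continuous hR
      (integrable_f₀_of_le hr₀ hΩ hR hs₂ fun _ _ => le_rfl)
    refine (minCost_le hr₀ hΩ ha hθ hp hc hR i).trans ?_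
    have e : H * (layerCost r₀ Ω (fun _ => 0) s₂ + ψ (0, 0) * layerMass r₀ Ω s₂) =
        ∫ _ in Icc 0 H, (layerCost r₀ Ω (fun _ => 0) s₂ + ψ (0, 0) * layerMass r₀ Ω s₂) := by
      rw [integral_const, measureReal_restrict_apply_univ, Real.volume_real_Icc_of_le hH.le,
        smul_eq_mul, sub_zero]
    rw [e]
    refine setIntegral_mono_on i (integrable_const _) measurableSet_Icc fun z hz => ?_
    refine layerCost_le_add (Ω := Ω) hr₀ (hp.continuous_slice (phi θ z)) continuous_const hs₂
      fun s _ => ?_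
    have : dot (s, phi θ z) (0, 0) - ψ (0, 0) ≤ pot l ψ (s, phi θ z) :=
      le_conj (isCompact_closure_discPlus hl) hψ (zero_mem_closure_discPlus hl)
    simp only [dot, mul_zero, add_zero] at this
    linarith
  have h2 := hconst 0 ⟨le_rfl, top_pos hr₀⟩
  have h3 := hconst s₁ hs₁
  have e0 : layerCost r₀ Ω (fun _ => 0) 0 = 0 := intervalIntegral.integral_same
  rw [e0, layerMass_zero] at h2
  rw [hm] at h3
  have e1 : H * (F + ψ (0, 0) * (2 / H)) = H * F + 2 * ψ (0, 0) := by field_simp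
  change _ ≤ H * (F + ψ (0, 0) * (2 / H)) at h3
  rw [e1] at h3
  unfold dualJ at hcψ
  have h4 := neg_abs_le c
  have h5 := le_abs_self L
  have h6 := mul_le_mul_of_nonneg_left (le_abs_self F) hH.le
  have h7 : 0 ≤ H * |F| := by positivity
  rw [abs_le]
  constructor <;> linarith

end Bipot

open scoped BoundedContinuousFunction

/-! ### Existence of a maximizer of the reduced dual functional -/

open Classical in
/-- Extension by zero of a function on a subset of the plane. -/
noncomputable def extendZero {Y : Set (ℝ × ℝ)} (f : Y → ℝ) (q : ℝ × ℝ) : ℝ :=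
  if h : q ∈ Y then f ⟨q, h⟩ else 0

lemma extendZero_of_mem {Y : Set (ℝ × ℝ)} (f : Y → ℝ) {q : ℝ × ℝ} (h : q ∈ Y) :
    extendZero f q = f ⟨q, h⟩ := dif_pos h

lemma continuousOn_extendZero {Y : Set (ℝ × ℝ)} {f : Y → ℝ} (hf : Continuous f) :
    ContinuousOn (extendZero f) Y := by
  rw [continuousOn_iff_continuous_domRestrict]
  convert! hf using 1
  funext q
  exact extendZero_of_mem f q.2

lemma isCompact_lipschitz_family {α : Type*} [MetricSpace α] [CompactSpace α] (C : NNReal)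
    (M : ℝ) : IsCompact {f : α →ᵇ ℝ | (∀ q, f q ∈ Icc (-M) M) ∧ LipschitzWith C f} := by
  have heval : ∀ q, Continuous fun f : α →ᵇ ℝ => f q := fun q =>
    (continuous_apply q).comp BoundedContinuousFunction.continuous_coe
  refine BoundedContinuousFunction.arzela_ascoli₂ (Icc (-M) M) isCompact_Icc _ ?_
    (fun f q hf => hf.1 q) ?_
  · refine IsClosed.inter ?_ ?_
    · have : {f : α →ᵇ ℝ | ∀ q, f q ∈ Icc (-M) M} = ⋂ q, {f : α →ᵇ ℝ | f q ∈ Icc (-M) M} := by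
        ext f
        simp only [mem_ofPred_eq, mem_iInter]
      change IsClosed {f : α →ᵇ ℝ | ∀ q, f q ∈ Icc (-M) M}
      rw [this]
      exact isClosed_iInter fun q =>
        isClosed_Icc.preimage (heval q)
    · have : {f : α →ᵇ ℝ | LipschitzWith C f} =
          ⋂ q, ⋂ q', {f : α →ᵇ ℝ | dist (f q) (f q') ≤ C * dist q q'} := by
        ext f
        simp only [mem_ofPred_eq, mem_iInter, lipschitzWith_iff_dist_le_mul]
      change IsClosed {f : α →ᵇ ℝ | LipschitzWith C f}
      rw [this]
      refine isClosed_iInter fun q => isClosed_iInter fun q' => ?_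
      exact isClosed_le ((heval q).dist (heval q')) continuous_const
  · exact (LipschitzWith.uniformEquicontinuous _ C fun f => f.2.2).equicontinuous

/-- The reduced dual functional has a maximizer. -/
theorem exists_isMaxDual {r₀ Ω H a b l : ℝ} {θ : ℝ → ℝ} {σ : Measure (ℝ × ℝ)}
    [IsProbabilityMeasure σ] (hr₀ : 0 < r₀) (hΩ : 0 < Ω) (hH : 0 < H) (ha : 0 < a) (hl : 0 < l)
    (hθ : IsAmbient H a b θ) (hσ : σ (discPlus l)ᶜ = 0) : ∃ ψ, IsMaxDual r₀ Ω H l θ σ ψ := by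
  set Y := closure (discPlus l)
  have hY : IsCompact Y := isCompact_closure_discPlus hl
  have h0Y : ((0, 0) : ℝ × ℝ) ∈ Y := zero_mem_closure_discPlus hl
  have : CompactSpace Y := isCompact_iff_compactSpace.1 hY
  obtain ⟨R, hR0, hR⟩ := exists_bound_of_isCompact (isCompact_srcRect r₀ H a)
  set C : NNReal := Real.toNNReal (2 * R)
  have hlip : ∀ ψ, ContinuousOn ψ Y →
      LipschitzWith C (conj (srcRect r₀ H a) (pot l ψ)) := fun ψ hψ =>
    lipschitzWith_conj (isCompact_srcRect r₀ H a) (srcRect_nonempty hr₀ hH ha)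
      (isPotential_pot hl hψ).continuous.continuousOn hR0 hR
  have hdist : ∀ q ∈ Y, dist q (0, 0) ≤ l := fun q hq => by
    rw [Prod.dist_eq, Real.dist_eq, Real.dist_eq, sub_zero, sub_zero]
    exact max_le (abs_le_of_mem_closure_discPlus hl q hq).1
      (abs_le_of_mem_closure_discPlus hl q hq).2
  -- Only functions at least as good as zero need a bound. On the closed quarter disc a
  -- `C`-Lipschitz function deviates from its value at the origin by at most `C * l`.
  obtain ⟨M₀, hM₀⟩ := exists_bound_of_dualJ_ge hr₀ hΩ ha hl hθ hH hσ
    (dualJ r₀ Ω H l θ σ fun _ => 0) (C * l)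
  set M := |M₀| + C * l
  have hM : 0 ≤ M := by positivity
  set 𝒞 : Set (Y →ᵇ ℝ) := {f | (∀ q, f q ∈ Icc (-M) M) ∧ LipschitzWith C f}
  have h𝒞 : IsCompact 𝒞 := isCompact_lipschitz_family C M
  have h0𝒞 : (0 : Y →ᵇ ℝ) ∈ 𝒞 :=
    ⟨fun q => ⟨by simpa using hM, by simpa using hM⟩, LipschitzWith.const' 0⟩
  have hcont : ∀ f : Y →ᵇ ℝ, ContinuousOn (extendZero f) Y := fun f =>
    continuousOn_extendZero f.continuous
  obtain ⟨S, hS⟩ := exists_isCap hr₀ hΩ H a (1 / (2 * r₀ ^ 2) * l + H / a * l + M)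
  have hcap : ∀ f ∈ 𝒞, IsCap r₀ Ω H a (pot l (extendZero f)) S := fun f hf => by
    refine hS _ (conj_le (closure_discPlus_nonempty hl) fun q hq => ?_)
    rw [extendZero_of_mem f hq]
    have h1 := (hf.1 ⟨q, hq⟩).1
    obtain ⟨h2, h3⟩ := closure_discPlus_subset hl hq
    have h4 := mul_le_mul_of_nonneg_left h2.2 (top_pos hr₀).le
    have h5 := mul_le_mul_of_nonneg_left h3.2 (by positivity : 0 ≤ H / a)
    unfold dot
    dsimp only
    linarith
  set m := 1 + layerMass r₀ Ω S * volume.real (Icc 0 H)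
  have hcontJ : ContinuousOn (fun f : Y →ᵇ ℝ => dualJ r₀ Ω H l θ σ (extendZero f)) 𝒞 := by
    have hm : 0 ≤ m := by
      have := layerMass_nonneg (r₀ := r₀) (Ω := Ω) (hcap 0 h0𝒞).mem.1
      positivity
    have hone : ∀ f ∈ 𝒞, ∀ g ∈ 𝒞, dualJ r₀ Ω H l θ σ (extendZero f) ≤
        dualJ r₀ Ω H l θ σ (extendZero g) + dist f g * m := fun f hf g hg => by
      refine dualJ_le_add hr₀ hΩ ha hl hθ hσ (hcont g) (hcont f) (hcap g hg) (hcap f hf)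
        dist_nonneg fun q hq => ?_
      rw [extendZero_of_mem _ hq, extendZero_of_mem _ hq, ← Real.dist_eq, dist_comm]
      exact BoundedContinuousFunction.dist_coe_le_dist _
    refine LipschitzOnWith.continuousOn (K := Real.toNNReal m)
      (LipschitzOnWith.of_dist_le_mul fun f hf g hg => ?_)
    rw [Real.coe_toNNReal _ hm, Real.dist_eq, abs_le]
    have h1 := hone f hf g hg
    have h2 := hone g hg f hf
    rw [dist_comm] at h2
    constructor <;> linarith
  obtain ⟨f, hf, hmax⟩ := h𝒞.exists_isMaxOn ⟨0, h0𝒞⟩ hcontJ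
  refine ⟨extendZero f, hcont f, fun χ hχ => ?_⟩
  -- A competitor worse than zero is beaten by the zero function, which lies in the compact family.
  -- Any other is replaced by its double conjugate, which lies there too.
  rcases le_or_gt (dualJ r₀ Ω H l θ σ fun _ => 0) (dualJ r₀ Ω H l θ σ χ) with hge | hlt
  · set χ' := conj (srcRect r₀ H a) (pot l χ)
    have hχ' : Continuous χ' := (hlip χ hχ).continuous
    have h1 : dualJ r₀ Ω H l θ σ χ ≤ dualJ r₀ Ω H l θ σ χ' :=
      dualJ_le_conj hr₀ hΩ ha hl hθ hH hσ hχ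
    have hosc : ∀ q ∈ Y, |χ' q - χ' (0, 0)| ≤ C * l := fun q hq => by
      rw [← Real.dist_eq]
      exact ((hlip χ hχ).dist_le_mul _ _).trans
        (mul_le_mul_of_nonneg_left (hdist q hq) C.2)
    have h2 := hM₀ χ' hχ'.continuousOn hosc (hge.trans h1)
    set g : Y →ᵇ ℝ := BoundedContinuousFunction.mkOfCompact
      ⟨fun q => χ' q, hχ'.comp continuous_subtype_val⟩
    have hg : g ∈ 𝒞 := by
      refine ⟨fun q => ?_, LipschitzWith.of_dist_le_mul fun q q' => (hlip χ hχ).dist_le_mul _ _⟩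
      change χ' q ∈ Icc (-M) M
      have h3 := abs_le.1 (hosc q q.2)
      have h4 := abs_le.1 (h2.trans (le_abs_self M₀))
      constructor <;> simp only [M] <;> linarith
    have h5 : dualJ r₀ Ω H l θ σ χ' = dualJ r₀ Ω H l θ σ (extendZero g) :=
      dualJ_congr hσ fun q hq => (extendZero_of_mem g hq).symm
    rw [h5] at h1
    exact h1.trans (hmax hg)
  · have h5 : dualJ r₀ Ω H l θ σ (fun _ => 0) = dualJ r₀ Ω H l θ σ (extendZero (0 : Y →ᵇ ℝ)) :=
      dualJ_congr hσ fun q hq => (extendZero_of_mem (0 : Y →ᵇ ℝ) hq).symm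
    exact hlt.le.trans (h5.le.trans (hmax h0𝒞))

/-! ### Pairs of potentials -/

section Pairs

variable {r₀ Ω H a b l : ℝ} {θ : ℝ → ℝ} {σ : Measure (ℝ × ℝ)} {ψ : ℝ × ℝ → ℝ}
  {P : ℝ × ℝ → ℝ → ℝ} {Ψ : ℝ × ℝ → ℝ}

/-- Height and temperature enter only through their ratio, so the potentials in three variables
reduce to functions on the plane. -/
lemma cost_eq_dot (p : ℝ × ℝ) (m : ℝ) (q : ℝ × ℝ) : cost p m q = dot (p.1, p.2 / m) q := by
  unfold cost dot
  ring

lemma mem_srcRect {p : ℝ × ℝ} {m : ℝ} (ha : 0 < a) (hp : p ∈ W r₀ H) (hm : m ∈ Ioo a b) :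
    (p.1, p.2 / m) ∈ srcRect r₀ H a :=
  ⟨⟨hp.1.1, hp.1.2.le⟩, div_nonneg hp.2.1 (ha.trans hm.1).le,
    div_le_div₀ (hp.2.1.trans hp.2.2) hp.2.2 ha hm.1.le⟩

lemma pair_mem_U (hr₀ : 0 < r₀) (hH : 0 < H) (ha : 0 < a) (hl : 0 < l)
    (hψ : ContinuousOn ψ (closure (discPlus l))) :
    (fun p m => pot l ψ (p.1, p.2 / m), conj (srcRect r₀ H a) (pot l ψ)) ∈ U r₀ H a b := by
  have hp := (isPotential_pot hl hψ).continuous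
  refine ⟨?_, (continuous_conj_srcRect hr₀ hH ha hp).continuousOn, fun p hpW m hm q _ => ?_⟩
  · have hsub : closure (W r₀ H ×ˢ Ioo a b) ⊆ {y : (ℝ × ℝ) × ℝ | a ≤ y.2} :=
      closure_minimal (fun y hy => (hy.2.1.le : a ≤ y.2))
        (isClosed_le continuous_const continuous_snd)
    have hc : ContinuousOn (fun y : (ℝ × ℝ) × ℝ => (y.1.1, y.1.2 / y.2))
        (closure (W r₀ H ×ˢ Ioo a b)) := by
      refine ContinuousOn.prodMk (by fun_prop) (ContinuousOn.div (by fun_prop) (by fun_prop) ?_)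
      intro y hy
      exact (ha.trans_le (hsub hy)).ne'
    exact hp.comp_continuousOn hc
  · have := le_conj (x := q) (isCompact_srcRect r₀ H a) hp.continuousOn (mem_srcRect ha hpW hm)
    rw [cost_eq_dot, dot_comm]
    change _ ≤ pot l ψ (p.1, p.2 / m) + conj (srcRect r₀ H a) (pot l ψ) q
    linarith

lemma continuousOn_of_mem_U₀ (hl : 0 < l) (h : (P, Ψ) ∈ U₀ r₀ H a b l) :
    ContinuousOn Ψ (closure (discPlus l)) :=
  h.1.2.1.mono (closure_discPlus_subset_quadrant hl)

lemma eq_pot_of_mem_U₀ (hl : 0 < l) (h : (P, Ψ) ∈ U₀ r₀ H a b l) {p : ℝ × ℝ} (hp : p ∈ W r₀ H)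
    {m : ℝ} (hm : m ∈ Ioo a b) : P p m = pot l Ψ (p.1, p.2 / m) := by
  have h1 := h.2.1 p hp m hm
  have h2 := isLUB_conj (isCompact_closure_discPlus hl) (closure_discPlus_nonempty hl)
    (continuousOn_of_mem_U₀ hl h) (p.1, p.2 / m)
  simp only [cost_eq_dot] at h1
  exact h1.unique h2

/-- The points `(s, z/m)` stay in `srcRect` and fill its half-open version: for `ζ < H/a` some `m`
in `(a, b)` near `a` satisfies `ζ * m ≤ H`. Continuity of the potential covers the remaining edges.
-/
lemma eq_conj_of_mem_U₀ (hr₀ : 0 < r₀) (hH : 0 < H) (ha : 0 < a) (hab : a < b) (hl : 0 < l)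
    (h : (P, Ψ) ∈ U₀ r₀ H a b l) {q : ℝ × ℝ} (hq : q ∈ disc l ∩ quadrant) :
    Ψ q = conj (srcRect r₀ H a) (pot l Ψ) q := by
  have hp := (isPotential_pot hl (continuousOn_of_mem_U₀ hl h)).continuous
  obtain ⟨h1, h2⟩ := h.2.2 q hq
  refine le_antisymm (h2 ?_) (conj_le (srcRect_nonempty hr₀ hH ha) fun x hx => ?_)
  · rintro _ ⟨⟨p, m⟩, ⟨hpW, hm⟩, rfl⟩
    have := le_conj (x := q) (isCompact_srcRect r₀ H a) hp.continuousOn (mem_srcRect ha hpW hm)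
    dsimp only at hpW hm ⊢
    rw [eq_pot_of_mem_U₀ hl h hpW hm, cost_eq_dot, dot_comm]
    exact this
  · have hcl : IsClosed {x | dot q x - pot l Ψ x ≤ Ψ q} :=
      isClosed_le ((continuous_dot_right q).sub hp) continuous_const
    have hsub : Ico 0 (1 / (2 * r₀ ^ 2)) ×ˢ Ico 0 (H / a) ⊆ {x | dot q x - pot l Ψ x ≤ Ψ q} := by
      rintro ⟨s, ζ⟩ ⟨hs, hζ⟩
      dsimp only at hs hζ
      obtain ⟨m, hm, hmH⟩ : ∃ m ∈ Ioo a b, ζ * m ≤ H := by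
        rcases hζ.1.eq_or_lt with h0 | h0
        · obtain ⟨m, hm⟩ := exists_between hab
          exact ⟨m, hm, by rw [← h0, zero_mul]; exact hH.le⟩
        · have : a < min b (H / ζ) := by
            refine lt_min hab ?_
            rw [lt_div_iff₀ h0, mul_comm]
            exact (lt_div_iff₀ ha).1 hζ.2
          obtain ⟨m, hm1, hm2⟩ := exists_between this
          refine ⟨m, ⟨hm1, hm2.trans_le (min_le_left _ _)⟩, ?_⟩
          have := (hm2.trans_le (min_le_right _ _)).le
          rw [le_div_iff₀ h0] at this
          linarith
      have hm0 : 0 < m := ha.trans hm.1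
      have hW : (s, ζ * m) ∈ W r₀ H := ⟨hs, mul_nonneg hζ.1 hm0.le, hmH⟩
      have := h1 ⟨((s, ζ * m), m), ⟨hW, hm⟩, rfl⟩
      dsimp only at this
      rw [eq_pot_of_mem_U₀ hl h hW hm, cost_eq_dot, dot_comm] at this
      rw [mul_div_cancel_right₀ _ hm0.ne'] at this
      exact this
    have hX : srcRect r₀ H a = closure (Ico 0 (1 / (2 * r₀ ^ 2)) ×ˢ Ico 0 (H / a)) := by
      rw [closure_prod_eq, closure_Ico (top_pos hr₀).ne, closure_Ico (by positivity), srcRect]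
    rw [hX] at hx
    exact closure_minimal hsub hcl hx

variable (hr₀ : 0 < r₀) (hΩ : 0 < Ω) (ha : 0 < a) (hl : 0 < l) (hθ : IsAmbient H a b θ)

include hr₀ hΩ ha hl hθ

lemma J_eq_dualJ (h : (P, Ψ) ∈ U₀ r₀ H a b l) :
    J r₀ Ω H θ σ (P, Ψ) = dualJ r₀ Ω H l θ σ Ψ := by
  obtain ⟨S, hc⟩ := exists_isCap_pot (l := l) hr₀ hΩ H a Ψ
  have hp := isPotential_pot hl (continuousOn_of_mem_U₀ hl h)
  unfold J dualJ
  dsimp only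
  rw [scrH_eq hr₀ hΩ ha hθ hp hc]
  intro s hs z hz
  exact eq_pot_of_mem_U₀ hl h (p := (s, z)) ⟨hs, hz⟩ (hθ.mapsTo hz)

lemma dualJ_le_J_pair [IsProbabilityMeasure σ] (hH : 0 < H) (hσ : σ (discPlus l)ᶜ = 0)
    (hψ : ContinuousOn ψ (closure (discPlus l))) :
    dualJ r₀ Ω H l θ σ ψ ≤ J r₀ Ω H θ σ
      (fun p m => pot l ψ (p.1, p.2 / m), conj (srcRect r₀ H a) (pot l ψ)) := by
  obtain ⟨S, hc⟩ := exists_isCap_pot (l := l) hr₀ hΩ H a ψ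
  have hp := isPotential_pot hl hψ
  have h1 : scrH r₀ Ω H θ (fun p m => pot l ψ (p.1, p.2 / m)) = minCost r₀ Ω H θ (pot l ψ) :=
    scrH_eq hr₀ hΩ ha hθ hp hc fun s _ z _ => rfl
  unfold J dualJ
  dsimp only
  rw [h1]
  have := integral_mono_ae
    (integrable_of_continuousOn hl hσ
      (continuous_conj_srcRect hr₀ hH ha hp.continuous).continuousOn)
    (integrable_of_continuousOn hl hσ hψ) (by
      filter_upwards [ae_mem_discPlus hσ] with q hq
      exact conj_srcRect_le hr₀ hH ha hl hψ (subset_closure hq))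
  linarith

/-- Every continuous `χ` on the quarter disc generates an admissible pair, its potential and the
conjugate of that, whose value under `J` is at least `dualJ` of `χ`. -/
lemma IsDualMaximizer.isMaxDual [IsProbabilityMeasure σ] (hH : 0 < H)
    (hσ : σ (discPlus l)ᶜ = 0) (h : IsDualMaximizer r₀ Ω H a b l θ σ (P, Ψ)) :
    IsMaxDual r₀ Ω H l θ σ Ψ := by
  refine ⟨continuousOn_of_mem_U₀ hl h.1, fun χ hχ => ?_⟩
  rw [← J_eq_dualJ hr₀ hΩ ha hl hθ h.1]
  exact (dualJ_le_J_pair hr₀ hΩ ha hl hθ hH hσ hχ).trans (h.2 (pair_mem_U hr₀ hH ha hl hχ))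

omit hr₀ hΩ in
/-- At interior points, the map `𝒯` is the gradient of the potential. -/
lemma T_eq_grad (h : (P, Ψ) ∈ U₀ r₀ H a b l) {x : ℝ × ℝ}
    (hx1 : x.1 ∈ Ioo 0 (1 / (2 * r₀ ^ 2))) (hx2 : x.2 ∈ Ioo 0 H)
    (hd : DifferentiableAt ℝ (pot l Ψ) (bff θ x)) :
    DifferentiableAt ℝ (fun p' => P p' (θ x.2)) x ∧ T θ P x = grad (pot l Ψ) (bff θ x) := by
  have hz : x.2 ∈ Icc 0 H := ⟨hx2.1.le, hx2.2.le⟩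
  have hm := hθ.mapsTo hz
  have hm0 := hθ.pos ha hz
  have hWn : W r₀ H ∈ 𝓝 x := by
    refine mem_of_superset (prod_mem_nhds (isOpen_Ioo.mem_nhds hx1) (isOpen_Ioo.mem_nhds hx2)) ?_
    exact prod_mono Ioo_subset_Ico_self Ioo_subset_Icc_self
  have hev : (fun p' => P p' (θ x.2)) =ᶠ[𝓝 x] fun p' => pot l Ψ (p'.1, p'.2 / θ x.2) := by
    filter_upwards [hWn] with p' hp'
    exact eq_pot_of_mem_U₀ hl h hp' hm
  have hd' : HasFDerivAt (pot l Ψ) (fderiv ℝ (pot l Ψ) (bff θ x)) (x.1, x.2 / θ x.2) :=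
    hd.hasFDerivAt
  refine ⟨?_, ?_⟩
  · refine DifferentiableAt.congr_of_eventuallyEq ?_ hev
    exact DifferentiableAt.comp x (g := pot l Ψ) (f := fun p' : ℝ × ℝ => (p'.1, p'.2 / θ x.2))
      hd'.differentiableAt (by fun_prop)
  · have e1 : HasDerivAt (fun s => P (s, x.2) (θ x.2)) (fderiv ℝ (pot l Ψ) (bff θ x) (1, 0))
        x.1 := by
      have hline : HasDerivAt (fun s : ℝ => (s, x.2 / θ x.2)) ((1 : ℝ), (0 : ℝ)) x.1 :=
        (hasDerivAt_id _).prodMk (hasDerivAt_const _ _)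
      refine (hd'.comp_hasDerivAt x.1 hline).congr_of_eventuallyEq ?_
      have hc : Tendsto (fun s : ℝ => (s, x.2)) (𝓝 x.1) (𝓝 x) :=
        Continuous.tendsto' (by fun_prop) _ _ rfl
      exact hc.eventually hev
    have e2 : HasDerivAt (fun z => P (x.1, z) (θ x.2))
        (fderiv ℝ (pot l Ψ) (bff θ x) (0, 1 / θ x.2)) x.2 := by
      have hline : HasDerivAt (fun z : ℝ => (x.1, z / θ x.2)) ((0 : ℝ), 1 / θ x.2) x.2 :=
        (hasDerivAt_const _ _).prodMk ((hasDerivAt_id _).div_const _)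
      refine (hd'.comp_hasDerivAt x.2 hline).congr_of_eventuallyEq ?_
      have hc : Tendsto (fun z : ℝ => (x.1, z)) (𝓝 x.2) (𝓝 x) :=
        Continuous.tendsto' (by fun_prop) _ _ rfl
      exact hc.eventually hev
    -- Differentiating in `z` with `m` frozen produces a factor `1/θ`, which the prefactor in `𝒯`
    -- cancels.
    have e3 : ((0 : ℝ), 1 / θ x.2) = (1 / θ x.2) • ((0 : ℝ), (1 : ℝ)) := by simp
    unfold T grad
    rw [e1.deriv, e2.deriv, e3, map_smul, smul_eq_mul, ← mul_assoc, mul_one_div_cancel hm0.ne',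
      one_mul]

/-- Two maximizers of the reduced dual functional have the same least depths. -/
lemma lo_eq_lo [IsProbabilityMeasure σ] (hσ : σ (discPlus l)ᶜ = 0) {χ : ℝ × ℝ → ℝ}
    (hψ : IsMaxDual r₀ Ω H l θ σ ψ) (hχ : IsMaxDual r₀ Ω H l θ σ χ) {z : ℝ} (hz : z ∈ Ioc 0 H) :
    lo r₀ Ω θ (pot l ψ) z = lo r₀ Ω θ (pot l χ) z := by
  have key : ∀ {ψ χ : ℝ × ℝ → ℝ}, IsMaxDual r₀ Ω H l θ σ ψ → IsMaxDual r₀ Ω H l θ σ χ →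
      lo r₀ Ω θ (pot l ψ) z ≤ lo r₀ Ω θ (pot l χ) z := by
    intro ψ χ hψ hχ
    obtain ⟨S, hc⟩ := exists_isCap_pot (l := l) hr₀ hΩ H a ψ
    obtain ⟨S', hc'⟩ := exists_isCap_pot (l := l) hr₀ hΩ H a χ
    have hp := isPotential_pot hl hψ.cont
    have hp' := isPotential_pot hl hχ.cont
    have hzI : z ∈ Icc 0 H := ⟨hz.1.le, hz.2⟩
    have hae := ae_eq_lo hr₀ hΩ ha hl hθ hσ hχ (lo_mem_R₀ hr₀ hΩ ha hl hθ hσ hψ) (by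
      rw [K_lo_eq hr₀ hΩ ha hl hθ hσ hψ, EReal.coe_le_coe_iff]
      linarith [hχ.le ψ hψ.cont])
    refine le_of_forall_lt fun t ht => ?_
    -- Lower semicontinuity gives the bound `t` on `lo` at points `y` just left of `z`. At almost
    -- every such `y` the two depths agree, and monotonicity carries the bound back to `z`. The
    -- argument needs points to the left, hence `z > 0`.
    have hev := eventually_lt_lo hr₀ hΩ ha hθ hp hc hzI ht
    rw [eventually_nhdsWithin_iff, Metric.eventually_nhds_iff] at hev
    obtain ⟨δ, hδ, hev⟩ := hev
    have hpos : 0 < volume (Ioo (max 0 (z - δ)) z) := by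
      rw [Real.volume_Ioo, ENNReal.ofReal_pos, sub_pos]
      exact max_lt hz.1 (by linarith)
    have hae' := (ae_restrict_iff' measurableSet_Icc).1 hae
    obtain ⟨y, hyI, hy⟩ := nonempty_of_measure_ne_zero (s := Ioo (max 0 (z - δ)) z ∩
        {y | y ∈ Icc 0 H → lo r₀ Ω θ (pot l ψ) y = lo r₀ Ω θ (pot l χ) y}) (by
      rw [measure_inter_conull hae']
      exact hpos.ne')
    have hy0 : 0 < y := (le_max_left _ _).trans_lt hyI.1
    have hyδ : z - δ < y := (le_max_right _ _).trans_lt hyI.1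
    have hyH : y ∈ Icc 0 H := ⟨hy0.le, hyI.2.le.trans hz.2⟩
    have h1 := hev (y := y) (by
      rw [Real.dist_eq, abs_lt]
      constructor <;> linarith [hyI.2]) hyH
    rw [hy hyH] at h1
    exact h1.trans_le (lo_monotoneOn hr₀ hΩ ha hθ hp' hc' hyH hzI hyI.2.le)
  exact le_antisymm (key hψ hχ) (key hχ hψ)

end Pairs

/-! ### The inverse map -/

section Inverse

variable {r₀ Ω H a b l : ℝ} {θ : ℝ → ℝ} {σ : Measure (ℝ × ℝ)} {ψ : ℝ × ℝ → ℝ}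
  {P : ℝ × ℝ → ℝ → ℝ} {Ψ : ℝ × ℝ → ℝ}

lemma IsAmbient.lt (hθ : IsAmbient H a b θ) (hH : 0 < H) : a < b := by
  have := hθ.mapsTo (left_mem_Icc.2 hH.le)
  exact this.1.trans this.2

lemma ae_regular (hr₀ : 0 < r₀) (hΩ : 0 < Ω) (ha : 0 < a) (hl : 0 < l) (hθ : IsAmbient H a b θ)
    [IsProbabilityMeasure σ] (hσ : σ (discPlus l)ᶜ = 0) (hψ : IsMaxDual r₀ Ω H l θ σ ψ) :
    ∀ᵐ x ∂(mu r₀ Ω H (lo r₀ Ω θ (pot l ψ))), x.1 ∈ Ioo 0 (1 / (2 * r₀ ^ 2)) ∧ x.2 ∈ Ioo 0 H ∧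
      DifferentiableAt ℝ (pot l ψ) (bff θ x) ∧ grad (pot l ψ) (bff θ x) ∈ discPlus l ∧
      bff θ x ∈ srcRect r₀ H a := by
  have hR := (lo_mem_R₀ hr₀ hΩ ha hl hθ hσ hψ).1
  have hm : AEMeasurable (fun x => grad (pot l ψ) (bff θ x))
      (mu r₀ Ω H (lo r₀ Ω θ (pot l ψ))) :=
    (measurable_grad _).comp_aemeasurable (aemeasurable_bff hθ ha)
  have h1 : ∀ᵐ q ∂((mu r₀ Ω H (lo r₀ Ω θ (pot l ψ))).map
      (fun x => grad (pot l ψ) (bff θ x))), q ∈ discPlus l := by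
    rw [map_grad_eq hr₀ hΩ ha hl hθ hσ hψ]
    exact ae_mem_discPlus hσ
  filter_upwards [ae_interior hR, ae_mem_D hR, ae_of_ae_map hm h1, mu_absolutelyContinuous
    ((isPotential_pot hl hψ.cont).ae_differentiableAt_bff hθ ha)] with x hx hD hq hd
  have hlt := (hR.2 hD.1).2
  exact ⟨⟨hx.2.1, hx.2.2.trans hlt⟩, hx.1, hd hx.1, hq, bff_mem hθ ha hR hD⟩

lemma bff_invFunOn {x : ℝ × ℝ} (hx : x.2 ∈ phi θ '' Icc 0 H) :
    bff θ (x.1, Function.invFunOn (phi θ) (Icc 0 H) x.2) = x := by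
  unfold bff
  rw [Function.invFunOn_eq hx]

lemma invFunOn_bff (hθ : IsAmbient H a b θ) (ha : 0 < a) {x : ℝ × ℝ} (hx : x.2 ∈ Icc 0 H) :
    ((bff θ x).1, Function.invFunOn (phi θ) (Icc 0 H) (bff θ x).2) = x := by
  unfold bff
  have h := (strictMonoOn_phi hθ ha).injOn.leftInvOn_invFunOn hx
  rw [h]

lemma aemeasurable_invFunOn_phi (hθ : IsAmbient H a b θ) (ha : 0 < a) {ν : Measure ℝ}
    (hν : ∀ᵐ y ∂ν, y ∈ phi θ '' Icc 0 H) :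
    AEMeasurable (Function.invFunOn (phi θ) (Icc 0 H)) ν := by
  rw [← Measure.restrict_eq_self_of_ae_mem hν]
  refine aemeasurable_restrict_of_monotoneOn
    (isCompact_Icc.image_of_continuousOn (continuousOn_phi hθ ha)).measurableSet ?_
  rintro _ ⟨z, hz, rfl⟩ _ ⟨z', hz', rfl⟩ h
  have hinv := (strictMonoOn_phi hθ ha).injOn.leftInvOn_invFunOn
  rw [hinv hz, hinv hz']
  exact ((strictMonoOn_phi hθ ha).le_iff_le hz hz').1 h

/-- On `discPlus`, the map `𝒮` is read off from the gradient of the conjugate of the potential. -/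
lemma S_eq_grad (hr₀ : 0 < r₀) (hH : 0 < H) (ha : 0 < a) (hl : 0 < l) (hθ : IsAmbient H a b θ)
    (h : (P, Ψ) ∈ U₀ r₀ H a b l) {q : ℝ × ℝ} (hq : q ∈ discPlus l)
    (hd : DifferentiableAt ℝ (conj (srcRect r₀ H a) (pot l Ψ)) q) :
    DifferentiableAt ℝ Ψ q ∧ dZ Ψ q = (grad (conj (srcRect r₀ H a) (pot l Ψ)) q).2 ∧
      S H θ Ψ q = ((grad (conj (srcRect r₀ H a) (pot l Ψ)) q).1,
        Function.invFunOn (phi θ) (Icc 0 H)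
          (grad (conj (srcRect r₀ H a) (pot l Ψ)) q).2) := by
  have hev : Ψ =ᶠ[𝓝 q] conj (srcRect r₀ H a) (pot l Ψ) := by
    filter_upwards [isOpen_discPlus.mem_nhds hq] with q' hq'
    exact eq_conj_of_mem_U₀ hr₀ hH ha (hθ.lt hH) hl h (discPlus_subset hq')
  have hd' := hd.hasFDerivAt.congr_of_eventuallyEq hev
  have e1 : HasDerivAt (fun Υ => Ψ (Υ, q.2))
      (grad (conj (srcRect r₀ H a) (pot l Ψ)) q).1 q.1 :=
    HasFDerivAt.comp_hasDerivAt q.1 (f := fun Υ : ℝ => (Υ, q.2)) hd'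
      ((hasDerivAt_id _).prodMk (hasDerivAt_const _ _))
  have e2 : HasDerivAt (fun Z => Ψ (q.1, Z))
      (grad (conj (srcRect r₀ H a) (pot l Ψ)) q).2 q.2 :=
    HasFDerivAt.comp_hasDerivAt q.2 (f := fun Z : ℝ => (q.1, Z)) hd'
      ((hasDerivAt_const _ _).prodMk (hasDerivAt_id _))
  refine ⟨hd'.differentiableAt, e2.deriv, ?_⟩
  unfold S dZ
  rw [e1.deriv, e2.deriv]

lemma ae_differentiableAt_conj_srcRect (hr₀ : 0 < r₀) (hH : 0 < H) (ha : 0 < a) (hl : 0 < l)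
    (hψ : ContinuousOn ψ (closure (discPlus l))) (hac : σ ≪ volume) :
    ∀ᵐ q ∂σ, DifferentiableAt ℝ (conj (srcRect r₀ H a) (pot l ψ)) q := by
  obtain ⟨C, hC0, hC⟩ := exists_bound_of_isCompact (isCompact_srcRect r₀ H a)
  exact hac (lipschitzWith_conj (isCompact_srcRect r₀ H a) (srcRect_nonempty hr₀ hH ha)
    (isPotential_pot hl hψ).continuous.continuousOn hC0 hC).ae_differentiableAt

variable (hr₀ : 0 < r₀) (hΩ : 0 < Ω) (hH : 0 < H) (ha : 0 < a) (hl : 0 < l)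
  (hθ : IsAmbient H a b θ)

include hr₀ hΩ hH ha hl hθ

/-- Contact, that is equality in Fenchel's inequality, is symmetric in the two variables. Where both
potentials are differentiable, each gradient selects the unique contact partner, so the gradients
invert each other. -/
lemma inverse_map [IsProbabilityMeasure σ] (hσ : σ (discPlus l)ᶜ = 0)
    (h : IsDualMaximizer r₀ Ω H a b l θ σ (P, Ψ)) (hac : σ ≪ volume) :
    (∀ᵐ q ∂σ, DifferentiableAt ℝ Ψ q ∧ dZ Ψ q ∈ phi θ '' Icc 0 H) ∧
      σ.map (S H θ Ψ) = mu r₀ Ω H (lo r₀ Ω θ (pot l Ψ)) ∧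
      (∀ᵐ x ∂(mu r₀ Ω H (lo r₀ Ω θ (pot l Ψ))), S H θ Ψ (T θ P x) = x) ∧
      ∀ᵐ q ∂σ, T θ P (S H θ Ψ q) = q := by
  have hmax := h.isMaxDual hr₀ hΩ ha hl hθ hH hσ
  have hp := (isPotential_pot hl hmax.cont).continuous
  have hreg := ae_regular hr₀ hΩ ha hl hθ hσ hmax
  have hmap := map_grad_eq hr₀ hΩ ha hl hθ hσ hmax
  have hdiff := ae_differentiableAt_conj_srcRect hr₀ hH ha hl hmax.cont hac
  set Φ := conj (srcRect r₀ H a) (pot l Ψ) with hΦ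
  set M := mu r₀ Ω H (lo r₀ Ω θ (pot l Ψ)) with hM
  have hK := isCompact_closure_discPlus hl
  have hX := isCompact_srcRect r₀ H a
  have hGm : AEMeasurable (fun x => grad (pot l Ψ) (bff θ x)) M :=
    (measurable_grad _).comp_aemeasurable (aemeasurable_bff hθ ha)
  have hT : ∀ᵐ x ∂M, T θ P x = grad (pot l Ψ) (bff θ x) := by
    filter_upwards [hreg] with x hx
    exact (T_eq_grad ha hl hθ h.1 hx.1 hx.2.1 hx.2.2.1).2
  -- Differentiability of `Φ` holds `σ`-almost everywhere by absolute continuity, and is pulled back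
  -- to the layer through the transport identity.
  have hgrad : ∀ᵐ x ∂M, grad Φ (grad (pot l Ψ) (bff θ x)) = bff θ x := by
    have := ae_of_ae_map hGm (hmap.symm ▸ hdiff)
    filter_upwards [hreg, this] with x hx hd
    refine grad_conj_eq hX hp.continuousOn hd hx.2.2.2.2 ?_
    have h1 := (grad_conj_mem hK (closure_discPlus_nonempty hl) hmax.cont hx.2.2.1).2
    have h2 := eq_conj_of_mem_U₀ hr₀ hH ha (hθ.lt hH) hl h.1 (discPlus_subset hx.2.2.2.1)
    change pot l Ψ (bff θ x) =
      dot (bff θ x) (grad (pot l Ψ) (bff θ x)) - Ψ (grad (pot l Ψ) (bff θ x)) at h1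
    rw [dot_comm]
    linarith
  have hY : MeasurableSet (phi θ '' Icc 0 H) :=
    (isCompact_Icc.image_of_continuousOn (continuousOn_phi hθ ha)).measurableSet
  have hmem : ∀ᵐ q ∂σ, (grad Φ q).2 ∈ phi θ '' Icc 0 H := by
    rw [← hmap, ae_map_iff hGm ((measurable_grad Φ).snd hY)]
    filter_upwards [hgrad, hreg] with x hx hr
    rw [hx]
    exact ⟨x.2, ⟨hr.2.1.1.le, hr.2.1.2.le⟩, rfl⟩
  have hS : ∀ᵐ q ∂σ, DifferentiableAt ℝ Ψ q ∧ dZ Ψ q = (grad Φ q).2 ∧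
      S H θ Ψ q = ((grad Φ q).1, Function.invFunOn (phi θ) (Icc 0 H) (grad Φ q).2) := by
    filter_upwards [hdiff, ae_mem_discPlus hσ] with q hd hq
    exact S_eq_grad hr₀ hH ha hl hθ h.1 hq hd
  have hSm : AEMeasurable (S H θ Ψ) σ := by
    have h2 : ∀ᵐ y ∂(σ.map fun q => (grad Φ q).2), y ∈ phi θ '' Icc 0 H :=
      (ae_map_iff (measurable_grad Φ).snd.aemeasurable hY).2 hmem
    have := (measurable_grad Φ).fst.aemeasurable (μ := σ) |>.prodMk
      ((aemeasurable_invFunOn_phi hθ ha h2).comp_aemeasurable (measurable_grad Φ).snd.aemeasurable)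
    refine this.congr ?_
    filter_upwards [hS] with q hq
    exact hq.2.2.symm
  have hSG : ∀ᵐ x ∂M, S H θ Ψ (grad (pot l Ψ) (bff θ x)) = x := by
    filter_upwards [hgrad, hreg, ae_of_ae_map hGm (hmap.symm ▸ hS)] with x hx hr hs
    rw [hs.2.2, hx]
    exact invFunOn_bff hθ ha ⟨hr.2.1.1.le, hr.2.1.2.le⟩
  have hSmap : σ.map (S H θ Ψ) = M := by
    have hSm' : AEMeasurable (S H θ Ψ) (M.map fun x => grad (pot l Ψ) (bff θ x)) := by
      rwa [hmap]
    rw [← hmap, AEMeasurable.map_map_of_aemeasurable hSm' hGm]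
    exact (Measure.map_congr (g := id) hSG).trans Measure.map_id
  refine ⟨?_, hSmap, ?_, ?_⟩
  · filter_upwards [hS, hmem] with q hq hm
    exact ⟨hq.1, hq.2.1 ▸ hm⟩
  · filter_upwards [hSG, hT] with x hx ht
    rw [ht, hx]
  · filter_upwards [hS, hmem, hdiff, ae_mem_discPlus hσ, ae_of_ae_map hSm (hSmap.symm ▸ hreg)]
      with q hs hm hd hq hr
    -- Contact is now read in the opposite direction: `q` attains the supremum defining the
    -- potential at `grad Φ q`.
    have hb : bff θ (S H θ Ψ q) = grad Φ q := by
      rw [hs.2.2]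
      exact bff_invFunOn hm
    rw [(T_eq_grad ha hl hθ h.1 hr.1 hr.2.1 hr.2.2.1).2]
    refine grad_conj_eq hK hmax.cont hr.2.2.1 (subset_closure hq) ?_
    have h1 := (grad_conj_mem hX (srcRect_nonempty hr₀ hH ha) hp.continuousOn hd).2
    have h2 := eq_conj_of_mem_U₀ hr₀ hH ha (hθ.lt hH) hl h.1 (discPlus_subset hq)
    rw [hb, dot_comm]
    change pot l Ψ (grad Φ q) ≤ _
    linarith

end Inverse

/-! ### Uniqueness of the potentials -/

/-- Two functions on a convex set with common subgradients differ by a constant. -/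
lemma sub_le_sub_of_common_subgradient {O : Set (ℝ × ℝ)} (hO : Convex ℝ O) {f g : ℝ × ℝ → ℝ}
    (h : ∀ q ∈ O, ∃ x, ∀ q' ∈ O, dot x q' - f q' ≤ dot x q - f q ∧
      dot x q' - g q' ≤ dot x q - g q) {q q' : ℝ × ℝ} (hq : q ∈ O) (hq' : q' ∈ O) :
    g q - f q ≤ g q' - f q' := by
  choose! ξ hξ using h
  set v := q' - q with hv
  set B := dot (ξ q') v - dot (ξ q) v with hB
  have key : ∀ N : ℕ, 0 < N → (g q - f q) - (g q' - f q') ≤ B / N := by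
    intro N hN
    have hN' : (0 : ℝ) < N := Nat.cast_pos.2 hN
    let c : ℕ → ℝ × ℝ := fun i => q + ((i : ℝ) / N) • v
    have hc : ∀ i ≤ N, c i ∈ O := fun i hi =>
      hO.add_smul_sub_mem hq hq' ⟨by positivity,
        (div_le_one hN').2 (Nat.cast_le.2 hi)⟩
    have hc0 : c 0 = q := by simp [c]
    have hcN : c N = q' := by
      simp [c, hv, div_self hN'.ne']
    have hstep : ∀ (x : ℝ × ℝ) (i : ℕ), dot x (c (i + 1)) - dot x (c i) = dot x v / N := by
      intro x i
      simp only [c, dot, Prod.fst_add, Prod.snd_add, Prod.smul_fst, Prod.smul_snd, smul_eq_mul,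
        Nat.cast_add, Nat.cast_one]
      ring
    -- On each of the `N` equal steps, `g` is estimated with its subgradient at the left end and `f`
    -- with its subgradient at the right end. The errors telescope, and their sum is at most `B /
    -- N`.
    have hind : ∀ i ≤ N, (g q - f q) - (g (c i) - f (c i)) ≤
        (dot (ξ (c i)) v - dot (ξ q) v) / N := by
      intro i
      induction i with
      | zero => intro _; rw [hc0]; simp
      | succ i ih =>
        intro hi
        have h1 := ih (by omega)
        have h2 := (hξ _ (hc i (by omega)) _ (hc (i + 1) hi)).2
        have h3 := (hξ _ (hc (i + 1) hi) _ (hc i (by omega))).1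
        have h4 := hstep (ξ (c i)) i
        have h5 := hstep (ξ (c (i + 1))) i
        rw [sub_div] at h1 ⊢
        linarith
    have := hind N le_rfl
    rwa [hcN] at this
  have hlim : Tendsto (fun N : ℕ => B / N) atTop (𝓝 0) := tendsto_const_div_atTop_nhds_zero_nat B
  have := ge_of_tendsto hlim ((eventually_gt_atTop 0).mono key)
  linarith

lemma convex_discPlus (l : ℝ) : Convex ℝ (discPlus l) := by
  refine Convex.inter ?_ ((convex_Ioi 0).prod (convex_Ioi 0))
  intro x hx y hy s t hs ht hst
  change x.1 ^ 2 + x.2 ^ 2 < l ^ 2 at hx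
  change y.1 ^ 2 + y.2 ^ 2 < l ^ 2 at hy
  change (s * x.1 + t * y.1) ^ 2 + (s * x.2 + t * y.2) ^ 2 < l ^ 2
  obtain rfl : t = 1 - s := by linarith
  have e : ∀ u w : ℝ, (s * u + (1 - s) * w) ^ 2 =
      s * u ^ 2 + (1 - s) * w ^ 2 - s * (1 - s) * (u - w) ^ 2 := fun u w => by ring
  rw [e, e]
  have h1 := mul_nonneg (mul_nonneg hs ht) (sq_nonneg (x.1 - y.1))
  have h2 := mul_nonneg (mul_nonneg hs ht) (sq_nonneg (x.2 - y.2))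
  have h3 : s * (x.1 ^ 2 + x.2 ^ 2) + (1 - s) * (y.1 ^ 2 + y.2 ^ 2) < l ^ 2 := by
    rcases hs.eq_or_lt with h0 | h0
    · rw [← h0]
      linarith
    · nlinarith [mul_lt_mul_of_pos_left hx h0, mul_le_mul_of_nonneg_left hy.le ht]
  linarith

section Unique

variable {r₀ Ω H a b l : ℝ} {θ : ℝ → ℝ} {σ : Measure (ℝ × ℝ)} {ψ χ : ℝ × ℝ → ℝ}
  {P P' : ℝ × ℝ → ℝ → ℝ} {Ψ Ψ' : ℝ × ℝ → ℝ}

lemma pot_add_const (hl : 0 < l) (hψ : ContinuousOn ψ (closure (discPlus l)))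
    (hχ : ContinuousOn χ (closure (discPlus l))) {k : ℝ}
    (h : ∀ q ∈ closure (discPlus l), χ q = ψ q + k) (x : ℝ × ℝ) :
    pot l χ x = pot l ψ x - k := by
  have hK := isCompact_closure_discPlus hl
  have hne := closure_discPlus_nonempty hl
  have h1 := conj_le_conj_add (x := x) hK hne hψ (χ := χ) (δ := -k) fun q hq => by
    rw [h q hq]; linarith
  have h2 := conj_le_conj_add (x := x) hK hne hχ (χ := ψ) (δ := k) fun q hq => (h q hq).le
  unfold pot
  linarith

/-- The set of target points at which both pairs of potentials are in contact with a common source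
point. -/
def commonContact (X Y : Set (ℝ × ℝ)) (p p' ψ ψ' : ℝ × ℝ → ℝ) : Set (ℝ × ℝ) :=
  {q ∈ Y | ∃ x ∈ X, p x + ψ q = dot x q ∧ p' x + ψ' q = dot x q}

/-- It is the projection of a compact set of contact pairs. Closedness allows passage from
`σ`-almost every point to the whole support. -/
lemma isClosed_commonContact {X Y : Set (ℝ × ℝ)} (hX : IsCompact X) (hY : IsCompact Y)
    {p p' : ℝ × ℝ → ℝ} (hp : Continuous p) (hp' : Continuous p') (hψ : ContinuousOn ψ Y)
    (hχ : ContinuousOn χ Y) : IsClosed (commonContact X Y p p' ψ χ) := by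
  have hc : ∀ {p ψ : ℝ × ℝ → ℝ}, Continuous p → ContinuousOn ψ Y →
      ContinuousOn (fun z : (ℝ × ℝ) × (ℝ × ℝ) => p z.1 + ψ z.2 - dot z.1 z.2) (X ×ˢ Y) := by
    intro p ψ hp hψ
    exact ((hp.comp continuous_fst).continuousOn.add
      (hψ.comp continuousOn_snd fun z hz => hz.2)).sub continuous_dot.continuousOn
  have hcl := ((hc hp hψ).prodMk (hc hp' hχ)).preimage_isClosed_of_isClosed
    (hX.prod hY).isClosed (isClosed_singleton (x := ((0 : ℝ), (0 : ℝ))))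
  have hK := ((hX.prod hY).of_isClosed_subset hcl inter_subset_left).image continuous_snd
  convert hK.isClosed using 1
  ext q
  constructor
  · rintro ⟨hq, x, hx, h1, h2⟩
    refine ⟨(x, q), ⟨⟨hx, hq⟩, ?_⟩, rfl⟩
    exact Prod.ext (sub_eq_zero.2 h1) (sub_eq_zero.2 h2)
  · rintro ⟨⟨x, q⟩, ⟨⟨hx, hq⟩, h⟩, rfl⟩
    exact ⟨hq, x, hx, sub_eq_zero.1 (congrArg Prod.fst h), sub_eq_zero.1 (congrArg Prod.snd h)⟩

variable (hr₀ : 0 < r₀) (hΩ : 0 < Ω) (ha : 0 < a) (hl : 0 < l) (hθ : IsAmbient H a b θ)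

include hr₀ hΩ ha hl hθ

lemma mu_lo_eq [IsProbabilityMeasure σ] (hσ : σ (discPlus l)ᶜ = 0)
    (hψ : IsMaxDual r₀ Ω H l θ σ ψ) (hχ : IsMaxDual r₀ Ω H l θ σ χ) :
    mu r₀ Ω H (lo r₀ Ω θ (pot l χ)) = mu r₀ Ω H (lo r₀ Ω θ (pot l ψ)) := by
  refine mu_congr ?_
  have h0 : ∀ᵐ z ∂(volume.restrict (Icc 0 H)), z ≠ 0 := ae_restrict_of_ae (Measure.ae_ne volume 0)
  filter_upwards [ae_restrict_mem measurableSet_Icc, h0] with z hz hz0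
  exact lo_eq_lo hr₀ hΩ ha hl hθ hσ hχ hψ ⟨lt_of_le_of_ne hz.1 hz0.symm, hz.2⟩

/-- The optimal map of one maximizer realizes the contact of any other one. -/
lemma ae_contact [IsProbabilityMeasure σ] (hσ : σ (discPlus l)ᶜ = 0)
    (hψ : IsMaxDual r₀ Ω H l θ σ ψ) (hχ : IsMaxDual r₀ Ω H l θ σ χ) :
    ∀ᵐ x ∂(mu r₀ Ω H (lo r₀ Ω θ (pot l ψ))),
      pot l ψ (bff θ x) + ψ (grad (pot l ψ) (bff θ x)) =
        dot (bff θ x) (grad (pot l ψ) (bff θ x)) ∧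
      pot l χ (bff θ x) + χ (grad (pot l ψ) (bff θ x)) =
        dot (bff θ x) (grad (pot l ψ) (bff θ x)) := by
  have hR := lo_mem_R₀ hr₀ hΩ ha hl hθ hσ hψ
  have hprob := hR.2
  have hmap := map_grad_eq hr₀ hΩ ha hl hθ hσ hψ
  have hmu := mu_lo_eq hr₀ hΩ ha hl hθ hσ hψ hχ
  have hK := isCompact_closure_discPlus hl
  obtain ⟨S, hc⟩ := exists_isCap_pot (l := l) hr₀ hΩ H a ψ
  obtain ⟨S', hc'⟩ := exists_isCap_pot (l := l) hr₀ hΩ H a χ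
  have hp := isPotential_pot hl hψ.cont
  have hp' := isPotential_pot hl hχ.cont
  have hreg := ae_regular hr₀ hΩ ha hl hθ hσ hψ
  have c1 := (integral_cost_lo hr₀ hΩ ha hθ hp hc).2
  have c2 := (integral_cost_lo hr₀ hΩ ha hθ hp' hc').2
  have hf := integrable_f₀_of_le hr₀ hΩ hR.1 hc.mem fun _ hz => lo_le_cap hr₀ hΩ ha hθ hp hc hz
  rw [hmu] at c2
  set M := mu r₀ Ω H (lo r₀ Ω θ (pot l ψ)) with hM
  have hGm : AEMeasurable (fun x => grad (pot l ψ) (bff θ x)) M :=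
    (measurable_grad _).comp_aemeasurable (aemeasurable_bff hθ ha)
  have i1 : Integrable (fun x => pot l ψ (bff θ x)) M :=
    integrable_comp_bff hθ ha hR.1 hp.continuous
  have i2 : Integrable (fun x => pot l χ (bff θ x)) M :=
    integrable_comp_bff hθ ha hR.1 hp'.continuous
  have hint : ∀ {ψ' : ℝ × ℝ → ℝ}, ContinuousOn ψ' (closure (discPlus l)) →
      Integrable (fun x => ψ' (grad (pot l ψ) (bff θ x))) M ∧
        ∫ x, ψ' (grad (pot l ψ) (bff θ x)) ∂M = ∫ q, ψ' q ∂σ := by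
    intro ψ' h'
    have hi := integrable_of_continuousOn hl hσ h'
    rw [← hmap] at hi ⊢
    exact ⟨hi.comp_aemeasurable hGm, (integral_map hGm hi.aestronglyMeasurable).symm⟩
  obtain ⟨j1, e1⟩ := hint hψ.cont
  obtain ⟨j2, e2⟩ := hint hχ.cont
  have hJ := le_antisymm (hψ.le χ hχ.cont) (hχ.le ψ hψ.cont)
  unfold dualJ at hJ
  rw [integral_sub hf i1] at c1
  rw [integral_sub hf i2] at c2
  have h0 : ∀ᵐ x ∂M, pot l ψ (bff θ x) + ψ (grad (pot l ψ) (bff θ x)) =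
      dot (bff θ x) (grad (pot l ψ) (bff θ x)) := by
    filter_upwards [hreg] with x hx
    have h1 := (grad_conj_mem hK (closure_discPlus_nonempty hl) hψ.cont hx.2.2.1).2
    change pot l ψ (bff θ x) =
      dot (bff θ x) (grad (pot l ψ) (bff θ x)) - ψ (grad (pot l ψ) (bff θ x)) at h1
    linarith
  have hnn : 0 ≤ᵐ[M] fun x => (pot l χ (bff θ x) + χ (grad (pot l ψ) (bff θ x))) -
      (pot l ψ (bff θ x) + ψ (grad (pot l ψ) (bff θ x))) := by
    filter_upwards [hreg, h0] with x hx h1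
    have h2 : _ ≤ pot l χ (bff θ x) :=
      le_conj (x := bff θ x) hK hχ.cont (subset_closure hx.2.2.2.1)
    change 0 ≤ _ - _
    rw [h1]
    linarith
  have k1 : Integrable (fun x => pot l ψ (bff θ x) + ψ (grad (pot l ψ) (bff θ x))) M := i1.add j1
  have k2 : Integrable (fun x => pot l χ (bff θ x) + χ (grad (pot l ψ) (bff θ x))) M := i2.add j2
  -- By the transport identity and the equality of the two layers, this nonnegative function
  -- integrates to the difference of two maximal dual values, which is zero.
  have hz : ∫ x, ((pot l χ (bff θ x) + χ (grad (pot l ψ) (bff θ x))) -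
      (pot l ψ (bff θ x) + ψ (grad (pot l ψ) (bff θ x)))) ∂M = 0 := by
    rw [integral_sub k2 k1, integral_add i2 j2, integral_add i1 j1, e1, e2]
    linarith
  filter_upwards [(integral_eq_zero_iff_of_nonneg_ae hnn (k2.sub k1)).1 hz, h0] with x hx h1
  exact ⟨h1, (sub_eq_zero.1 hx).trans h1⟩

/-- A closed set of full measure contains the support, which here is the whole closed quarter disc.
-/
lemma exists_common_contact [IsProbabilityMeasure σ] (hσ : σ (discPlus l)ᶜ = 0)
    (hsupp : σ.support = closure (discPlus l))
    (hψ : IsMaxDual r₀ Ω H l θ σ ψ) (hχ : IsMaxDual r₀ Ω H l θ σ χ) {q : ℝ × ℝ}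
    (hq : q ∈ closure (discPlus l)) :
    ∃ x, pot l ψ x + ψ q = dot x q ∧ pot l χ x + χ q = dot x q := by
  have hmap := map_grad_eq hr₀ hΩ ha hl hθ hσ hψ
  have hGm : AEMeasurable (fun x => grad (pot l ψ) (bff θ x))
      (mu r₀ Ω H (lo r₀ Ω θ (pot l ψ))) :=
    (measurable_grad _).comp_aemeasurable (aemeasurable_bff hθ ha)
  have hcl := isClosed_commonContact (isCompact_srcRect r₀ H a) (isCompact_closure_discPlus hl)
    (isPotential_pot hl hψ.cont).continuous (isPotential_pot hl hχ.cont).continuous hψ.cont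
    hχ.cont
  have hae : ∀ᵐ q ∂σ, q ∈ commonContact (srcRect r₀ H a) (closure (discPlus l)) (pot l ψ)
      (pot l χ) ψ χ := by
    rw [← hmap]
    refine (ae_map_iff hGm hcl.measurableSet).2 ?_
    filter_upwards [ae_contact hr₀ hΩ ha hl hθ hσ hψ hχ, ae_regular hr₀ hΩ ha hl hθ hσ hψ]
      with x hx hr
    exact ⟨subset_closure hr.2.2.2.1, bff θ x, hr.2.2.2.2, hx.1, hx.2⟩
  rw [← hsupp] at hq
  obtain ⟨-, x, -, hx⟩ := Measure.support_subset_of_isClosed hcl hae hq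
  exact ⟨x, hx⟩

/-- If the support of `σ` is full, the reduced dual functional has only one maximizer. -/
lemma eq_of_isMaxDual [IsProbabilityMeasure σ] (hσ : σ (discPlus l)ᶜ = 0)
    (hsupp : σ.support = closure (discPlus l))
    (hψ : IsMaxDual r₀ Ω H l θ σ ψ) (hχ : IsMaxDual r₀ Ω H l θ σ χ) :
    (∀ q ∈ closure (discPlus l), χ q = ψ q) ∧ ∀ x, pot l χ x = pot l ψ x := by
  have hK := isCompact_closure_discPlus hl
  have hsub : ∀ q ∈ discPlus l, ∃ x, ∀ q' ∈ discPlus l,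
      dot x q' - ψ q' ≤ dot x q - ψ q ∧ dot x q' - χ q' ≤ dot x q - χ q := by
    intro q hq
    obtain ⟨x, h1, h2⟩ := exists_common_contact hr₀ hΩ ha hl hθ hσ hsupp hψ hχ (subset_closure hq)
    refine ⟨x, fun q' hq' => ⟨?_, ?_⟩⟩
    · have : _ ≤ pot l ψ x := le_conj (x := x) hK hψ.cont (subset_closure hq')
      linarith
    · have : _ ≤ pot l χ x := le_conj (x := x) hK hχ.cont (subset_closure hq')
      linarith
  obtain ⟨q₀, hq₀⟩ := closure_nonempty_iff.1 (closure_discPlus_nonempty hl)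
  have hk : ∀ q ∈ closure (discPlus l), χ q = ψ q + (χ q₀ - ψ q₀) := by
    have : EqOn χ (fun q => ψ q + (χ q₀ - ψ q₀)) (closure (discPlus l)) := by
      refine EqOn.of_subset_closure (s := discPlus l) (fun q hq => ?_) hχ.cont
        (hψ.cont.add continuousOn_const) subset_closure Subset.rfl
      have h1 := sub_le_sub_of_common_subgradient (convex_discPlus l) hsub hq hq₀
      have h2 := sub_le_sub_of_common_subgradient (convex_discPlus l) hsub hq₀ hq
      linarith
    exact this
  have hpot := pot_add_const hl hψ.cont hχ.cont hk
  have hR := lo_mem_R₀ hr₀ hΩ ha hl hθ hσ hψ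
  have hprob := hR.2
  obtain ⟨x, hx, hx1, hx2⟩ := (ae_interior (Ω := Ω) hR.1).exists
  have hz : x.2 ∈ Ioc 0 H := ⟨hx.1, hx.2.le⟩
  have hz' : x.2 ∈ Icc 0 H := ⟨hx.1.le, hx.2.le⟩
  have hpos := hx1.trans hx2
  have hlo := lo_eq_lo hr₀ hΩ ha hl hθ hσ hψ hχ hz
  obtain ⟨S, hc⟩ := exists_isCap_pot (l := l) hr₀ hΩ H a ψ
  obtain ⟨S', hc'⟩ := exists_isCap_pot (l := l) hr₀ hΩ H a χ
  have hp := isPotential_pot hl hψ.cont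
  have hp' := isPotential_pot hl hχ.cont
  -- At a height where the common least depth is positive, both potentials take the value of `f₀` at
  -- that depth, so the additive constant is zero.
  have e1 := eq_f₀_of_mem_argmins hr₀ hΩ (hp.continuous_slice _)
    (lo_mem hr₀ hΩ ha hθ hp hc hz') hpos
  have e2 := eq_f₀_of_mem_argmins hr₀ hΩ (hp'.continuous_slice _)
    (lo_mem hr₀ hΩ ha hθ hp' hc' hz') (hlo ▸ hpos)
  rw [← hlo, e1] at e2
  have e3 := hpot (lo r₀ Ω θ (pot l ψ) x.2, phi θ x.2)
  have hk0 : χ q₀ - ψ q₀ = 0 := by linarith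
  rw [hk0] at hk hpot
  exact ⟨fun q hq => by rw [hk q hq, add_zero], fun x => by rw [hpot, sub_zero]⟩

lemma IsDualMaximizer.eq_of_J_eq [IsProbabilityMeasure σ] (hH : 0 < H)
    (hσ : σ (discPlus l)ᶜ = 0) (hsupp : σ.support = closure (discPlus l))
    (h : IsDualMaximizer r₀ Ω H a b l θ σ (P, Ψ)) (h' : (P', Ψ') ∈ U₀ r₀ H a b l)
    (hJ : J r₀ Ω H θ σ (P, Ψ) = J r₀ Ω H θ σ (P', Ψ')) :
    (∀ p ∈ W r₀ H, ∀ m ∈ Ioo a b, P' p m = P p m) ∧ ∀ q ∈ discPlus l, Ψ' q = Ψ q := by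
  have h2 : IsDualMaximizer r₀ Ω H a b l θ σ (P', Ψ') := ⟨h', fun y hy => (h.2 hy).trans_eq hJ⟩
  obtain ⟨e1, e2⟩ := eq_of_isMaxDual hr₀ hΩ ha hl hθ hσ hsupp
    (h.isMaxDual hr₀ hΩ ha hl hθ hH hσ) (h2.isMaxDual hr₀ hΩ ha hl hθ hH hσ)
  refine ⟨fun p hp m hm => ?_, fun q hq => e1 q (subset_closure hq)⟩
  rw [eq_pot_of_mem_U₀ hl h' hp hm, eq_pot_of_mem_U₀ hl h.1 hp hm, e2]

end Unique

/-! ### Regularity of the free boundary -/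

section Regularity

variable {r₀ Ω H a b l : ℝ} {θ : ℝ → ℝ} {σ : Measure (ℝ × ℝ)} {ψ : ℝ × ℝ → ℝ}
  {P : ℝ × ℝ → ℝ → ℝ} {Ψ : ℝ × ℝ → ℝ}

/-- At a point where `∂_z P ≥ b₀`, the potential grows at least at the rate `a b₀` in its second
variable. -/
lemma pot_add_le_of_le_deriv (ha : 0 < a) (hl : 0 < l) (h : (P, Ψ) ∈ U₀ r₀ H a b l) {b₀ : ℝ}
    (hb₀ : 0 < b₀) {s z m : ℝ} (hs : s ∈ Ico 0 (1 / (2 * r₀ ^ 2))) (hz : z ∈ Ioo 0 H)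
    (hm : m ∈ Ioo a b) (hd : b₀ ≤ deriv (fun z => P (s, z) m) z) {t : ℝ} (ht : 0 ≤ t) :
    b₀ * a * t ≤ pot l Ψ (s, z / m + t) - pot l Ψ (s, z / m) := by
  have hm0 : 0 < m := ha.trans hm.1
  have hK := isCompact_closure_discPlus hl
  have hψ := continuousOn_of_mem_U₀ hl h
  obtain ⟨q, hq, hqe, -⟩ := exists_conj_eq hK (closure_discPlus_nonempty hl) hψ (s, z / m)
  change pot l Ψ (s, z / m) = _ at hqe
  have hsub : ∀ y, dot y q - Ψ q ≤ pot l Ψ y := fun y => le_conj hK hψ hq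
  -- Where the derivative fails to exist, `deriv` is zero, which is excluded by `b₀ > 0`.
  have hdiff : DifferentiableAt ℝ (fun z => P (s, z) m) z := by
    by_contra hc
    rw [deriv_zero_of_not_differentiableAt hc] at hd
    exact absurd hd hb₀.not_ge
  -- A maximizing `q` supports the potential from below, so the derivative of `P` in `z` equals `q.2
  -- / m`. Hence `q.2` is at least `b₀ * a`, and the same supporting plane gives the growth for all
  -- `t ≥ 0`.
  have hmin : IsLocalMin (fun y => P (s, y) m - y * (q.2 / m)) z := by
    filter_upwards [isOpen_Ioo.mem_nhds hz] with y hy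
    rw [eq_pot_of_mem_U₀ hl h (p := (s, z)) ⟨hs, hz.1.le, hz.2.le⟩ hm,
      eq_pot_of_mem_U₀ hl h (p := (s, y)) ⟨hs, hy.1.le, hy.2.le⟩ hm]
    have := hsub (s, y / m)
    dsimp only
    rw [hqe]
    unfold dot at this ⊢
    dsimp only at this ⊢
    have e1 : y * (q.2 / m) = y / m * q.2 := by ring
    have e2 : z * (q.2 / m) = z / m * q.2 := by ring
    rw [e1, e2]
    linarith
  have h0 := hmin.hasDerivAt_eq_zero (hdiff.hasDerivAt.sub ((hasDerivAt_id z).mul_const (q.2 / m)))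
  have hq2 : b₀ * a ≤ q.2 := by
    have h1 : b₀ ≤ q.2 / m := by linarith
    rw [le_div_iff₀ hm0] at h1
    exact (mul_le_mul_of_nonneg_left hm.1.le hb₀.le).trans h1
  have h2 := hsub (s, z / m + t)
  have h3 := mul_le_mul_of_nonneg_right hq2 ht
  unfold dot at hqe h2
  dsimp only at hqe h2
  rw [hqe]
  linarith

/-- Unlike the derivative bound, the growth estimate is a closed condition on continuous functions.
The set where it fails is open and null in the interior, hence empty; the end heights follow by
continuity. -/
lemma pot_add_le (ha : 0 < a) (hl : 0 < l) (h : (P, Ψ) ∈ U₀ r₀ H a b l) (hH : 0 < H) {b₀ : ℝ}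
    (hb₀ : 0 < b₀)
    (hd : ∀ᵐ x ∂((volume : Measure ((ℝ × ℝ) × ℝ)).restrict (W r₀ H ×ˢ Ioo a b)),
      b₀ ≤ deriv (fun z => P (x.1.1, z) x.2) x.1.2) {s z m t : ℝ}
    (hs : s ∈ Ioo 0 (1 / (2 * r₀ ^ 2))) (hz : z ∈ Icc 0 H) (hm : m ∈ Ioo a b) (ht : 0 ≤ t) :
    b₀ * a * t ≤ pot l Ψ (s, z / m + t) - pot l Ψ (s, z / m) := by
  have hp := (isPotential_pot hl (continuousOn_of_mem_U₀ hl h)).continuous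
  set O : Set ((ℝ × ℝ) × ℝ) := (Ioo 0 (1 / (2 * r₀ ^ 2)) ×ˢ Ioo 0 H) ×ˢ Ioo a b with hO
  have hOo : IsOpen O := (isOpen_Ioo.prod isOpen_Ioo).prod isOpen_Ioo
  have hOW : O ⊆ W r₀ H ×ˢ Ioo a b :=
    prod_mono (prod_mono Ioo_subset_Ico_self Ioo_subset_Icc_self) Subset.rfl
  have hd' := (ae_restrict_iff' hOo.measurableSet).1 (ae_restrict_of_ae_restrict_of_subset hOW hd)
  have hc : ContinuousOn (fun x : (ℝ × ℝ) × ℝ =>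
      pot l Ψ (x.1.1, x.1.2 / x.2 + t) - pot l Ψ (x.1.1, x.1.2 / x.2)) O := by
    have h1 : ContinuousOn (fun x : (ℝ × ℝ) × ℝ => x.1.2 / x.2) O :=
      ContinuousOn.div (by fun_prop) (by fun_prop) fun x hx => (ha.trans hx.2.1).ne'
    exact (hp.comp_continuousOn (ContinuousOn.prodMk (by fun_prop) (h1.add continuousOn_const))).sub
      (hp.comp_continuousOn (ContinuousOn.prodMk (by fun_prop) h1))
  have hF := hc.isOpen_inter_preimage hOo (isOpen_Iio (a := b₀ * a * t))
  have hF0 := (hF.measure_eq_zero_iff volume).1 <| measure_eq_zero_iff_ae_notMem.2 <| by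
    filter_upwards [hd'] with x hx' hx
    exact absurd hx.2 (not_lt.2 (pot_add_le_of_le_deriv ha hl h hb₀
      ⟨hx.1.1.1.1.le, hx.1.1.1.2⟩ hx.1.1.2 hx.1.2 (hx' hx.1) ht))
  have hcl : IsClosed {z | b₀ * a * t ≤ pot l Ψ (s, z / m + t) - pot l Ψ (s, z / m)} :=
    isClosed_le continuous_const ((hp.comp (by fun_prop)).sub (hp.comp (by fun_prop)))
  have hsub : Ioo 0 H ⊆ {z | b₀ * a * t ≤ pot l Ψ (s, z / m + t) - pot l Ψ (s, z / m)} := by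
    intro y hy
    by_contra hlt
    rw [Set.mem_ofPred_eq, not_le] at hlt
    have hmem : ((s, y), m) ∈ O := ⟨⟨hs, hy⟩, hm⟩
    exact eq_empty_iff_forall_notMem.1 hF0 _ ⟨hmem, hlt⟩
  have := closure_minimal hsub hcl
  rw [closure_Ioo hH.ne] at this
  exact this hz

lemma phi_sub_ge (hθ : IsAmbient H a b θ) (ha : 0 < a) {ε : ℝ} (hε : 0 < ε)
    (hA : ∀ z ∈ Ioo 0 H, ε ≤ θ z - z * deriv θ z) {z₁ z₂ : ℝ} (h₁ : z₁ ∈ Icc 0 H)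
    (h₂ : z₂ ∈ Icc 0 H) (h : z₁ ≤ z₂) : ε / b ^ 2 * (z₂ - z₁) ≤ phi θ z₂ - phi θ z₁ := by
  refine Convex.mul_sub_le_image_sub_of_le_deriv (convex_Icc 0 H) (continuousOn_phi hθ ha)
    ?_ ?_ z₁ h₁ z₂ h₂ h
  · rw [interior_Icc]
    exact fun z hz => (hasDerivAt_phi hθ ha hz).differentiableAt.differentiableWithinAt
  · rw [interior_Icc]
    intro z hz
    have hz' : z ∈ Icc 0 H := ⟨hz.1.le, hz.2.le⟩
    have h0 := hθ.pos ha hz'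
    rw [(hasDerivAt_phi hθ ha hz).deriv]
    exact div_le_div₀ (hε.le.trans (hA z hz)) (hA z hz) (by positivity)
      (pow_le_pow_left₀ h0.le (hθ.mapsTo hz').2.le 2)

lemma f₀_sub_le (hr₀ : 0 < r₀) {S s t : ℝ} (hS : S < 1 / (2 * r₀ ^ 2)) (hst : s ≤ t)
    (htS : t ≤ S) :
    f₀ r₀ Ω t - f₀ r₀ Ω s ≤ r₀ ^ 4 * Ω ^ 2 / (1 - 2 * r₀ ^ 2 * S) ^ 2 * (t - s) := by
  have hu := one_sub_pos hr₀ hS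
  have hut := one_sub_pos hr₀ (htS.trans_lt hS)
  have hus := one_sub_pos hr₀ ((hst.trans htS).trans_lt hS)
  have e : f₀ r₀ Ω t - f₀ r₀ Ω s =
      r₀ ^ 4 * Ω ^ 2 / ((1 - 2 * r₀ ^ 2 * t) * (1 - 2 * r₀ ^ 2 * s)) * (t - s) := by
    have n1 := hut.ne'
    have n2 := hus.ne'
    unfold f₀
    rw [div_sub_div _ _ (by positivity) (by positivity), div_mul_eq_mul_div,
      div_eq_div_iff (by positivity) (by positivity)]
    ring
  have hr2 : 0 ≤ 2 * r₀ ^ 2 := by positivity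
  have h1 : 1 - 2 * r₀ ^ 2 * S ≤ 1 - 2 * r₀ ^ 2 * t :=
    sub_le_sub_left (mul_le_mul_of_nonneg_left htS hr2) _
  have h2 : 1 - 2 * r₀ ^ 2 * S ≤ 1 - 2 * r₀ ^ 2 * s :=
    sub_le_sub_left (mul_le_mul_of_nonneg_left (hst.trans htS) hr2) _
  rw [e]
  refine mul_le_mul_of_nonneg_right ?_ (sub_nonneg.2 hst)
  refine div_le_div_of_nonneg_left (by positivity) (by positivity) ?_
  rw [sq]
  exact mul_le_mul h1 h2 hu.le hut.le

/-- For depths `ϱ₁ ≤ ϱ₂` at heights `z₁ ≤ z₂`, the free boundary equation and monotonicity in `s`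
bound the increment of the potential in `ζ` at depth `ϱ₁` by `f₀ ϱ₂ - f₀ ϱ₁`. The former is at least
`b₀ a (φ z₂ - φ z₁)`, where `φ' ≥ ε/b²` by (A1'). The latter is at most a multiple of `ϱ₂ - ϱ₁`,
since `f₀` is Lipschitz below the cap. -/
lemma exists_bound_free_boundary (hr₀ : 0 < r₀) (hΩ : 0 < Ω) (hH : 0 < H) (ha : 0 < a)
    (hl : 0 < l) (hθ : IsAmbient H a b θ) (hA : CondA1' H θ) (h : (P, Ψ) ∈ U₀ r₀ H a b l) {b₀ : ℝ}
    (hb₀ : 0 < b₀)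
    (hd : ∀ᵐ x ∂((volume : Measure ((ℝ × ℝ) × ℝ)).restrict (W r₀ H ×ˢ Ioo a b)),
      b₀ ≤ deriv (fun z => P (x.1.1, z) x.2) x.1.2) :
    ∃ C > 0, ∀ z₁ ∈ Icc 0 H, ∀ z₂ ∈ Icc 0 H, 0 < lo r₀ Ω θ (pot l Ψ) z₁ →
      0 < lo r₀ Ω θ (pot l Ψ) z₂ →
      |z₂ - z₁| ≤ C * |lo r₀ Ω θ (pot l Ψ) z₂ - lo r₀ Ω θ (pot l Ψ) z₁| := by
  obtain ⟨ε, hε, hA⟩ := hA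
  obtain ⟨S, hc⟩ := exists_isCap_pot (l := l) hr₀ hΩ H a Ψ
  have hp := isPotential_pot hl (continuousOn_of_mem_U₀ hl h)
  have hu := one_sub_pos hr₀ hc.mem.2
  have hb : 0 < b := by
    have := hθ.mapsTo (left_mem_Icc.2 hH.le)
    exact ha.trans (this.1.trans this.2)
  set L := r₀ ^ 4 * Ω ^ 2 / (1 - 2 * r₀ ^ 2 * S) ^ 2 with hL
  have hL0 : 0 < L := by positivity
  have hc0 : 0 < b₀ * a * (ε / b ^ 2) := by positivity
  refine ⟨L / (b₀ * a * (ε / b ^ 2)), div_pos hL0 hc0, ?_⟩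
  have key : ∀ z₁ ∈ Icc 0 H, ∀ z₂ ∈ Icc 0 H, 0 < lo r₀ Ω θ (pot l Ψ) z₁ →
      0 < lo r₀ Ω θ (pot l Ψ) z₂ → z₁ ≤ z₂ →
      |z₂ - z₁| ≤ L / (b₀ * a * (ε / b ^ 2)) *
        |lo r₀ Ω θ (pot l Ψ) z₂ - lo r₀ Ω θ (pot l Ψ) z₁| := by
    intro z₁ h₁ z₂ h₂ hpos₁ hpos₂ hzz
    have hm := lo_monotoneOn hr₀ hΩ ha hθ hp hc h₁ h₂ hzz
    have m₁ := lo_mem hr₀ hΩ ha hθ hp hc h₁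
    have m₂ := lo_mem hr₀ hΩ ha hθ hp hc h₂
    have e₁ := eq_f₀_of_mem_argmins hr₀ hΩ (hp.continuous_slice _) m₁ hpos₁
    have e₂ := eq_f₀_of_mem_argmins hr₀ hΩ (hp.continuous_slice _) m₂ hpos₂
    have i1 := f₀_sub_le (Ω := Ω) hr₀ hc.mem.2 hm (lo_le_cap hr₀ hΩ ha hθ hp hc h₂)
    have i2 := phi_sub_ge hθ ha hε hA h₁ h₂ hzz
    have hφ : 0 ≤ phi θ z₂ - phi θ z₁ :=
      (mul_nonneg (by positivity) (sub_nonneg.2 hzz)).trans i2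
    have i3 := pot_add_le ha hl h hH hb₀ hd ⟨hpos₁, m₁.1.2⟩ h₁ (hθ.mapsTo h₁) hφ
    have e3 : z₁ / θ z₁ + (phi θ z₂ - phi θ z₁) = phi θ z₂ := by
      unfold phi
      ring
    rw [e3] at i3
    have i4 := hp.mono (lo r₀ Ω θ (pot l Ψ) z₁, phi θ z₂) (lo r₀ Ω θ (pot l Ψ) z₂, phi θ z₂) hm
      le_rfl
    have i5 := mul_le_mul_of_nonneg_left i2 (by positivity : 0 ≤ b₀ * a)
    change b₀ * a * (phi θ z₂ - phi θ z₁) ≤ pot l Ψ (lo r₀ Ω θ (pot l Ψ) z₁, phi θ z₂) -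
      pot l Ψ (lo r₀ Ω θ (pot l Ψ) z₁, phi θ z₁) at i3
    rw [abs_of_nonneg (sub_nonneg.2 hzz), abs_of_nonneg (sub_nonneg.2 hm), div_mul_eq_mul_div,
      le_div_iff₀ hc0]
    linarith
  intro z₁ h₁ z₂ h₂ hpos₁ hpos₂
  rcases le_total z₁ z₂ with hzz | hzz
  · exact key z₁ h₁ z₂ h₂ hpos₁ hpos₂ hzz
  · rw [abs_sub_comm, abs_sub_comm (lo r₀ Ω θ (pot l Ψ) z₂)]
    exact key z₂ h₂ z₁ h₁ hpos₂ hpos₁ hzz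

end Regularity

/-! ### The representative of the minimizer and the properties of its free boundary. -/

section Main

variable {r₀ Ω H a b l : ℝ} {θ : ℝ → ℝ} {σ : Measure (ℝ × ℝ)} {ψ : ℝ × ℝ → ℝ} {ϱ : ℝ → ℝ}
  {P : ℝ × ℝ → ℝ → ℝ} {Ψ : ℝ × ℝ → ℝ}

lemma K_congr {ϱ ϱ' : ℝ → ℝ} (hϱ : ϱ ∈ R₀ r₀ Ω H) (hϱ' : ϱ' ∈ R₀ r₀ Ω H)
    (h : mu r₀ Ω H ϱ = mu r₀ Ω H ϱ') : K r₀ Ω H θ σ ϱ = K r₀ Ω H θ σ ϱ' := by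
  unfold K
  rw [if_pos hϱ, if_pos hϱ', h]

/-- The free boundary of the potential conjugate to `ψ`, set to zero at the bottom. -/
noncomputable def boundary (r₀ Ω l : ℝ) (θ : ℝ → ℝ) (ψ : ℝ × ℝ → ℝ) (z : ℝ) : ℝ :=
  if 0 < z then lo r₀ Ω θ (pot l ψ) z else 0

variable (hr₀ : 0 < r₀) (hΩ : 0 < Ω) (hH : 0 < H) (ha : 0 < a) (hl : 0 < l)
  (hθ : IsAmbient H a b θ)

lemma boundary_eq {z : ℝ} (hz : 0 < z) : boundary r₀ Ω l θ ψ z = lo r₀ Ω θ (pot l ψ) z :=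
  if_pos hz

lemma pos_of_boundary_pos {z : ℝ} (h : 0 < boundary r₀ Ω l θ ψ z) : 0 < z := by
  by_contra hz
  rw [boundary, if_neg hz] at h
  exact lt_irrefl _ h

lemma boundary_ae_eq :
    boundary r₀ Ω l θ ψ =ᵐ[volume.restrict (Icc 0 H)] lo r₀ Ω θ (pot l ψ) := by
  have h0 : ∀ᵐ z ∂(volume.restrict (Icc 0 H)), z ≠ 0 := ae_restrict_of_ae (Measure.ae_ne volume 0)
  filter_upwards [ae_restrict_mem measurableSet_Icc, h0] with z hz hz0
  exact boundary_eq (lt_of_le_of_ne hz.1 hz0.symm)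

include hr₀ hΩ ha hl hθ

lemma boundary_mem {z : ℝ} (hψ : ContinuousOn ψ (closure (discPlus l))) (hz : z ∈ Icc 0 H) :
    boundary r₀ Ω l θ ψ z ∈ Ico 0 (1 / (2 * r₀ ^ 2)) := by
  obtain ⟨S, hc⟩ := exists_isCap_pot (l := l) hr₀ hΩ H a ψ
  unfold boundary
  split_ifs
  · exact (lo_mem hr₀ hΩ ha hθ (isPotential_pot hl hψ) hc hz).1
  · exact ⟨le_rfl, top_pos hr₀⟩

lemma boundary_monotoneOn (hψ : ContinuousOn ψ (closure (discPlus l))) :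
    MonotoneOn (boundary r₀ Ω l θ ψ) (Icc 0 H) := by
  obtain ⟨S, hc⟩ := exists_isCap_pot (l := l) hr₀ hΩ H a ψ
  intro z hz z' hz' h
  by_cases h0 : 0 < z
  · rw [boundary_eq h0, boundary_eq (h0.trans_le h)]
    exact lo_monotoneOn hr₀ hΩ ha hθ (isPotential_pot hl hψ) hc hz hz' h
  · rw [boundary, if_neg h0]
    exact (boundary_mem hr₀ hΩ ha hl hθ hψ hz').1

lemma boundary_mem_R₀ [IsProbabilityMeasure σ] (hσ : σ (discPlus l)ᶜ = 0)
    (hψ : IsMaxDual r₀ Ω H l θ σ ψ) : boundary r₀ Ω l θ ψ ∈ R₀ r₀ Ω H := by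
  refine ⟨mem_R_of_monotoneOn (boundary_monotoneOn hr₀ hΩ ha hl hθ hψ.cont)
    fun z hz => boundary_mem hr₀ hΩ ha hl hθ hψ.cont hz, ?_⟩
  rw [mu_congr boundary_ae_eq]
  exact (lo_mem_R₀ hr₀ hΩ ha hl hθ hσ hψ).2

lemma K_boundary_eq [IsProbabilityMeasure σ] (hσ : σ (discPlus l)ᶜ = 0)
    (hψ : IsMaxDual r₀ Ω H l θ σ ψ) :
    K r₀ Ω H θ σ (boundary r₀ Ω l θ ψ) = ((dualJ r₀ Ω H l θ σ ψ + m₂ σ : ℝ) : EReal) := by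
  rw [K_congr (boundary_mem_R₀ hr₀ hΩ ha hl hθ hσ hψ) (lo_mem_R₀ hr₀ hΩ ha hl hθ hσ hψ)
    (mu_congr boundary_ae_eq), K_lo_eq hr₀ hΩ ha hl hθ hσ hψ]

include hH

lemma map_T_eq [IsProbabilityMeasure σ] (hσ : σ (discPlus l)ᶜ = 0)
    (h : IsDualMaximizer r₀ Ω H a b l θ σ (P, Ψ)) :
    (∀ᵐ x ∂(mu r₀ Ω H (lo r₀ Ω θ (pot l Ψ))), DifferentiableAt ℝ (fun p' => P p' (θ x.2)) x) ∧
      (mu r₀ Ω H (lo r₀ Ω θ (pot l Ψ))).map (T θ P) = σ := by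
  have hmax := h.isMaxDual hr₀ hΩ ha hl hθ hH hσ
  have hreg : ∀ᵐ x ∂(mu r₀ Ω H (lo r₀ Ω θ (pot l Ψ))),
      DifferentiableAt ℝ (fun p' => P p' (θ x.2)) x ∧ T θ P x = grad (pot l Ψ) (bff θ x) := by
    filter_upwards [ae_regular hr₀ hΩ ha hl hθ hσ hmax] with x hx
    exact T_eq_grad ha hl hθ h.1 hx.1 hx.2.1 hx.2.2.1
  refine ⟨hreg.mono fun x hx => hx.1, ?_⟩
  rw [Measure.map_congr (hreg.mono fun x hx => hx.2)]
  exact map_grad_eq hr₀ hΩ ha hl hθ hσ hmax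

omit hH in
lemma free_boundary_eq (h : (P, Ψ) ∈ U₀ r₀ H a b l) {z : ℝ} (hz : z ∈ Icc 0 H)
    (hpos : 0 < lo r₀ Ω θ (pot l Ψ) z) :
    2 * (1 - 2 * r₀ ^ 2 * lo r₀ Ω θ (pot l Ψ) z) * P (lo r₀ Ω θ (pot l Ψ) z, z) (θ z) =
      r₀ ^ 2 * Ω ^ 2 := by
  obtain ⟨S, hc⟩ := exists_isCap_pot (l := l) hr₀ hΩ H a Ψ
  have hp := isPotential_pot hl (continuousOn_of_mem_U₀ hl h)
  have hm := lo_mem hr₀ hΩ ha hθ hp hc hz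
  have e := eq_f₀_of_mem_argmins hr₀ hΩ (hp.continuous_slice _) hm hpos
  have hu := one_sub_pos hr₀ hm.1.2
  rw [eq_pot_of_mem_U₀ hl h (p := (lo r₀ Ω θ (pot l Ψ) z, z)) ⟨hm.1, hz⟩ (hθ.mapsTo hz)]
  change _ * pot l Ψ (lo r₀ Ω θ (pot l Ψ) z, phi θ z) = _
  rw [← e]
  unfold f₀
  exact mul_div_cancel₀ _ (by positivity)

end Main

end Vortex

theorem mainTheorem2 (r₀ Ω H a b l : ℝ) (hr₀ : 0 < r₀) (hΩ : 0 < Ω) (hH : 0 < H) (ha : 0 < a)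
    (hl : 0 < l) (θ : ℝ → ℝ) (hθ : Vortex.IsAmbient H a b θ)
    (σ : Measure (ℝ × ℝ)) [IsProbabilityMeasure σ] (hσ : σ (Vortex.discPlus l)ᶜ = 0) :
    ∃ ϱ₀ ∈ Vortex.R₀ r₀ Ω H,
      -- (i): unique minimizer, monotone
      IsMinOn (Vortex.K r₀ Ω H θ σ) (Vortex.R₀ r₀ Ω H) ϱ₀ ∧
      (∀ ϱ ∈ Vortex.R₀ r₀ Ω H, IsMinOn (Vortex.K r₀ Ω H θ σ) (Vortex.R₀ r₀ Ω H) ϱ →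
        ϱ =ᵐ[volume.restrict (Icc 0 H)] ϱ₀) ∧
      MonotoneOn ϱ₀ (Icc 0 H) ∧
      -- (i): consequences for every dual maximizer
      (∀ P₀ Ψ₀, Vortex.IsDualMaximizer r₀ Ω H a b l θ σ (P₀, Ψ₀) →
        (∀ᵐ p ∂(Vortex.mu r₀ Ω H ϱ₀), DifferentiableAt ℝ (fun p' => P₀ p' (θ p.2)) p) ∧
        (Vortex.mu r₀ Ω H ϱ₀).map (Vortex.T θ P₀) = σ ∧
        Vortex.K r₀ Ω H θ σ ϱ₀
          = ((Vortex.J r₀ Ω H θ σ (P₀, Ψ₀) + Vortex.m₂ σ : ℝ) : EReal) ∧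
        (∀ z ∈ Icc 0 H, 0 < ϱ₀ z →
          2 * (1 - 2 * r₀ ^ 2 * ϱ₀ z) * P₀ (ϱ₀ z, z) (θ z) = r₀ ^ 2 * Ω ^ 2) ∧
        (σ ≪ volume →
          (∀ᵐ q ∂σ, DifferentiableAt ℝ Ψ₀ q ∧
            Vortex.dZ Ψ₀ q ∈ Vortex.phi θ '' Icc 0 H) ∧
          σ.map (Vortex.S H θ Ψ₀) = Vortex.mu r₀ Ω H ϱ₀ ∧
          (∀ᵐ p ∂(Vortex.mu r₀ Ω H ϱ₀), Vortex.S H θ Ψ₀ (Vortex.T θ P₀ p) = p) ∧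
          (∀ᵐ q ∂σ, Vortex.T θ P₀ (Vortex.S H θ Ψ₀ q) = q))) ∧
      -- (ii): uniqueness of the potentials
      (∀ c₀ > 0, σ ≪ volume →
        (∀ᵐ q ∂(volume.restrict (Vortex.discPlus l)),
          ENNReal.ofReal c₀ < σ.rnDeriv volume q) →
        σ.support = closure (Vortex.discPlus l) →
        ∀ P₀ Ψ₀ P₁ Ψ₁, Vortex.IsDualMaximizer r₀ Ω H a b l θ σ (P₀, Ψ₀) →
          (P₁, Ψ₁) ∈ Vortex.U₀ r₀ H a b l →
          Vortex.J r₀ Ω H θ σ (P₀, Ψ₀) = Vortex.J r₀ Ω H θ σ (P₁, Ψ₁) →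
          (∀ p ∈ Vortex.W r₀ H, ∀ m ∈ Ioo a b, P₁ p m = P₀ p m) ∧
          (∀ q ∈ Vortex.discPlus l, Ψ₁ q = Ψ₀ q)) ∧
      -- (iii): regularity of the free boundary
      (Vortex.CondA1' H θ → ∀ b₀ > 0, ∀ P₀ Ψ₀,
        Vortex.IsDualMaximizer r₀ Ω H a b l θ σ (P₀, Ψ₀) →
        (∀ᵐ x ∂((volume : Measure ((ℝ × ℝ) × ℝ)).restrict (Vortex.W r₀ H ×ˢ Ioo a b)),
          b₀ ≤ deriv (fun z => P₀ (x.1.1, z) x.2) x.1.2) →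
        ∃ C > 0, ∀ z₁ ∈ Icc 0 H, ∀ z₂ ∈ Icc 0 H, 0 < ϱ₀ z₁ → 0 < ϱ₀ z₂ →
          |z₂ - z₁| ≤ C * |ϱ₀ z₂ - ϱ₀ z₁|) := by
  obtain ⟨ψ, hψ⟩ := Vortex.exists_isMaxDual hr₀ hΩ hH ha hl hθ hσ
  have hR := Vortex.boundary_mem_R₀ hr₀ hΩ ha hl hθ hσ hψ
  have hKe := Vortex.K_boundary_eq hr₀ hΩ ha hl hθ hσ hψ
  -- The minimizer is built from one maximizer `ψ`, but the pointwise claims concern all of them;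
  -- equality of least depths at every height `z > 0` transfers them.
  have hlo : ∀ {P Ψ}, Vortex.IsDualMaximizer r₀ Ω H a b l θ σ (P, Ψ) → ∀ z ∈ Icc 0 H,
      0 < Vortex.boundary r₀ Ω l θ ψ z →
        Vortex.boundary r₀ Ω l θ ψ z = Vortex.lo r₀ Ω θ (Vortex.pot l Ψ) z := by
    intro P Ψ h z hz hpos
    have hz0 := Vortex.pos_of_boundary_pos hpos
    rw [Vortex.boundary_eq hz0]
    exact Vortex.lo_eq_lo hr₀ hΩ ha hl hθ hσ hψ (h.isMaxDual hr₀ hΩ ha hl hθ hH hσ) ⟨hz0, hz.2⟩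
  -- The comparison of least depths does not reach `z = 0`. The value zero there keeps the field
  -- monotone and makes the claims at positive depth vacuous at the bottom.
  refine ⟨Vortex.boundary r₀ Ω l θ ψ, hR, ?_, ?_, Vortex.boundary_monotoneOn hr₀ hΩ ha hl hθ hψ.cont,
    ?_, ?_, ?_⟩
  · intro ϱ hϱ
    rw [Set.mem_ofPred_eq, hKe]
    exact Vortex.dualJ_le_K hr₀ hΩ ha hl hθ hσ hψ.cont hϱ
  · intro ϱ hϱ hmin
    exact (Vortex.ae_eq_lo hr₀ hΩ ha hl hθ hσ hψ hϱ ((hmin hR).trans_eq hKe)).trans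
      Vortex.boundary_ae_eq.symm
  · intro P Ψ h
    have hΨ := h.isMaxDual hr₀ hΩ ha hl hθ hH hσ
    have hmu : Vortex.mu r₀ Ω H (Vortex.boundary r₀ Ω l θ ψ) =
        Vortex.mu r₀ Ω H (Vortex.lo r₀ Ω θ (Vortex.pot l Ψ)) := by
      rw [Vortex.mu_congr Vortex.boundary_ae_eq, Vortex.mu_lo_eq hr₀ hΩ ha hl hθ hσ hΨ hψ]
    rw [hmu]
    obtain ⟨h1, h2⟩ := Vortex.map_T_eq hr₀ hΩ hH ha hl hθ hσ h
    refine ⟨h1, h2, ?_, ?_, Vortex.inverse_map hr₀ hΩ hH ha hl hθ hσ h⟩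
    · rw [hKe, Vortex.J_eq_dualJ hr₀ hΩ ha hl hθ h.1,
        le_antisymm (hΨ.le ψ hψ.cont) (hψ.le Ψ hΨ.cont)]
    · intro z hz hpos
      have e := hlo h z hz hpos
      rw [e] at hpos ⊢
      exact Vortex.free_boundary_eq hr₀ hΩ ha hl hθ h.1 hz hpos
  · intro c₀ _ _ _ hsupp P₀ Ψ₀ P₁ Ψ₁ h h' hJ
    exact h.eq_of_J_eq hr₀ hΩ ha hl hθ hH hσ hsupp h' hJ
  · intro hA b₀ hb₀ P Ψ h hd
    obtain ⟨C, hC, hC'⟩ :=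
      Vortex.exists_bound_free_boundary hr₀ hΩ hH ha hl hθ hA h.1 hb₀ hd
    refine ⟨C, hC, fun z₁ h₁ z₂ h₂ hp₁ hp₂ => ?_⟩
    have e₁ := hlo h z₁ h₁ hp₁
    have e₂ := hlo h z₂ h₂ hp₂
    rw [e₁] at hp₁
    rw [e₂] at hp₂
    rw [e₁, e₂]
    exact hC' z₁ h₁ z₂ h₂ hp₁ hp₂
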